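/- Let $t\ge 2$ be an integer. Let $c_0=1$ and, for $n\ge 1$, let $c_n$ be the number of finite integer sequences $(b_1,\dots,b_l)$, $l\ge 1$, with $b_1=1$, $1\le b_i\le t\,b_{i-1}$ for $2\le i\le l$, and $b_1+\dots+b_l=n$; thus $c_n$ is the number of $t$-ary canonical rooted trees with $n$ inner vertices. Then $\sum_{n\ge 0}c_nq^n$ converges for $|q|<1/2$, and its sum extends to a meromorphic function $F(q)$ on the open unit disc. Put $r_3=1.123,\ 1.098,\ 1.083$ for $t=2,3,4$, respectively, and $$r_3=1+\frac{\log 2}{t}-\frac{\log 2-\log^2 2}{2t^2}\qquad (t\ge 5).$$ There are real numbers $\rho>\rho_2>r_3>1$ and $R,R_2>0$, depending on $t$, such that $F$ has exactly two poles in the disc $|q|\le 1/r_3$, namely $1/\rho$ and $1/\rho_2$; both are simple, with residue $-R$ at $1/\rho$ and residue $-R_2$ at $1/\rho_2$. Moreover: 1. For $t\ge 3$, $$\left|\rho-\left(2-\frac1{2^{t+1}}-\frac{t+3}{2^{2t+3}}-\frac{3t^2+19t+24}{2^{3t+6}}\right)\right|\le\frac{0.28\,t^3}{2^{4t}};$$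 for $t=2$, $|\rho-1.794147187541686|\le 10^{-15}$. 2. For $t\ge 6$, $$\left|R-\left(\frac18+\frac{t-2}{2^{t+5}}+\frac{2t^2+3t-5}{2^{2t+7}}+\frac{9t^3+45t^2+20t-68}{2^{3t+10}}\right)\right|\le\frac{t^4}{50\cdot 2^{4t}};$$ for $t=2,3,4,5$, $R$ differs by at most $10^{-16}$ from $0.1418532020854094$, $0.1338681353605138$, $0.1305243270109503$, $0.1284678647212778$, respectively. 3. For $t\ge 16$, $$\left|\rho_2-\left(1+\frac{\log 2}{t}-\frac{\log 2-\log^2 2}{2t^2}+\frac{4\log^3 2+3\log^2 2+6\log 2}{24t^3}+\frac{2\log^4 2+54\log^3 2-27\log^2 2-6\log 2}{48t^4}\right)\right|\le\frac{0.26}{t^5};$$ for $t=2,3,\dots,15$, $\rho_2$ differs by at most $10^{-15}$ from, respectively, $1.279549134726681$, $1.211479378117327$, $1.165158374565692$, $1.134459698442781$, $1.113019849812048$, $1.097324075593615$, $1.085389242111509$, $1.076032488551186$, $1.068511410911158$, $1.062339511503337$, $1.057186165846774$, $1.052819586914068$, $1.049072853620226$, $1.045822904924682$. 4. For all $t\ge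 2$, $$\left|R_2-\left(\frac1{4t}-\frac{4\log 2+1}{8t^2}\right)\right|\le\frac{0.77}{t^3}.$$ 5. $|F(q)|\le 5t^4$ for all complex $q$ with $|q|=1/r_3$. -/

import Mathlib

open Filter Topology

/-- A bounded degree sequence `(b_1, …, b_l)` for the arity `t`: `b_1 = 1` and
`1 ≤ b_i ≤ t * b_{i-1}` for `2 ≤ i ≤ l`. Such a sequence is the list of the numbers of inner
vertices at heights `0, 1, …, l - 1` of a `t`-ary canonical rooted tree, and determines the tree.
The empty sequence stands for the trivial tree (a single leaf, no inner vertex). -/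
def IsBoundedDegreeSeq (t : ℕ) (b : List ℕ) : Prop :=
  (∀ x ∈ b, 1 ≤ x) ∧ (∀ x ∈ b.head?, x = 1) ∧ b.IsChain (fun x y => y ≤ t * x)

/-- `treeCount t n` is `c_n = g_t(n)`, the number of `t`-ary canonical rooted trees with
`n` inner vertices. -/
noncomputable def treeCount (t n : ℕ) : ℕ :=
  Set.ncard {b : List ℕ | IsBoundedDegreeSeq t b ∧ b.sum = n}

/-- `F` is the generating function `∑ c_n q ^ n`, continued meromorphically to the open unit
disc. Normal form means that `F` has its analytic value at every point that is not a pole, so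
that `F` is uniquely determined on the unit disc (with value `0` at the poles). -/
def IsTreeGeneratingFunction (t : ℕ) (F : ℂ → ℂ) : Prop :=
  MeromorphicNFOn F (Metric.ball 0 1) ∧
    ∀ q : ℂ, ‖q‖ < 1 / 2 → HasSum (fun n : ℕ => (treeCount t n : ℂ) * q ^ n) (F q)

/-- `p` is a pole of `F`. -/
def IsPole (F : ℂ → ℂ) (p : ℂ) : Prop :=
  MeromorphicAt F p ∧ meromorphicOrderAt F p < 0

/-- `p` is a simple pole of `F`, and the residue of `F` at `p` is `c`. -/
def IsSimplePoleWithResidue (F : ℂ → ℂ) (p c : ℂ) : Prop :=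
  MeromorphicAt F p ∧ meromorphicOrderAt F p = ((-1 : ℤ) : WithTop ℤ) ∧
    Tendsto (fun q => (q - p) * F q) (𝓝[≠] p) (𝓝 c)

/-- The number `r_3`, whose inverse is the radius of the disc under consideration. -/
noncomputable def rThree (t : ℕ) : ℝ :=
  match t with
  | 2 => 1.123
  | 3 => 1.098
  | 4 => 1.083
  | t => 1 + Real.log 2 / t - (Real.log 2 - Real.log 2 ^ 2) / (2 * (t : ℝ) ^ 2)

/-- Numerical values of `ρ_2` for `2 ≤ t ≤ 15`. -/
noncomputable def rhoTwoTable (t : ℕ) : ℝ :=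
  match t with
  | 2 => 1.279549134726681
  | 3 => 1.211479378117327
  | 4 => 1.165158374565692
  | 5 => 1.134459698442781
  | 6 => 1.113019849812048
  | 7 => 1.097324075593615
  | 8 => 1.085389242111509
  | 9 => 1.076032488551186
  | 10 => 1.068511410911158
  | 11 => 1.062339511503337
  | 12 => 1.057186165846774
  | 13 => 1.052819586914068
  | 14 => 1.049072853620226
  | 15 => 1.045822904924682
  | _ => 0

/-- Numerical values of `R` for `2 ≤ t ≤ 5`. -/
noncomputable def resTable (t : ℕ) : ℝ :=
  match t with
  | 2 => 0.1418532020854094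
  | 3 => 0.1338681353605138
  | 4 => 0.1305243270109503
  | 5 => 0.1284678647212778
  | _ => 0

/-! Write `[i] = 1 + t + ⋯ + t ^ i`, and let `G(u)` be the generating function of the nonempty
sequences, `q` marking the sum and `u` the last part. Appending a part gives `G(u) = q u + q u / (1
- q u) * (G(1) - G((q u) ^ t))`. At `u = q ^ ([i] - 1)` the argument `(q u) ^ t` is `q ^ ([i + 1] -
1)`, so the equation can be iterated from `u = 1`. The iteration converges superexponentially and
yields `1 + G(1) = treeNum / treeDen` (`treeDen_mul_one_add_seqSum`), where both series are
holomorphic on the unit disc. This is the meromorphic continuation; its poles come from zeros of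
`treeDen`. It remains to find and isolate the two zeros, to estimate the residues, and to bound the
quotient on the circle (`DenZeros`, `TreeNumerics`). Multiplying both series by `∏ (1 - q ^ [k])`
over `k < K` leaves a polynomial and a tail of size about `q ^ [K]`.

For `t ≤ 15` this is a certified computation. Discs with integer data enclose the cleared functions;
a quadtree shows that there are no zeros outside two windows and bounds the quotient near the
circle; enclosures of the derivative make the function injective in each window; sign changes on the
real axis give the zeros, and dual numbers give the residues (`TreeCert.denZeros`).

For `t ≥ 16` two cleared factors suffice. The denominator becomes `1 - 2 q + q ^ (t + 1) * (3 q - 1)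
- q ^ (t + 2) ω`, where `ω` begins at exponent `t ^ 2 + t + 1`. Near `1 / 2` the linear part
dominates; the second zero has `q ^ (t + 1)` near `1 / 2`. Truncated expansions with a free last
coefficient have opposite signs at its two extreme values, so the intermediate value theorem gives
both zeros with error bounds (`exists_first_zero`, `exists_second_zero`). At a zero, the equation
eliminates `q ^ (t + 1)`, and the residue becomes a rational expression compared with its expansion
(`isDenZero_of_redDen`).

There are no further zeros by a two-scale argument. In `‖q‖ ≤ 0.6` the function is `-2 q` plus a map
with Lipschitz constant one. Further out, a value of size at most `t ^ (-4)` forces `q` to have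
small angle and modulus close to that of the second zero `β`; there the powers of `q` have positive
real parts, and the function expands distances from `β` by the factor `1.4`
(`RadiusData.norm_sub_le`). As `1 / rThree t` exceeds `β` by the order of `t ^ (-3)`, the
denominator is at least `t ^ (-4)` on the circle, which gives the bound for `F`. -/

/-! ### The alternating series in the powers `q ^ [i]` -/

/-- The `t`-ary repunit `1 + t + ⋯ + t ^ i`. -/
def brk (t : ℕ) : ℕ → ℕ
  | 0 => 1
  | i + 1 => t * brk t i + 1

lemma succ_le_brk {t : ℕ} (ht : 1 ≤ t) (i : ℕ) : i + 1 ≤ brk t i := by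
  induction i with
  | zero => simp [brk]
  | succ i ih => simp only [brk]; nlinarith

lemma brk_pos {t : ℕ} (ht : 1 ≤ t) (i : ℕ) : 0 < brk t i := by
  have := succ_le_brk ht i; omega

lemma brk_mono {t : ℕ} (ht : 1 ≤ t) {i j : ℕ} (h : i ≤ j) : brk t i ≤ brk t j := by
  induction j, h using Nat.le_induction with
  | base => rfl
  | succ j _ ih => simp only [brk]; nlinarith

/-- This is the factor `q u / (1 - q u)` of the functional equation at `u = q ^ ([i] - 1)`. -/
noncomputable def brkRatio (t i : ℕ) (q : ℂ) : ℂ := q ^ brk t i / (1 - q ^ brk t i)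

/-- `∑ j, (-1) ^ j a_i ⋯ a_{i+j} q ^ (b * [i + j])` with `a_k = q ^ [k] / (1 - q ^ [k])`. -/
noncomputable def altSum (t b i : ℕ) (q : ℂ) : ℂ :=
  ∑' j : ℕ, (-1) ^ j * (∏ k ∈ Finset.range (j + 1), brkRatio t (i + k) q) * q ^ (b * brk t (i + j))

/-- When the functional equation is iterated from `u = 1`, the terms carrying the unknown `1 + G(1)`
collect in the series with `b = 0`, the others in the series with `b = 1`. -/
noncomputable def treeDen (t : ℕ) (q : ℂ) : ℂ := 1 - altSum t 0 0 q

noncomputable def treeNum (t : ℕ) (q : ℂ) : ℂ := 1 - altSum t 1 0 q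

lemma one_sub_pow_ne_zero {q : ℂ} (hq : ‖q‖ < 1) {n : ℕ} (hn : 0 < n) : 1 - q ^ n ≠ 0 := by
  intro h
  have h1 : q ^ n = 1 := (sub_eq_zero.mp h).symm
  have h2 : ‖q‖ ^ n = 1 := by rw [← norm_pow, h1, norm_one]
  exact absurd h2 (pow_lt_one₀ (norm_nonneg _) hq hn.ne').ne

lemma norm_brkRatio_le_of_pow {t : ℕ} (ht : 1 ≤ t) {s : ℝ} (hs : s < 1) {q : ℂ} (hq : ‖q‖ ≤ s)
    (i : ℕ) : ‖brkRatio t i q‖ ≤ s ^ brk t i / (1 - s ^ brk t i) := by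
  have hs0 : 0 ≤ s := (norm_nonneg q).trans hq
  have h1 : ‖q ^ brk t i‖ ≤ s ^ brk t i := by
    rw [norm_pow]; exact pow_le_pow_left₀ (norm_nonneg _) hq _
  have h2 : s ^ brk t i < 1 := pow_lt_one₀ hs0 hs (brk_pos ht i).ne'
  have h3 : 1 - s ^ brk t i ≤ ‖1 - q ^ brk t i‖ := by
    have := norm_sub_norm_le (1 : ℂ) (q ^ brk t i)
    rw [norm_one] at this; linarith
  rw [brkRatio, norm_div]
  exact div_le_div₀ (by positivity) h1 (by linarith) h3

lemma norm_brkRatio_le {t : ℕ} (ht : 1 ≤ t) {s : ℝ} (hs : s < 1) {q : ℂ} (hq : ‖q‖ ≤ s)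
    (i j : ℕ) (hij : j ≤ i) : ‖brkRatio t i q‖ ≤ s ^ j / (1 - s) := by
  have hs0 : 0 ≤ s := (norm_nonneg q).trans hq
  have hb := succ_le_brk ht i
  refine (norm_brkRatio_le_of_pow ht hs hq i).trans ?_
  refine div_le_div₀ (by positivity) (pow_le_pow_of_le_one hs0 hs.le (by omega)) (by linarith) ?_
  have : s ^ brk t i ≤ s ^ 1 := pow_le_pow_of_le_one hs0 hs.le (by omega)
  rw [pow_one] at this
  linarith

/-- Consecutive terms have ratio `s ^ (j + 1) / |c|`, which tends to zero. With `c = 1 - s` this is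
the majorant that makes the alternating series converge in the whole unit disc. -/
lemma summable_prod_pow_div {s : ℝ} (hs0 : 0 ≤ s) (hs : s < 1) (c : ℝ) :
    Summable fun j : ℕ => ∏ k ∈ Finset.range (j + 1), (s ^ k / c) := by
  -- The ratio test needs nonzero terms. For `s = 0` the factor with `k = 1` vanishes, and for `c =
  -- 0` every factor does, as division by zero gives zero.
  rcases hs0.eq_or_lt with rfl | hpos
  · refine summable_of_ne_finset_zero (s := Finset.range 1) fun j hj => ?_
    refine Finset.prod_eq_zero (i := 1) ?_ (by simp)
    simp at hj ⊢; omega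
  by_cases hc : c = 0
  · subst hc
    refine summable_of_ne_finset_zero (s := ∅) fun j _ => ?_
    exact Finset.prod_eq_zero (i := 0) (by simp) (by simp)
  refine summable_of_ratio_test_tendsto_lt_one (l := 0) one_pos (Eventually.of_forall fun j => ?_) ?_
  · exact Finset.prod_ne_zero_iff.mpr fun k _ => div_ne_zero (pow_ne_zero _ hpos.ne') hc
  · have h : ∀ j : ℕ, ‖∏ k ∈ Finset.range (j + 1 + 1), (s ^ k / c)‖ /
        ‖∏ k ∈ Finset.range (j + 1), (s ^ k / c)‖ = s ^ (j + 1) / |c| := by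
      intro j
      rw [Finset.prod_range_succ, norm_mul, mul_div_cancel_left₀]
      · rw [norm_div, norm_pow, Real.norm_eq_abs, Real.norm_eq_abs, abs_of_pos hpos]
      · rw [norm_ne_zero_iff]
        exact Finset.prod_ne_zero_iff.mpr fun k _ => div_ne_zero (pow_ne_zero _ hpos.ne') hc
    simp_rw [h]
    have := ((tendsto_pow_atTop_nhds_zero_of_lt_one hs0 hs).comp (tendsto_add_atTop_nat 1)).div_const |c|
    simpa using this

lemma norm_altSum_term_le {t : ℕ} (ht : 1 ≤ t) {s : ℝ} (hs : s < 1) {q : ℂ} (hq : ‖q‖ ≤ s)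
    (b i j : ℕ) :
    ‖(-1) ^ j * (∏ k ∈ Finset.range (j + 1), brkRatio t (i + k) q) * q ^ (b * brk t (i + j))‖ ≤
      ∏ k ∈ Finset.range (j + 1), (s ^ k / (1 - s)) := by
  have hs0 : 0 ≤ s := (norm_nonneg q).trans hq
  rw [norm_mul, norm_mul, norm_pow, norm_neg, norm_one, one_pow, one_mul, norm_prod, norm_pow]
  have h1 : ‖q‖ ^ (b * brk t (i + j)) ≤ 1 := pow_le_one₀ (norm_nonneg _) (hq.trans hs.le)
  have h2 : ∏ k ∈ Finset.range (j + 1), ‖brkRatio t (i + k) q‖ ≤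
      ∏ k ∈ Finset.range (j + 1), (s ^ k / (1 - s)) :=
    Finset.prod_le_prod (fun _ _ => norm_nonneg _)
      fun k _ => norm_brkRatio_le ht hs hq (i + k) k (by omega)
  calc _ ≤ (∏ k ∈ Finset.range (j + 1), ‖brkRatio t (i + k) q‖) * 1 := by gcongr
    _ ≤ _ := by rwa [mul_one]

lemma summable_altSum {t : ℕ} (ht : 1 ≤ t) {q : ℂ} (hq : ‖q‖ < 1) (b i : ℕ) :
    Summable fun j : ℕ => (-1) ^ j * (∏ k ∈ Finset.range (j + 1), brkRatio t (i + k) q) *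
      q ^ (b * brk t (i + j)) :=
  Summable.of_norm_bounded (summable_prod_pow_div (norm_nonneg q) hq _)
    (norm_altSum_term_le ht hq le_rfl b i)

lemma altSum_eq {t : ℕ} (ht : 1 ≤ t) {q : ℂ} (hq : ‖q‖ < 1) (b i : ℕ) :
    altSum t b i q = brkRatio t i q * (q ^ (b * brk t i) - altSum t b (i + 1) q) := by
  rw [altSum, (summable_altSum ht hq b i).tsum_eq_zero_add, altSum, mul_sub, ← tsum_mul_left,
    sub_eq_add_neg, ← tsum_neg]
  congr 1
  · simp
  · refine tsum_congr fun j => ?_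
    rw [Finset.prod_range_succ' _ (j + 1)]
    have h1 : ∀ k, i + (k + 1) = i + 1 + k := by intro k; ring
    have h2 : ∏ k ∈ Finset.range (j + 1), brkRatio t (i + (k + 1)) q =
        ∏ k ∈ Finset.range (j + 1), brkRatio t (i + 1 + k) q :=
      Finset.prod_congr rfl fun k _ => by rw [h1]
    rw [h2, h1 j, add_zero, pow_succ]
    generalize q ^ (b * brk t (i + 1 + j)) = z
    ring

/-- The difference of two solutions of the recursion satisfies `e_i = -a_i * e_(i+1)`, hence `e_0 =
± a_0 ⋯ a_(j-1) * e_j`; the products tend to zero while `e_j` stays bounded. -/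
lemma altSum_eq_of_bounded {t : ℕ} (ht : 1 ≤ t) {q : ℂ} (hq : ‖q‖ < 1) (b : ℕ) (X : ℕ → ℂ)
    (hX : ∀ i, X i = brkRatio t i q * (q ^ (b * brk t i) - X (i + 1))) (C : ℝ)
    (hC : ∀ i, ‖X i - altSum t b i q‖ ≤ C) : X 0 = altSum t b 0 q := by
  have key : ∀ j : ℕ, X 0 - altSum t b 0 q =
      (-1) ^ j * (∏ k ∈ Finset.range j, brkRatio t k q) * (X j - altSum t b j q) := by
    intro j
    induction j with
    | zero => simp
    | succ j ih =>
      rw [ih, Finset.prod_range_succ, hX j, altSum_eq ht hq b j]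
      ring
  have h0 := (summable_prod_pow_div (norm_nonneg q) hq (1 - ‖q‖)).tendsto_atTop_zero
  have hle : ∀ j : ℕ, ‖X 0 - altSum t b 0 q‖ ≤
      (∏ k ∈ Finset.range (j + 1), (‖q‖ ^ k / (1 - ‖q‖))) * C := by
    intro j
    rw [key (j + 1), norm_mul, norm_mul, norm_pow, norm_neg, norm_one, one_pow, one_mul, norm_prod]
    have hp : 0 < 1 - ‖q‖ := by linarith
    refine mul_le_mul (Finset.prod_le_prod (fun _ _ => norm_nonneg _)
      fun k _ => norm_brkRatio_le ht hq le_rfl k k le_rfl) (hC _) (norm_nonneg _) ?_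
    exact Finset.prod_nonneg fun k _ => by positivity
  have := ge_of_tendsto' (h0.mul_const C) hle
  rw [zero_mul] at this
  exact sub_eq_zero.mp (norm_le_zero_iff.mp this)

lemma differentiableOn_brkRatio {t : ℕ} (ht : 1 ≤ t) (i : ℕ) :
    DifferentiableOn ℂ (brkRatio t i) (Metric.ball 0 1) := by
  intro q hq
  have := one_sub_pow_ne_zero (mem_ball_zero_iff.mp hq) (brk_pos ht i)
  exact (DifferentiableAt.div (c := fun q : ℂ => q ^ brk t i) (d := fun q => 1 - q ^ brk t i)
    (by fun_prop) (by fun_prop) this).differentiableWithinAt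

lemma differentiableOn_altSum {t : ℕ} (ht : 1 ≤ t) (b i : ℕ) :
    DifferentiableOn ℂ (altSum t b i) (Metric.ball 0 1) := by
  intro q hq
  rw [mem_ball_zero_iff] at hq
  obtain ⟨s, hs1, hs2⟩ := exists_between hq
  have h : DifferentiableOn ℂ (altSum t b i) (Metric.ball 0 s) := by
    unfold altSum
    refine Complex.differentiableOn_tsum_of_summable_norm
      (summable_prod_pow_div ((norm_nonneg q).trans hs1.le) hs2 (1 - s)) (fun j => ?_)
      Metric.isOpen_ball fun j w hw => norm_altSum_term_le ht hs2 (mem_ball_zero_iff.mp hw).le b i j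
    refine DifferentiableOn.mul (DifferentiableOn.mul (by fun_prop) ?_) (by fun_prop)
    refine DifferentiableOn.fun_finsetProd fun k _ => ?_
    exact (differentiableOn_brkRatio ht (i + k)).mono (Metric.ball_subset_ball hs2.le)
  exact ((h q (mem_ball_zero_iff.mpr hs1)).differentiableAt
    (Metric.isOpen_ball.mem_nhds (mem_ball_zero_iff.mpr hs1))).differentiableWithinAt

lemma differentiableAt_altSum {t : ℕ} (ht : 1 ≤ t) (b i : ℕ) {q : ℂ} (hq : ‖q‖ < 1) :
    DifferentiableAt ℂ (altSum t b i) q :=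
  (differentiableOn_altSum ht b i).differentiableAt
    (Metric.isOpen_ball.mem_nhds (mem_ball_zero_iff.mpr hq))

/-- If `s ^ [i] ≤ 1 / 3`, each ratio from level `i` on is at most `A = (3 / 2) * s ^ [i] ≤ 1 / 2`,
and the geometric majorant sums to `A / (1 - A) ≤ 2 A`. -/
lemma norm_altSum_le {t : ℕ} (ht : 1 ≤ t) {s : ℝ} (hs : s < 1) {q : ℂ} (hq : ‖q‖ ≤ s) (b i : ℕ)
    (hi : s ^ brk t i ≤ 1 / 3) : ‖altSum t b i q‖ ≤ 3 * s ^ brk t i := by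
  have hs0 : 0 ≤ s := (norm_nonneg q).trans hq
  set A : ℝ := 3 / 2 * s ^ brk t i with hA
  have hA0 : 0 ≤ A := by positivity
  have hA1 : A ≤ 1 / 2 := by rw [hA]; linarith
  have hterm : ∀ j : ℕ, ‖(-1) ^ j * (∏ k ∈ Finset.range (j + 1), brkRatio t (i + k) q) *
      q ^ (b * brk t (i + j))‖ ≤ A * A ^ j := by
    intro j
    rw [norm_mul, norm_mul, norm_pow, norm_neg, norm_one, one_pow, one_mul, norm_prod, norm_pow]
    have h1 : ‖q‖ ^ (b * brk t (i + j)) ≤ 1 := pow_le_one₀ (norm_nonneg _) (hq.trans hs.le)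
    have h2 : ∏ k ∈ Finset.range (j + 1), ‖brkRatio t (i + k) q‖ ≤
        ∏ k ∈ Finset.range (j + 1), A := by
      refine Finset.prod_le_prod (fun _ _ => norm_nonneg _) fun k _ => ?_
      refine (norm_brkRatio_le_of_pow ht hs hq (i + k)).trans ?_
      have h3 : s ^ brk t (i + k) ≤ s ^ brk t i :=
        pow_le_pow_of_le_one hs0 hs.le (brk_mono ht (by omega))
      rw [div_le_iff₀ (by linarith)]
      have : 0 ≤ s ^ brk t i := by positivity
      rw [hA]; nlinarith
    calc _ ≤ (∏ k ∈ Finset.range (j + 1), ‖brkRatio t (i + k) q‖) * 1 := by gcongr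
      _ ≤ _ := by rw [mul_one]; refine h2.trans (le_of_eq ?_); simp [pow_succ']
  have hg : HasSum (fun j : ℕ => A * A ^ j) (A * (1 - A)⁻¹) :=
    (hasSum_geometric_of_lt_one hA0 (by linarith)).mul_left A
  refine (tsum_of_norm_bounded hg hterm).trans ?_
  rw [← div_eq_mul_inv, div_le_iff₀ (by linarith)]
  rw [hA] at *; nlinarith

/-- The coefficients are real. This makes values on the real axis real and allows searches for zeros
to be restricted to the upper half disc. -/
lemma altSum_conj (t b i : ℕ) (q : ℂ) :
    altSum t b i ((starRingEnd ℂ) q) = (starRingEnd ℂ) (altSum t b i q) := by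
  unfold altSum
  rw [Complex.conj_tsum]
  refine tsum_congr fun j => ?_
  simp [brkRatio, map_prod]

lemma altSum_ofReal_im (t b i : ℕ) (x : ℝ) : (altSum t b i (x : ℂ)).im = 0 := by
  have := altSum_conj t b i (x : ℂ)
  rw [Complex.conj_ofReal] at this
  exact Complex.conj_eq_iff_im.mp this.symm

/-! ### Generating function of the sequences and its functional equation -/

/-- The bounded degree sequences of length `l + 1`, in reverse order. -/
def revSeqs (t : ℕ) : ℕ → Finset (List ℕ)
  | 0 => {[1]}
  | l + 1 => (revSeqs t l).biUnion fun b => (Finset.Icc 1 (t * b.headI)).image (· :: b)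

lemma mem_revSeqs_iff {t l : ℕ} {b : List ℕ} :
    b ∈ revSeqs t l ↔ IsBoundedDegreeSeq t b.reverse ∧ b.length = l + 1 := by
  induction l generalizing b with
  | zero =>
    simp only [revSeqs, Finset.mem_singleton, zero_add, List.length_eq_one_iff]
    constructor
    · rintro rfl
      simp [IsBoundedDegreeSeq]
    · rintro ⟨⟨_, h, _⟩, a, rfl⟩
      simpa using h
  | succ l ih =>
    simp only [revSeqs, Finset.mem_biUnion, Finset.mem_image, Finset.mem_Icc, ih]
    constructor
    · rintro ⟨c, ⟨⟨h1, h2, h3⟩, hc⟩, m, ⟨hm1, hm2⟩, rfl⟩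
      obtain ⟨x, c', rfl⟩ : ∃ x c', c = x :: c' := by
        cases c with
        | nil => simp at hc
        | cons x c' => exact ⟨x, c', rfl⟩
      refine ⟨⟨?_, ?_, ?_⟩, by simpa using hc⟩
      · intro y hy
        simp only [List.reverse_cons, List.mem_append, List.mem_reverse,
          List.mem_cons] at hy h1
        rcases hy with hy | hy
        · exact h1 y (by tauto)
        · obtain rfl : y = m := by simpa using hy
          exact hm1
      · intro y hy
        refine h2 y ?_
        simp only [List.reverse_cons, List.head?_append] at hy ⊢
        cases h : c'.reverse.head? <;> simp_all
      · rw [List.isChain_reverse] at h3 ⊢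
        exact List.isChain_cons_cons.mpr ⟨hm2, h3⟩
    · rintro ⟨⟨h1, h2, h3⟩, hb⟩
      cases b with
      | nil => simp at hb
      | cons m c =>
        cases c with
        | nil => simp at hb
        | cons x c' =>
          rw [List.isChain_reverse, List.isChain_cons_cons] at h3
          refine ⟨x :: c', ⟨⟨?_, ?_, ?_⟩, by simpa using hb⟩, m, ⟨?_, h3.1⟩, rfl⟩
          · intro y hy
            refine h1 y ?_
            simp only [List.reverse_cons, List.mem_append, List.mem_reverse, List.mem_singleton]
              at hy ⊢
            tauto
          · intro y hy
            refine h2 y ?_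
            simp only [List.reverse_cons, List.head?_append] at hy ⊢
            cases h : c'.reverse.head? <;> simp_all
          · rw [List.isChain_reverse]; exact h3.2
          · exact h1 m (by simp)

/-- The sum of `q ^ (b.sum) * u ^ (last part of b)` over the sequences of length `l + 1`. -/
noncomputable def levelSum (t l : ℕ) (q u : ℂ) : ℂ :=
  ∑ b ∈ revSeqs t l, q ^ b.sum * u ^ b.headI

lemma levelSum_zero (t : ℕ) (q u : ℂ) : levelSum t 0 q u = q * u := by
  simp [levelSum, revSeqs]

lemma sum_revSeqs_succ {M : Type*} [AddCommMonoid M] (t l : ℕ) (f : List ℕ → M) :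
    ∑ b ∈ revSeqs t (l + 1), f b =
      ∑ b ∈ revSeqs t l, ∑ m ∈ Finset.Icc 1 (t * b.headI), f (m :: b) := by
  rw [revSeqs, Finset.sum_biUnion]
  · refine Finset.sum_congr rfl fun b _ => ?_
    rw [Finset.sum_image]
    intro x _ y _ h
    simpa using h
  · intro b _ c _ hbc
    rw [Function.onFun, Finset.disjoint_left]
    intro x hx hy
    simp only [Finset.mem_image] at hx hy
    obtain ⟨m, _, rfl⟩ := hx
    obtain ⟨m', _, h⟩ := hy
    simp only [List.cons.injEq] at h
    exact hbc h.2.symm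

lemma sum_Icc_pow {z : ℂ} (hz : 1 - z ≠ 0) (n : ℕ) :
    ∑ m ∈ Finset.Icc 1 n, z ^ m = z / (1 - z) * (1 - z ^ n) := by
  rw [div_mul_eq_mul_div, eq_div_iff hz]
  induction n with
  | zero => simp
  | succ n ih =>
    rw [Finset.sum_Icc_succ_top (by omega), add_mul, ih]
    ring

/-- The new last part runs over a geometric progression in `q u` up to `t` times the old one; its
upper end contributes `(q u) ^ t` raised to the old last part. -/
lemma levelSum_succ (t l : ℕ) {q u : ℂ} (h : 1 - q * u ≠ 0) :
    levelSum t (l + 1) q u =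
      q * u / (1 - q * u) * (levelSum t l q 1 - levelSum t l q ((q * u) ^ t)) := by
  rw [levelSum, sum_revSeqs_succ, levelSum, levelSum, ← Finset.sum_sub_distrib, Finset.mul_sum]
  refine Finset.sum_congr rfl fun b _ => ?_
  have : ∀ m, q ^ (m :: b).sum * u ^ (m :: b).headI = q ^ b.sum * (q * u) ^ m := by
    intro m
    simp only [List.sum_cons, List.headI_cons, pow_add, mul_pow]
    ring
  simp_rw [this, ← Finset.mul_sum]
  rw [sum_Icc_pow h, ← pow_mul, one_pow]
  ring

/-- Dropping the upper limit for each new part leaves the full geometric series `‖q‖ / (1 - ‖q‖)`.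
This is below one for `‖q‖ < 1 / 2`, which explains that disc. -/
lemma sum_norm_revSeqs_le (t l : ℕ) {q : ℂ} (hq : ‖q‖ < 1) :
    ∑ b ∈ revSeqs t l, ‖q ^ b.sum‖ ≤ ‖q‖ * (‖q‖ / (1 - ‖q‖)) ^ l := by
  have hp : 0 < 1 - ‖q‖ := by linarith
  induction l with
  | zero => simp [revSeqs]
  | succ l ih =>
    rw [sum_revSeqs_succ]
    have h : ∀ b : List ℕ, ∑ m ∈ Finset.Icc 1 (t * b.headI), ‖q ^ (m :: b).sum‖ ≤
        ‖q ^ b.sum‖ * (‖q‖ / (1 - ‖q‖)) := by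
      intro b
      simp_rw [List.sum_cons, norm_pow, add_comm _ b.sum, pow_add, ← Finset.mul_sum]
      refine mul_le_mul_of_nonneg_left ?_ (by positivity)
      rw [le_div_iff₀ hp]
      generalize t * b.headI = n
      have : (∑ m ∈ Finset.Icc 1 n, ‖q‖ ^ m) * (1 - ‖q‖) = ‖q‖ * (1 - ‖q‖ ^ n) := by
        induction n with
        | zero => simp
        | succ n ih => rw [Finset.sum_Icc_succ_top (by omega), add_mul, ih]; ring
      rw [this]
      have : 0 ≤ ‖q‖ ^ n := by positivity
      nlinarith [norm_nonneg q]
    calc _ ≤ ∑ b ∈ revSeqs t l, ‖q ^ b.sum‖ * (‖q‖ / (1 - ‖q‖)) := Finset.sum_le_sum fun b _ => h b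
      _ = (∑ b ∈ revSeqs t l, ‖q ^ b.sum‖) * (‖q‖ / (1 - ‖q‖)) := by rw [Finset.sum_mul]
      _ ≤ ‖q‖ * (‖q‖ / (1 - ‖q‖)) ^ l * (‖q‖ / (1 - ‖q‖)) := by gcongr
      _ = _ := by ring

lemma ratio_lt_one {x : ℝ} (hx : x < 1 / 2) : x / (1 - x) < 1 := by
  rw [div_lt_one (by linarith)]; linarith

lemma summable_revSeqs (t : ℕ) {q : ℂ} (hq : ‖q‖ < 1 / 2) :
    Summable fun b : (Σ l : ℕ, revSeqs t l) => q ^ (b.2 : List ℕ).sum := by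
  have hp : 0 < 1 - ‖q‖ := by linarith
  refine Summable.of_norm ((summable_sigma_of_nonneg fun _ => norm_nonneg _).mpr
    ⟨fun l => (hasSum_fintype _).summable, ?_⟩)
  have hs : Summable fun l : ℕ => ‖q‖ * (‖q‖ / (1 - ‖q‖)) ^ l :=
    (summable_geometric_of_lt_one (by positivity) (ratio_lt_one hq)).mul_left _
  refine Summable.of_nonneg_of_le (fun l => tsum_nonneg fun _ => norm_nonneg _) (fun l => ?_) hs
  rw [Finset.tsum_subtype (revSeqs t l) (fun b => ‖q ^ b.sum‖)]
  exact sum_norm_revSeqs_le t l (by linarith)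

lemma norm_levelSum_le (t l : ℕ) {q u : ℂ} (hq : ‖q‖ < 1) (hu : ‖u‖ ≤ 1) :
    ‖levelSum t l q u‖ ≤ ‖q‖ * (‖q‖ / (1 - ‖q‖)) ^ l := by
  refine (norm_sum_le _ _).trans (le_trans (Finset.sum_le_sum fun b _ => ?_)
    (sum_norm_revSeqs_le t l hq))
  rw [norm_mul, norm_pow u]
  exact mul_le_of_le_one_right (norm_nonneg _) (pow_le_one₀ (norm_nonneg _) hu)

/-- The empty sequence is not included: level `l` consists of sequences of length `l + 1`. -/
noncomputable def seqSum (t : ℕ) (q u : ℂ) : ℂ := ∑' l, levelSum t l q u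

lemma summable_levelSum (t : ℕ) {q u : ℂ} (hq : ‖q‖ < 1 / 2) (hu : ‖u‖ ≤ 1) :
    Summable fun l => levelSum t l q u := by
  have hp : 0 < 1 - ‖q‖ := by linarith
  exact Summable.of_norm_bounded
    ((summable_geometric_of_lt_one (by positivity) (ratio_lt_one hq)).mul_left ‖q‖)
    fun l => norm_levelSum_le t l (by linarith) hu

lemma norm_seqSum_le (t : ℕ) {q u : ℂ} (hq : ‖q‖ < 1 / 2) (hu : ‖u‖ ≤ 1) :
    ‖seqSum t q u‖ ≤ ‖q‖ * (1 - ‖q‖ / (1 - ‖q‖))⁻¹ := by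
  have hp : 0 < 1 - ‖q‖ := by linarith
  exact tsum_of_norm_bounded
    ((hasSum_geometric_of_lt_one (by positivity) (ratio_lt_one hq)).mul_left ‖q‖)
    fun l => norm_levelSum_le t l (by linarith) hu

lemma seqSum_eq (t : ℕ) {q u : ℂ} (hq : ‖q‖ < 1 / 2) (hu : ‖u‖ ≤ 1) :
    seqSum t q u = q * u + q * u / (1 - q * u) * (seqSum t q 1 - seqSum t q ((q * u) ^ t)) := by
  have h1 : ‖q * u‖ < 1 := by
    rw [norm_mul]; nlinarith [norm_nonneg q, norm_nonneg u]
  have h2 : 1 - q * u ≠ 0 := by simpa using one_sub_pow_ne_zero h1 one_pos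
  have h3 : ‖(q * u) ^ t‖ ≤ 1 := by
    rw [norm_pow]; exact pow_le_one₀ (norm_nonneg _) h1.le
  rw [seqSum, (summable_levelSum t hq hu).tsum_eq_zero_add, levelSum_zero]
  simp_rw [levelSum_succ t _ h2]
  rw [tsum_mul_left, (summable_levelSum t hq (by simp)).tsum_sub (summable_levelSum t hq h3)]
  rfl

/-- The points `u = q ^ ([i] - 1)` form an orbit of `u ↦ (q u) ^ t` starting at `1`, so the
functional equation becomes a recursion in `i`. -/
lemma treeDen_mul_one_add_seqSum {t : ℕ} (ht : 1 ≤ t) {q : ℂ} (hq : ‖q‖ < 1 / 2) :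
    treeDen t q * (1 + seqSum t q 1) = treeNum t q := by
  have hq1 : ‖q‖ < 1 := by linarith
  have hu : ∀ i, ‖q ^ (brk t i - 1)‖ ≤ 1 := fun i => by
    rw [norm_pow]; exact pow_le_one₀ (norm_nonneg _) hq1.le
  have hrec : ∀ i, seqSum t q (q ^ (brk t i - 1)) = brkRatio t i q *
      (1 - q ^ brk t i + seqSum t q 1 - seqSum t q (q ^ (brk t (i + 1) - 1))) := by
    intro i
    have hqu : q * q ^ (brk t i - 1) = q ^ brk t i := by
      rw [← pow_succ', Nat.sub_add_cancel (brk_pos ht i)]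
    have h1 := one_sub_pow_ne_zero hq1 (brk_pos ht i)
    rw [seqSum_eq t hq (hu i), hqu, ← pow_mul, mul_comm (brk t i) t, brkRatio]
    rw [show brk t (i + 1) = t * brk t i + 1 from rfl, Nat.add_sub_cancel]
    field_simp
    ring
  set g := seqSum t q 1 with hg
  obtain ⟨C, hC⟩ : ∃ C, ∀ b i, ‖altSum t b i q‖ ≤ C := by
    refine ⟨∑' j, ∏ k ∈ Finset.range (j + 1), (‖q‖ ^ k / (1 - ‖q‖)), fun b i => ?_⟩
    exact tsum_of_norm_bounded (summable_prod_pow_div (norm_nonneg q) hq1 _).hasSum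
      (norm_altSum_term_le ht hq1 le_rfl b i)
  -- `(1 + g) * altSum t 0 i q` solves the recursion with inhomogeneity `1 + g`. Subtracting the
  -- values of `seqSum` leaves `q ^ [i]`, which is the recursion for `b = 1`; at `i = 0` the
  -- identification is the claim.
  have key := altSum_eq_of_bounded ht hq1 1
    (fun i => (1 + g) * altSum t 0 i q - seqSum t q (q ^ (brk t i - 1))) (fun i => ?_)
    (‖1 + g‖ * C + ‖q‖ * (1 - ‖q‖ / (1 - ‖q‖))⁻¹ + C) fun i => ?_
  · have hb0 : brk t 0 - 1 = 0 := rfl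
    rw [hb0, pow_zero, ← hg] at key
    rw [treeDen, treeNum, ← key]
    ring
  · rw [hrec, altSum_eq ht hq1 0 i, zero_mul, one_mul, pow_zero]
    ring
  · refine (norm_sub_le _ _).trans (add_le_add ((norm_sub_le _ _).trans (add_le_add ?_ ?_)) (hC _ _))
    · rw [norm_mul]; exact mul_le_mul_of_nonneg_left (hC _ _) (norm_nonneg _)
    · exact norm_seqSum_le t hq (hu i)

lemma hasSum_treeCount {t : ℕ} {q : ℂ} (hq : ‖q‖ < 1 / 2) :
    HasSum (fun n : ℕ => (treeCount t n : ℂ) * q ^ n) (1 + seqSum t q 1) := by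
  let w : (Σ l : ℕ, revSeqs t l) → ℕ := fun b => (b.2 : List ℕ).sum
  have h0 : HasSum (fun b : (Σ l : ℕ, revSeqs t l) => q ^ w b) (seqSum t q 1) := by
    have h := (summable_revSeqs t hq).hasSum
    have h2 := (summable_revSeqs t hq).tsum_sigma
    have h3 : ∀ l, ∑' c : revSeqs t l, q ^ (c : List ℕ).sum = levelSum t l q 1 := by
      intro l
      rw [Finset.tsum_subtype (revSeqs t l) (fun b => q ^ b.sum), levelSum]
      simp
    have h2 : seqSum t q 1 = _ := (tsum_congr h3).symm.trans h2.symm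
    rw [h2]; exact h
  have h1 := (Equiv.sigmaFiberEquiv w).hasSum_iff.mpr h0
  -- The fibre over `0` is empty because only nonempty sequences occur, while `treeCount t 0 = 1`
  -- counts the empty one; the summand `1` restores it at the end.
  have hcard : ∀ n, Nat.card {b // w b = n} = if n = 0 then 0 else treeCount t n := by
    intro n
    have hinj : Function.Injective fun b : {b // w b = n} => ((b.1.2 : List ℕ)).reverse := by
      rintro ⟨⟨l, b, hb⟩, h⟩ ⟨⟨l', b', hb'⟩, h'⟩ hbb
      simp only [List.reverse_inj] at hbb
      subst hbb
      obtain rfl : l = l' := by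
        have h1 := (mem_revSeqs_iff.mp hb).2
        have h2 := (mem_revSeqs_iff.mp hb').2
        omega
      rfl
    have hrange : ∀ b : List ℕ, b ∈ (fun b : {b // w b = n} => ((b.1.2 : List ℕ)).reverse) '' Set.univ ↔
        b ≠ [] ∧ IsBoundedDegreeSeq t b ∧ b.sum = n := by
      intro b
      simp only [Set.image_univ, Set.mem_range, Subtype.exists, Sigma.exists]
      constructor
      · rintro ⟨l, c, hc, hw, rfl⟩
        have := mem_revSeqs_iff.mp hc
        refine ⟨fun h => ?_, this.1, ?_⟩
        · have h' := congrArg List.length h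
          simp [this.2] at h'
        · rw [List.sum_reverse]; exact hw
      · rintro ⟨hb, hB, hs⟩
        have hl : 0 < b.length := List.length_pos_iff.mpr hb
        refine ⟨b.length - 1, b.reverse, mem_revSeqs_iff.mpr ⟨by simpa using hB, ?_⟩, ?_, by simp⟩
        · simp; omega
        · simp only [w, List.sum_reverse]; exact hs
    rw [← Set.ncard_univ, ← Set.ncard_image_of_injective _ hinj, treeCount]
    split_ifs with hn
    · subst hn
      suffices h : (fun b : {b // w b = 0} => ((b.1.2 : List ℕ)).reverse) '' Set.univ = ∅ by
        rw [h, Set.ncard_empty]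
      refine Set.eq_empty_of_forall_notMem fun b hb => ?_
      obtain ⟨h1, h2, h3⟩ := (hrange b).mp hb
      obtain ⟨x, hx⟩ := List.exists_mem_of_ne_nil b h1
      have := h2.1 x hx
      have := List.single_le_sum (by simp) x hx
      omega
    · congr 1
      ext b
      rw [hrange]
      refine ⟨fun h => h.2, fun h => ⟨?_, h⟩⟩
      rintro rfl
      exact hn h.2.symm
  have hc0 : treeCount t 0 = 1 := by
    rw [treeCount, Set.ncard_eq_one]
    refine ⟨[], Set.eq_singleton_iff_unique_mem.mpr ⟨by simp [IsBoundedDegreeSeq], ?_⟩⟩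
    rintro b ⟨hb, hs⟩
    by_contra hne
    obtain ⟨x, hx⟩ := List.exists_mem_of_ne_nil b hne
    have := hb.1 x hx
    have := List.single_le_sum (by simp) x hx
    omega
  have h2 : HasSum (fun n : ℕ => ((if n = 0 then 0 else treeCount t n : ℕ) : ℂ) * q ^ n)
      (seqSum t q 1) := by
    refine h1.sigma fun n => ?_
    have hfin : Finite {b // w b = n} := by
      refine Set.Finite.subset ((Finset.range n).sigma fun l => (revSeqs t l).attach).finite_toSet ?_
      rintro ⟨l, b, hb⟩ (hw : b.sum = n)
      have h := mem_revSeqs_iff.mp hb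
      have := List.length_le_sum_of_one_le b fun i hi => h.1.1 i (List.mem_reverse.mpr hi)
      simp only [Finset.coe_sigma, Set.mem_sigma_iff, Finset.mem_coe, Finset.mem_range,
        Finset.mem_attach, and_true]
      omega
    have := Fintype.ofFinite {b // w b = n}
    convert hasSum_fintype (fun _ : {b // w b = n} => q ^ n) using 1
    · ext c
      simp [c.2]
    · rw [Finset.sum_const, ← hcard, Nat.card_eq_fintype_card, nsmul_eq_mul]
      rfl
  have h3 := (hasSum_ite_eq 0 (1 : ℂ)).add h2
  convert h3 using 2 with n
  by_cases hn : n = 0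
  · subst hn; simp [hc0]
  · simp [hn]

/-! ### Meromorphic continuation, poles and residues -/

lemma differentiableAt_treeDen {t : ℕ} (ht : 1 ≤ t) {q : ℂ} (hq : ‖q‖ < 1) :
    DifferentiableAt ℂ (treeDen t) q :=
  (differentiableAt_altSum ht 0 0 hq).const_sub 1

lemma analyticAt_treeDen {t : ℕ} (ht : 1 ≤ t) {q : ℂ} (hq : ‖q‖ < 1) :
    AnalyticAt ℂ (treeDen t) q :=
  ((differentiableOn_altSum ht 0 0).const_sub 1).analyticAt
    (Metric.isOpen_ball.mem_nhds (mem_ball_zero_iff.mpr hq))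

lemma analyticAt_treeNum {t : ℕ} (ht : 1 ≤ t) {q : ℂ} (hq : ‖q‖ < 1) :
    AnalyticAt ℂ (treeNum t) q :=
  ((differentiableOn_altSum ht 1 0).const_sub 1).analyticAt
    (Metric.isOpen_ball.mem_nhds (mem_ball_zero_iff.mpr hq))

/-- `x` is a simple zero of the denominator at which the quotient has residue `-R`. -/
structure IsDenZero (t : ℕ) (x R : ℝ) : Prop where
  zero : treeDen t x = 0
  deriv_ne : deriv (treeDen t) x ≠ 0
  num_eq : treeNum t x = -R * deriv (treeDen t) x

noncomputable def treeGF (t : ℕ) : ℂ → ℂ :=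
  toMeromorphicNFOn (fun q => treeNum t q / treeDen t q) (Metric.ball 0 1)

lemma meromorphicOn_treeQuot {t : ℕ} (ht : 1 ≤ t) :
    MeromorphicOn (fun q => treeNum t q / treeDen t q) (Metric.ball 0 1) := fun _ hq =>
  (analyticAt_treeNum ht (mem_ball_zero_iff.mp hq)).meromorphicAt.fun_div
    (analyticAt_treeDen ht (mem_ball_zero_iff.mp hq)).meromorphicAt

lemma treeGF_eventuallyEq {t : ℕ} (ht : 1 ≤ t) {p : ℂ} (hp : ‖p‖ < 1) :
    treeGF t =ᶠ[𝓝[≠] p] fun q => treeNum t q / treeDen t q :=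
  (meromorphicOn_treeQuot ht).toMeromorphicNFOn_eq_self_on_nhdsNE (mem_ball_zero_iff.mpr hp)

lemma meromorphicNFOn_treeGF (t : ℕ) : MeromorphicNFOn (treeGF t) (Metric.ball 0 1) :=
  meromorphicNFOn_toMeromorphicNFOn _ _

lemma analyticAt_treeQuot {t : ℕ} (ht : 1 ≤ t) {q : ℂ} (hq : ‖q‖ < 1) (h : treeDen t q ≠ 0) :
    AnalyticAt ℂ (fun q => treeNum t q / treeDen t q) q :=
  (analyticAt_treeNum ht hq).fun_div (analyticAt_treeDen ht hq) h

lemma treeGF_eq {t : ℕ} (ht : 1 ≤ t) {q : ℂ} (hq : ‖q‖ < 1) (h : treeDen t q ≠ 0) :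
    treeGF t q = treeNum t q / treeDen t q := by
  rw [treeGF, toMeromorphicNFOn_eq_toMeromorphicNFAt (meromorphicOn_treeQuot ht)
    (mem_ball_zero_iff.mpr hq),
    toMeromorphicNFAt_eq_self.mpr (analyticAt_treeQuot ht hq h).meromorphicNFAt]

lemma not_isPole_treeGF {t : ℕ} (ht : 1 ≤ t) {q : ℂ} (hq : ‖q‖ < 1) (h : treeDen t q ≠ 0) :
    ¬ IsPole (treeGF t) q := by
  rintro ⟨-, h2⟩
  rw [meromorphicOrderAt_congr (treeGF_eventuallyEq ht hq)] at h2
  exact absurd (analyticAt_treeQuot ht hq h).meromorphicOrderAt_nonneg (not_le.mpr h2)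

/-- Near `x` the denominator is `q - x` times `dslope (treeDen t) x`, which is analytic with the
nonzero derivative as its value at `x`. -/
lemma IsDenZero.isSimplePole {t : ℕ} (ht : 1 ≤ t) {x R : ℝ} (hx : |x| < 1) (hR : R ≠ 0)
    (h : IsDenZero t x R) : IsSimplePoleWithResidue (treeGF t) x (-(R : ℂ)) := by
  have hx' : ‖(x : ℂ)‖ < 1 := by simpa using hx
  obtain ⟨p, hp⟩ := analyticAt_treeDen ht hx'
  have hd : AnalyticAt ℂ (dslope (treeDen t) x) x := ⟨_, hp.has_fpower_series_dslope_fslope⟩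
  have hdx : dslope (treeDen t) x x = deriv (treeDen t) x := dslope_same _ _
  have hg : AnalyticAt ℂ (fun q => treeNum t q / dslope (treeDen t) x q) x :=
    (analyticAt_treeNum ht hx').fun_div hd (by rw [hdx]; exact h.deriv_ne)
  have hgx : treeNum t x / dslope (treeDen t) x x = -(R : ℂ) := by
    rw [hdx, h.num_eq, mul_div_cancel_right₀ _ h.deriv_ne]
  have heq : ∀ᶠ q in 𝓝[≠] (x : ℂ), treeGF t q =
      (q - x) ^ (-1 : ℤ) • (treeNum t q / dslope (treeDen t) x q) := by
    filter_upwards [treeGF_eventuallyEq ht hx', self_mem_nhdsWithin] with q hq hne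
    rw [hq, dslope_of_ne _ hne, slope_def_field, h.zero, sub_zero, zpow_neg_one, smul_eq_mul]
    have : q - x ≠ 0 := sub_ne_zero.mpr hne
    field_simp
  have hm : MeromorphicAt (treeGF t) x :=
    (meromorphicNFOn_treeGF t (mem_ball_zero_iff.mpr hx')).meromorphicAt
  refine ⟨hm, (meromorphicOrderAt_eq_int_iff hm).mpr ⟨_, hg, ?_, heq⟩, ?_⟩
  · simp only [hgx]; simpa using hR
  · have hc : Tendsto (fun q => treeNum t q / dslope (treeDen t) x q) (𝓝[≠] (x : ℂ))
        (𝓝 (-(R : ℂ))) := by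
      rw [← hgx]; exact hg.continuousAt.tendsto.mono_left nhdsWithin_le_nhds
    refine hc.congr' ?_
    filter_upwards [heq, self_mem_nhdsWithin] with q hq hne
    have : q - x ≠ 0 := sub_ne_zero.mpr hne
    rw [hq, zpow_neg_one, smul_eq_mul, mul_inv_cancel_left₀ this]

lemma isTreeGeneratingFunction_treeGF {t : ℕ} (ht : 1 ≤ t)
    (h : ∀ q : ℂ, ‖q‖ < 1 / 2 → treeDen t q ≠ 0) : IsTreeGeneratingFunction t (treeGF t) := by
  refine ⟨meromorphicNFOn_treeGF t, fun q hq => ?_⟩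
  have := hasSum_treeCount (t := t) hq
  rwa [treeGF_eq ht (by linarith) (h q hq), ← treeDen_mul_one_add_seqSum ht hq,
    mul_div_cancel_left₀ _ (h q hq)]

/-- The two zeros of the denominator in the closed disc of radius `r` and the bound on the circle. -/
structure DenZeros (t : ℕ) (r α β R R₂ : ℝ) : Prop where
  half_lt : 1 / 2 < α
  lt : α < β
  lt_r : β < r
  r_lt : r < 1
  pos : 0 < R
  pos₂ : 0 < R₂
  zero : IsDenZero t α R
  zero₂ : IsDenZero t β R₂
  only : ∀ q : ℂ, ‖q‖ ≤ r → treeDen t q = 0 → q = α ∨ q = β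
  bound : ∀ q : ℂ, ‖q‖ = r → ‖treeNum t q‖ ≤ 5 * (t : ℝ) ^ 4 * ‖treeDen t q‖

namespace DenZeros

variable {t : ℕ} {r α β R R₂ : ℝ}

lemma isPole_iff (h : DenZeros t r α β R R₂) (ht : 1 ≤ t) {q : ℂ} (hq : ‖q‖ ≤ r) :
    IsPole (treeGF t) q ↔ q = α ∨ q = β := by
  have h1 := h.half_lt
  have h2 := h.lt
  have h3 := h.lt_r
  have h4 := h.r_lt
  constructor
  · intro hp
    by_contra hne
    exact not_isPole_treeGF ht (hq.trans_lt h4) (fun h0 => hne (h.only q hq h0)) hp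
  · have key : ∀ x S : ℝ, 0 < S → |x| < 1 → IsDenZero t x S → IsPole (treeGF t) x := by
      intro x S hS hx hz
      have := hz.isSimplePole ht hx hS.ne'
      exact ⟨this.1, by rw [this.2.1]; exact WithTop.coe_lt_coe.mpr (by norm_num)⟩
    rintro (rfl | rfl)
    · exact key _ _ h.pos (by rw [abs_lt]; constructor <;> linarith) h.zero
    · exact key _ _ h.pos₂ (by rw [abs_lt]; constructor <;> linarith) h.zero₂

lemma isTreeGeneratingFunction (h : DenZeros t r α β R R₂) (ht : 1 ≤ t) :
    IsTreeGeneratingFunction t (treeGF t) := by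
  have h1 := h.half_lt
  have h2 := h.lt
  have h3 := h.lt_r
  refine isTreeGeneratingFunction_treeGF ht fun q hq h0 => ?_
  rcases h.only q (by linarith) h0 with rfl | rfl <;>
  · rw [Complex.norm_real, Real.norm_eq_abs, abs_lt] at hq; linarith

lemma norm_treeGF_le (h : DenZeros t r α β R R₂) (ht : 1 ≤ t) {q : ℂ} (hq : ‖q‖ = r) :
    ‖treeGF t q‖ ≤ 5 * (t : ℝ) ^ 4 := by
  have h1 := h.half_lt
  have h2 := h.lt
  have h3 := h.lt_r
  have h0 : treeDen t q ≠ 0 := fun h0 => by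
    rcases h.only q hq.le h0 with rfl | rfl <;>
    · rw [Complex.norm_real, Real.norm_eq_abs, abs_of_pos (by linarith)] at hq; linarith
  rw [treeGF_eq ht (hq.trans_lt h.r_lt) h0, norm_div, div_le_iff₀ (norm_pos_iff.mpr h0)]
  exact h.bound q hq

end DenZeros

/-! ### A division-free evaluation program for numerator and denominator -/

/-- Explicit ring operations, so that one program runs on numbers, functions, balls and jets. -/
structure RingOps (A : Type) where
  one : A
  mul : A → A → A
  sub : A → A → A

namespace RingOps

variable {A A' : Type} (o : RingOps A) (o' : RingOps A')

/-- Repeated squaring with fuel `f`; any `f ≥ k` suffices. -/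
def powAux (x : A) : ℕ → ℕ → A
  | 0, _ => o.one
  | f + 1, k =>
    bif Nat.beq k 0 then o.one
    else bif Nat.beq k 1 then x
    else bif Nat.beq (Nat.mod k 2) 0 then o.mul (powAux x f (Nat.div k 2)) (powAux x f (Nat.div k 2))
    else o.mul (o.mul (powAux x f (Nat.div k 2)) (powAux x f (Nat.div k 2))) x

/-- Given `x = q ^ [i]`, push `q ^ [i], …, q ^ [i + k - 1]` on a list. -/
def levels (t : ℕ) (q : A) : ℕ → A → List A → List A
  | 0, _, l => l
  | k + 1, x, l => levels t q k (o.mul (o.powAux x t t) q) (x :: l)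

structure State (A : Type) where
  den : A
  prod : A
  num : A

/-- This runs the recursion of `altSum_eq` from the tail down to level `0` without dividing: `Q` is
the product of the factors `1 - x` met so far, `N` is `Q` times `1 - altSum t 0 i q`, and `M` is `Q`
times `altSum t 1 i q`. -/
def horner : List A → A → A → A → State A
  | [], N, Q, M => ⟨N, Q, M⟩
  | x :: l, N, Q, M =>
    horner l (o.sub (o.mul (o.sub o.one x) Q) (o.mul x N)) (o.mul (o.sub o.one x) Q)
      (o.mul x (o.sub (o.mul x Q) M))

/-- With tails `N`, `M` at level `K`, the denominator, the numerator and the common factor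
`∏ (1 - q ^ [i])` they have been multiplied with. -/
def eval (t K : ℕ) (q N M : A) : State A :=
  o.horner (o.levels t q K q []) N o.one M

/-- A relation that is compatible with the operations. -/
structure Compat (R : A → A' → Prop) : Prop where
  one : R o.one o'.one
  mul : ∀ {x x' y y'}, R x x' → R y y' → R (o.mul x y) (o'.mul x' y')
  sub : ∀ {x x' y y'}, R x x' → R y y' → R (o.sub x y) (o'.sub x' y')

variable {o o'} {R : A → A' → Prop}

/-- The program uses only the three operations, so a compatible relation propagates from inputs to
outputs. It is applied to balls and complex numbers, to jets and functions, and to functions and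
their values. -/
lemma Compat.powAux (h : Compat o o' R) {x : A} {x' : A'} (hx : R x x') (f k : ℕ) :
    R (o.powAux x f k) (o'.powAux x' f k) := by
  induction f generalizing k with
  | zero => exact h.one
  | succ f ih =>
    simp only [RingOps.powAux]
    cases Nat.beq k 0 <;> cases Nat.beq k 1 <;> cases Nat.beq (Nat.mod k 2) 0 <;>
      simp only [cond_true, cond_false]
    all_goals first
      | exact h.one
      | exact hx
      | exact h.mul (ih _) (ih _)
      | exact h.mul (h.mul (ih _) (ih _)) hx

lemma Compat.levels (h : Compat o o' R) (t : ℕ) {q : A} {q' : A'} (hq : R q q') (k : ℕ)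
    {x : A} {x' : A'} (hx : R x x') {l : List A} {l' : List A'} (hl : List.Forall₂ R l l') :
    List.Forall₂ R (o.levels t q k x l) (o'.levels t q' k x' l') := by
  induction k generalizing x x' l l' with
  | zero => exact hl
  | succ k ih => exact ih (h.mul (h.powAux hx t t) hq) (.cons hx hl)

structure State.Rel (R : A → A' → Prop) (s : State A) (s' : State A') : Prop where
  den : R s.den s'.den
  prod : R s.prod s'.prod
  num : R s.num s'.num

lemma Compat.horner (h : Compat o o' R) {l : List A} {l' : List A'} (hl : List.Forall₂ R l l')
    {N Q M : A} {N' Q' M' : A'} (hN : R N N') (hQ : R Q Q') (hM : R M M') :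
    State.Rel R (o.horner l N Q M) (o'.horner l' N' Q' M') := by
  induction hl generalizing N Q M N' Q' M' with
  | nil => exact ⟨hN, hQ, hM⟩
  | cons hx _ ih =>
    exact ih (h.sub (h.mul (h.sub h.one hx) hQ) (h.mul hx hN)) (h.mul (h.sub h.one hx) hQ)
      (h.mul hx (h.sub (h.mul hx hQ) hM))

lemma Compat.eval (h : Compat o o' R) (t K : ℕ) {q N M : A} {q' N' M' : A'} (hq : R q q')
    (hN : R N N') (hM : R M M') :
    State.Rel R (o.eval t K q N M) (o'.eval t K q' N' M') :=
  h.horner (h.levels t hq K hq .nil) hN h.one hM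

end RingOps

def complexOps : RingOps ℂ := ⟨1, (· * ·), (· - ·)⟩

def funOps : RingOps (ℂ → ℂ) := ⟨fun _ => 1, fun f g z => f z * g z, fun f g z => f z - g z⟩

lemma complexOps_powAux (x : ℂ) (f k : ℕ) (hk : k ≤ f) : complexOps.powAux x f k = x ^ k := by
  induction f generalizing k with
  | zero => obtain rfl : k = 0 := by omega
            simp [RingOps.powAux, complexOps]
  | succ f ih =>
    have h2 := Nat.div_add_mod k 2
    simp only [RingOps.powAux]
    have ih' := ih (Nat.div k 2) (by change k / 2 ≤ f; omega)
    rw [ih']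
    cases h0 : Nat.beq k 0
    · cases h1 : Nat.beq k 1
      · cases h : Nat.beq (Nat.mod k 2) 0
        · have hm : k % 2 = 1 := by
            have : ¬ k % 2 = 0 := fun h' => by
              rw [show Nat.mod k 2 = 0 from h'] at h; simp at h
            omega
          simp only [cond_false, complexOps]
          conv_rhs => rw [← h2, hm]
          change x ^ (k / 2) * x ^ (k / 2) * x = _
          ring
        · have hm : k % 2 = 0 := Nat.eq_of_beq_eq_true h
          simp only [cond_false, cond_true, complexOps]
          conv_rhs => rw [← h2, hm]
          change x ^ (k / 2) * x ^ (k / 2) = _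
          ring
      · obtain rfl : k = 1 := Nat.eq_of_beq_eq_true h1
        simp
    · obtain rfl : k = 0 := Nat.eq_of_beq_eq_true h0
      simp [complexOps]

/-- `[q ^ [k - 1], …, q ^ [0]]` -/
def brkPowers (t : ℕ) (q : ℂ) : ℕ → List ℂ
  | 0 => []
  | k + 1 => q ^ brk t k :: brkPowers t q k

lemma complexOps_levels (t : ℕ) (q : ℂ) (k i : ℕ) :
    complexOps.levels t q k (q ^ brk t i) (brkPowers t q i) = brkPowers t q (i + k) := by
  induction k generalizing i with
  | zero => rfl
  | succ k ih =>
    have : complexOps.mul (complexOps.powAux (q ^ brk t i) t t) q = q ^ brk t (i + 1) := by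
      rw [complexOps_powAux _ _ _ le_rfl, ← pow_mul, mul_comm (brk t i)]
      exact (pow_succ _ _).symm
    rw [RingOps.levels, this]
    have := ih (i + 1)
    rw [show i + (k + 1) = i + 1 + k by ring, ← this]
    rfl

lemma complexOps_horner {t : ℕ} (ht : 1 ≤ t) {q : ℂ} (hq : ‖q‖ < 1) (i : ℕ) (Q : ℂ) :
    complexOps.horner (brkPowers t q i) (Q * (1 - altSum t 0 i q)) Q (Q * altSum t 1 i q) =
      ⟨(Q * ∏ k ∈ Finset.range i, (1 - q ^ brk t k)) * treeDen t q,
        Q * ∏ k ∈ Finset.range i, (1 - q ^ brk t k),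
        (Q * ∏ k ∈ Finset.range i, (1 - q ^ brk t k)) * (1 - treeNum t q)⟩ := by
  induction i generalizing Q with
  | zero => simp [brkPowers, RingOps.horner, treeDen, treeNum]
  | succ i ih =>
    have h := one_sub_pow_ne_zero hq (brk_pos ht i)
    have h0 := altSum_eq ht hq 0 i
    have h1 := altSum_eq ht hq 1 i
    rw [brkRatio] at h0 h1
    rw [brkPowers, RingOps.horner, Finset.prod_range_succ]
    have := ih ((1 - q ^ brk t i) * Q)
    rw [show Q * ((∏ k ∈ Finset.range i, (1 - q ^ brk t k)) * (1 - q ^ brk t i)) =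
      (1 - q ^ brk t i) * Q * ∏ k ∈ Finset.range i, (1 - q ^ brk t k) by ring, ← this, h0, h1]
    simp only [complexOps]
    congr 1
    · field_simp
      ring
    · field_simp
      ring

/-- The factor `∏ (1 - q ^ [k])`. -/
noncomputable def brkProd (t K : ℕ) (q : ℂ) : ℂ := ∏ k ∈ Finset.range K, (1 - q ^ brk t k)

lemma complexOps_eval {t : ℕ} (ht : 1 ≤ t) (K : ℕ) {q : ℂ} (hq : ‖q‖ < 1) :
    complexOps.eval t K q (1 - altSum t 0 K q) (altSum t 1 K q) =
      ⟨brkProd t K q * treeDen t q, brkProd t K q, brkProd t K q * (1 - treeNum t q)⟩ := by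
  have h1 := complexOps_horner ht hq K 1
  have h2 := complexOps_levels t q K 0
  simp only [one_mul, zero_add, brk, pow_one, brkPowers] at h1 h2
  rw [RingOps.eval, h2]
  exact h1

lemma brkProd_ne_zero {t : ℕ} (ht : 1 ≤ t) (K : ℕ) {q : ℂ} (hq : ‖q‖ < 1) :
    brkProd t K q ≠ 0 :=
  Finset.prod_ne_zero_iff.mpr fun k _ => one_sub_pow_ne_zero hq (brk_pos ht k)

lemma funOps_eval (t K : ℕ) (N M : ℂ → ℂ) (q : ℂ) :
    RingOps.State.Rel (fun f z => f q = z) (funOps.eval t K id N M)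
      (complexOps.eval t K q (N q) (M q)) := by
  have hc : RingOps.Compat funOps complexOps (fun f z => f q = z) :=
    ⟨rfl, by rintro _ _ _ _ rfl rfl; rfl, by rintro _ _ _ _ rfl rfl; rfl⟩
  exact hc.eval t K rfl rfl rfl

/-! ### Disc arithmetic with natural number data -/

/-- A disc in the complex plane: centre `((a - bias) + (b - bias) * I) / scale` and radius
`r / scale`. -/
structure Ball where
  a : ℕ
  b : ℕ
  r : ℕ

namespace Ball

def scale : ℕ := 1000000000000000000000000000000

/-- The offset makes signed coordinates natural numbers. If a truncated subtraction clips all the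
same, the lost amount goes into the radius, so soundness needs no range condition. -/
def bias : ℕ := 1000000000000000000000000000000000

/-- `|a - bias|` -/
def mag (a : ℕ) : ℕ := Nat.add (Nat.sub a bias) (Nat.sub bias a)

/-- Since `27 / 64 > √2 - 1`, the larger coordinate plus this multiple of the smaller bounds the
Euclidean norm; the added `1` absorbs the rounding of the division. -/
def hyp (u v : ℕ) : ℕ :=
  bif Nat.ble u v then Nat.add v (Nat.add (Nat.div (Nat.mul 27 u) 64) 1)
  else Nat.add u (Nat.add (Nat.div (Nat.mul 27 v) 64) 1)

/-- An upper bound for the norm of the centre. -/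
def nup (x : Ball) : ℕ := hyp (mag x.a) (mag x.b)

def one : Ball := ⟨Nat.add bias scale, bias, 0⟩

def zero : Ball := ⟨bias, bias, 0⟩

def subBias (a c : ℕ) : ℕ := Nat.sub (Nat.add a bias) c

def sub (x y : Ball) : Ball :=
  ⟨subBias x.a y.a, subBias x.b y.b,
    Nat.add (Nat.add x.r y.r) (Nat.add (Nat.sub y.a (Nat.add x.a bias))
      (Nat.sub y.b (Nat.add x.b bias)))⟩

def add (x y : Ball) : Ball := sub x (sub zero y)

def quot (m n : ℕ) : ℕ := Nat.div (Nat.sub m n) scale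

/-- The `3` pays for rounding: one unit for `s / scale` and one for each coordinate. The last two
differences vanish unless a subtraction clips. -/
def mulBalls (m n m' n' s : ℕ) : Ball :=
  ⟨quot m n, quot m' n', Nat.add (Nat.add (Nat.div s scale) 3) (Nat.add (Nat.sub n m) (Nat.sub n' m'))⟩

/-- In the expanded real and imaginary parts of the product of the centres, the positive terms come
first and the negative ones second; `bias * scale` is added so that the quotients are biased again.
-/
def mul (x y : Ball) : Ball :=
  mulBalls
    (Nat.add (Nat.add (Nat.mul x.a y.a) (Nat.mul bias (Nat.add x.b y.b))) (Nat.mul bias scale))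
    (Nat.add (Nat.mul x.b y.b) (Nat.mul bias (Nat.add x.a y.a)))
    (Nat.add (Nat.add (Nat.add (Nat.mul x.a y.b) (Nat.mul x.b y.a))
      (Nat.mul 2 (Nat.mul bias bias))) (Nat.mul bias scale))
    (Nat.mul bias (Nat.add (Nat.add x.a y.a) (Nat.add x.b y.b)))
    (Nat.add (Nat.add (Nat.mul (nup x) y.r) (Nat.mul (nup y) x.r)) (Nat.mul x.r y.r))

def ops : RingOps Ball := ⟨one, mul, sub⟩

noncomputable def ctr (x : Ball) : ℂ := ⟨(x.a : ℝ) - bias, (x.b : ℝ) - bias⟩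

def Mem (x : Ball) (z : ℂ) : Prop := ‖z * (scale : ℂ) - ctr x‖ ≤ x.r

lemma mag_cast (a : ℕ) : (mag a : ℝ) = |(a : ℝ) - bias| := by
  change ((a - bias + (bias - a) : ℕ) : ℝ) = _
  rcases le_total a bias with h | h
  · rw [Nat.sub_eq_zero_of_le h, zero_add, Nat.cast_sub h, abs_of_nonpos]
    · ring
    · have : (a : ℝ) ≤ bias := by exact_mod_cast h
      linarith
  · rw [Nat.sub_eq_zero_of_le h, add_zero, Nat.cast_sub h, abs_of_nonneg]
    have : (bias : ℝ) ≤ a := by exact_mod_cast h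
    linarith

lemma sqrt_le_of_le {u v w : ℝ} (hu : 0 ≤ u) (huv : u ≤ v) (h : v + 27 * u / 64 ≤ w) :
    √(u ^ 2 + v ^ 2) ≤ w := by
  refine Real.sqrt_le_iff.mpr ⟨by linarith, ?_⟩
  have : u ^ 2 + v ^ 2 ≤ (v + 27 * u / 64) ^ 2 := by nlinarith
  exact this.trans (pow_le_pow_left₀ (by linarith) h 2)

lemma lt_div_add_one (a b : ℕ) (hb : 0 < b) : (a : ℝ) / b ≤ ((Nat.add (Nat.div a b) 1 : ℕ) : ℝ) := by
  rw [div_le_iff₀ (by exact_mod_cast hb)]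
  have := Nat.lt_div_mul_add (a := a) hb
  change (a : ℝ) ≤ ((a / b + 1 : ℕ) : ℝ) * b
  have h : a ≤ (a / b + 1) * b := by nlinarith
  exact_mod_cast h

lemma sqrt_le_hyp (u v : ℕ) : √((u : ℝ) ^ 2 + (v : ℝ) ^ 2) ≤ hyp u v := by
  unfold hyp
  cases h : Nat.ble u v
  · have h' : v ≤ u := by
      have : ¬ u ≤ v := fun h' => by rw [Nat.ble_eq_true_of_le h'] at h; simp at h
      omega
    rw [cond_false, add_comm ((u : ℝ) ^ 2)]
    refine sqrt_le_of_le (by positivity) (by exact_mod_cast h') ?_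
    change _ ≤ ((u + Nat.add (Nat.div (27 * v) 64) 1 : ℕ) : ℝ)
    have := lt_div_add_one (27 * v) 64 (by norm_num)
    push_cast at this ⊢
    linarith
  · have h' : u ≤ v := Nat.le_of_ble_eq_true h
    rw [cond_true]
    refine sqrt_le_of_le (by positivity) (by exact_mod_cast h') ?_
    change _ ≤ ((v + Nat.add (Nat.div (27 * u) 64) 1 : ℕ) : ℝ)
    have := lt_div_add_one (27 * u) 64 (by norm_num)
    push_cast at this ⊢
    linarith

lemma norm_ctr (x : Ball) : ‖ctr x‖ = √((mag x.a : ℝ) ^ 2 + (mag x.b : ℝ) ^ 2) := by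
  rw [mag_cast, mag_cast, sq_abs, sq_abs, Complex.norm_eq_sqrt_sq_add_sq]
  rfl

lemma norm_ctr_le (x : Ball) : ‖ctr x‖ ≤ nup x := by
  rw [norm_ctr]; exact sqrt_le_hyp _ _

lemma scale_pos : (0 : ℝ) < scale := by norm_num [scale]

lemma mem_one : one.Mem 1 := by
  have h : ctr one = (scale : ℂ) := by
    apply Complex.ext
    · change ((bias + scale : ℕ) : ℝ) - bias = _
      simp
    · change ((bias : ℕ) : ℝ) - bias = _
      simp
  rw [Mem, h]
  simp [one]

lemma mem_zero : zero.Mem 0 := by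
  have h : ctr zero = 0 := by
    apply Complex.ext <;> simp [ctr, zero]
  rw [Mem, h]
  simp [zero]

lemma norm_mk_le (x y : ℝ) : ‖(⟨x, y⟩ : ℂ)‖ ≤ |x| + |y| := Complex.norm_le_abs_re_add_abs_im _

lemma subBias_cast (a c : ℕ) :
    |((subBias a c : ℕ) : ℝ) - (a + bias - c)| ≤ ((Nat.sub c (Nat.add a bias) : ℕ) : ℝ) := by
  change |((a + bias - c : ℕ) : ℝ) - _| ≤ ((c - (a + bias) : ℕ) : ℝ)
  rcases le_total c (a + bias) with h | h
  · rw [Nat.cast_sub h, Nat.sub_eq_zero_of_le h]; simp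
  · rw [Nat.sub_eq_zero_of_le h, Nat.cast_sub h]
    have : ((a + bias : ℕ) : ℝ) ≤ c := by exact_mod_cast h
    push_cast at this ⊢
    rw [abs_of_nonneg (by linarith)]
    linarith

lemma mem_sub {x y : Ball} {z w : ℂ} (hx : x.Mem z) (hy : y.Mem w) : (sub x y).Mem (z - w) := by
  unfold Mem at *
  have h : ‖ctr x - ctr y - ctr (sub x y)‖ ≤
      ((Nat.add (Nat.sub y.a (Nat.add x.a bias)) (Nat.sub y.b (Nat.add x.b bias)) : ℕ) : ℝ) := by
    have e : ctr x - ctr y - ctr (sub x y) =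
        ⟨(x.a + bias - y.a) - ((subBias x.a y.a : ℕ) : ℝ),
          (x.b + bias - y.b) - ((subBias x.b y.b : ℕ) : ℝ)⟩ := by
      apply Complex.ext
      · simp only [Complex.sub_re, ctr, sub]; ring
      · simp only [Complex.sub_im, ctr, sub]; ring
    rw [e]
    refine (norm_mk_le _ _).trans ?_
    rw [abs_sub_comm, abs_sub_comm (_ - (y.b : ℝ))]
    refine (add_le_add (subBias_cast _ _) (subBias_cast _ _)).trans (le_of_eq ?_)
    exact (Nat.cast_add _ _).symm
  have e : (z - w) * (scale : ℂ) - ctr (sub x y) =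
      (z * scale - ctr x) - (w * scale - ctr y) + (ctr x - ctr y - ctr (sub x y)) := by ring
  rw [e]
  refine (norm_add_le _ _).trans ((add_le_add ((norm_sub_le _ _).trans (add_le_add hx hy)) h).trans
    (le_of_eq ?_))
  change _ = ((x.r + y.r + _ : ℕ) : ℝ)
  push_cast
  rfl

lemma mem_add {x y : Ball} {z w : ℂ} (hx : x.Mem z) (hy : y.Mem w) : (add x y).Mem (z + w) := by
  have := mem_sub hx (mem_sub mem_zero hy)
  rwa [zero_sub, sub_neg_eq_add] at this

lemma quot_cast (m n : ℕ) :
    |((quot m n : ℕ) : ℝ) - ((m : ℝ) - n) / scale| ≤ 1 + ((Nat.sub n m : ℕ) : ℝ) := by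
  change |(((m - n) / scale : ℕ) : ℝ) - _| ≤ 1 + ((n - m : ℕ) : ℝ)
  have hs := scale_pos
  rcases le_total n m with h | h
  · rw [Nat.sub_eq_zero_of_le h, ← Nat.cast_sub h]
    have h1 : (((m - n) / scale : ℕ) : ℝ) ≤ ((m - n : ℕ) : ℝ) / scale := Nat.cast_div_le
    have h2 := lt_div_add_one (m - n) scale (by norm_num [scale])
    change _ ≤ (((m - n) / scale + 1 : ℕ) : ℝ) at h2
    push_cast at h2 ⊢
    rw [abs_le]; constructor <;> linarith
  · rw [Nat.sub_eq_zero_of_le h, Nat.zero_div, Nat.cast_sub h, Nat.cast_zero, zero_sub, ← neg_div,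
      neg_sub]
    have h3 : (m : ℝ) ≤ n := by exact_mod_cast h
    have h4 : (1 : ℝ) ≤ scale := by norm_num [scale]
    rw [abs_of_nonneg (div_nonneg (by linarith) hs.le)]
    have := div_le_self (sub_nonneg.mpr h3) h4
    linarith

lemma mem_mul {x y : Ball} {z w : ℂ} (hx : x.Mem z) (hy : y.Mem w) : (mul x y).Mem (z * w) := by
  unfold Mem at *
  have hs := scale_pos
  have hsc : (scale : ℂ) ≠ 0 := by
    rw [← Complex.ofReal_natCast]; exact Complex.ofReal_ne_zero.mpr hs.ne'
  have hnx := norm_ctr_le x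
  have hny := norm_ctr_le y
  have e : z * w * (scale : ℂ) - ctr (mul x y) =
      (ctr x * (w * scale - ctr y) + ctr y * (z * scale - ctr x) +
        (z * scale - ctr x) * (w * scale - ctr y)) / scale +
      (ctr x * ctr y / scale - ctr (mul x y)) := by
    field_simp; ring
  have h1 : ‖(ctr x * (w * scale - ctr y) + ctr y * (z * scale - ctr x) +
        (z * scale - ctr x) * (w * scale - ctr y)) / scale‖ ≤
      ((nup x * y.r + nup y * x.r + x.r * y.r : ℕ) : ℝ) / scale := by
    rw [norm_div, Complex.norm_natCast]
    refine div_le_div_of_nonneg_right ?_ hs.le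
    refine (norm_add_le _ _).trans ?_
    push_cast
    refine add_le_add ((norm_add_le _ _).trans (add_le_add ?_ ?_)) ?_ <;> rw [norm_mul]
    · exact mul_le_mul hnx hy (norm_nonneg _) (Nat.cast_nonneg _)
    · exact mul_le_mul hny hx (norm_nonneg _) (Nat.cast_nonneg _)
    · exact mul_le_mul hx hy (norm_nonneg _) (Nat.cast_nonneg _)
  have h1' := lt_div_add_one (nup x * y.r + nup y * x.r + x.r * y.r) scale (by norm_num [scale])
  set m := Nat.add (Nat.add (Nat.mul x.a y.a) (Nat.mul bias (Nat.add x.b y.b))) (Nat.mul bias scale)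
    with hm
  set n := Nat.add (Nat.mul x.b y.b) (Nat.mul bias (Nat.add x.a y.a)) with hn
  set m' := Nat.add (Nat.add (Nat.add (Nat.mul x.a y.b) (Nat.mul x.b y.a))
      (Nat.mul 2 (Nat.mul bias bias))) (Nat.mul bias scale) with hm'
  set n' := Nat.mul bias (Nat.add (Nat.add x.a y.a) (Nat.add x.b y.b)) with hn'
  have hre : (m : ℝ) - n = (ctr x * ctr y).re + bias * scale := by
    have hm : m = x.a * y.a + bias * (x.b + y.b) + bias * scale := hm
    have hn : n = x.b * y.b + bias * (x.a + y.a) := hn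
    rw [hm, hn, Complex.mul_re]
    simp only [ctr]
    push_cast
    ring
  have him : (m' : ℝ) - n' = (ctr x * ctr y).im + bias * scale := by
    have hm : m' = x.a * y.b + x.b * y.a + 2 * (bias * bias) + bias * scale := hm'
    have hn : n' = bias * (x.a + y.a + (x.b + y.b)) := hn'
    rw [hm, hn, Complex.mul_im]
    simp only [ctr]
    push_cast
    ring
  have h2 : ‖ctr x * ctr y / scale - ctr (mul x y)‖ ≤
      (1 + ((Nat.sub n m : ℕ) : ℝ)) + (1 + ((Nat.sub n' m' : ℕ) : ℝ)) := by
    have e2 : ctr x * ctr y / scale - ctr (mul x y) =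
        ⟨((m : ℝ) - n) / scale - ((quot m n : ℕ) : ℝ), ((m' : ℝ) - n') / scale - ((quot m' n' : ℕ) : ℝ)⟩ := by
      have hd : ctr x * ctr y / (scale : ℂ) = ctr x * ctr y / ((scale : ℝ) : ℂ) := by simp
      apply Complex.ext
      · rw [Complex.sub_re, hd, Complex.div_ofReal_re, hre, add_div, mul_div_cancel_right₀ _ hs.ne']
        change _ - (((quot m n : ℕ) : ℝ) - bias) = _
        ring
      · rw [Complex.sub_im, hd, Complex.div_ofReal_im, him, add_div, mul_div_cancel_right₀ _ hs.ne']
        change _ - (((quot m' n' : ℕ) : ℝ) - bias) = _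
        ring
    rw [e2]
    refine (norm_mk_le _ _).trans ?_
    rw [abs_sub_comm, abs_sub_comm (_ / _)]
    exact add_le_add (quot_cast _ _) (quot_cast _ _)
  rw [e]
  refine (norm_add_le _ _).trans ((add_le_add (h1.trans h1') h2).trans (le_of_eq ?_))
  change ((Nat.div (nup x * y.r + nup y * x.r + x.r * y.r) scale + 1 : ℕ) : ℝ) + _ =
    ((Nat.div (nup x * y.r + nup y * x.r + x.r * y.r) scale + 3 + (Nat.sub n m + Nat.sub n' m') : ℕ) : ℝ)
  push_cast
  ring

lemma compat : RingOps.Compat ops complexOps Mem := ⟨mem_one, mem_mul, mem_sub⟩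

end Ball

/-! ### Tail bounds and evaluation with derivatives -/

/-- Cauchy's estimate on the circle of radius `s - s'` about `q`, which stays in the disc where the
series is bounded. -/
lemma norm_deriv_altSum_le {t : ℕ} (ht : 1 ≤ t) {s s' : ℝ} (hs : s < 1) (hss : s' < s) {q : ℂ}
    (hq : ‖q‖ ≤ s') (b i : ℕ) (hi : s ^ brk t i ≤ 1 / 3) :
    ‖deriv (altSum t b i) q‖ ≤ 3 * s ^ brk t i / (s - s') := by
  have hsub : Metric.closedBall q (s - s') ⊆ Metric.closedBall 0 s := by
    refine Metric.closedBall_subset_closedBall' ?_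
    rw [dist_zero_right]; linarith
  refine Complex.norm_deriv_le_of_forall_mem_sphere_norm_le (by linarith) ?_ fun z hz => ?_
  · refine (DifferentiableOn.diffContOnCl ?_)
    rw [closure_ball _ (by linarith)]
    intro z hz
    have := mem_closedBall_zero_iff.mp (hsub hz)
    exact (differentiableAt_altSum ht b i (by linarith)).differentiableWithinAt
  · have := mem_closedBall_zero_iff.mp (hsub (Metric.sphere_subset_closedBall hz))
    exact norm_altSum_le ht hs this b i hi

/-- The denominator and the numerator multiplied by `∏ (1 - q ^ [k])`. -/
noncomputable def clearedDen (t K : ℕ) (q : ℂ) : ℂ := brkProd t K q * treeDen t q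

noncomputable def clearedNum (t K : ℕ) (q : ℂ) : ℂ := brkProd t K q * treeNum t q

/-- `τ / scale` bounds the tails at level `K` and their derivatives for `‖q‖ ≤ s`. -/
def TailBound (t K τ : ℕ) (s : ℝ) : Prop :=
  s < 1 ∧ ∀ b, ∀ q : ℂ, ‖q‖ ≤ s → ‖altSum t b K q‖ * Ball.scale ≤ τ ∧
    ‖deriv (altSum t b K) q‖ * Ball.scale ≤ τ

/-- Integer form of `3 * s ^ [K] / (s - s') ≤ τ / scale` with `s = m / 1000` and `s' = m' / 1000`.
As `s - s' < 1`, the bound for derivatives also covers values. -/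
def tailCheck (t K τ m' m : ℕ) : Bool :=
  Nat.blt m' m && Nat.blt m 1000 && Nat.ble (3 * m ^ brk t K) (1000 ^ brk t K) &&
    Nat.ble (3 * m ^ brk t K * (1000 * Ball.scale)) (τ * (m - m') * 1000 ^ brk t K)

lemma tailBound_of_check {t K τ m' m : ℕ} (ht : 1 ≤ t) (h : tailCheck t K τ m' m = true) :
    TailBound t K τ ((m' : ℝ) / 1000) := by
  simp only [tailCheck, Bool.and_eq_true, Nat.blt_eq, Nat.ble_eq] at h
  obtain ⟨⟨⟨h1, h2⟩, h3⟩, h4⟩ := h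
  have h1' : (m' : ℝ) < m := by exact_mod_cast h1
  have h2' : (m : ℝ) < 1000 := by exact_mod_cast h2
  have h3' : 3 * (m : ℝ) ^ brk t K ≤ 1000 ^ brk t K := by exact_mod_cast h3
  have h4' : 3 * (m : ℝ) ^ brk t K * (1000 * Ball.scale) ≤ τ * (m - m') * 1000 ^ brk t K := by
    rw [← Nat.cast_sub h1.le]; exact_mod_cast h4
  have hs := Ball.scale_pos
  have hpos : (0 : ℝ) < 1000 ^ brk t K := by positivity
  have hs1 : ((m : ℝ) / 1000) ^ brk t K ≤ 1 / 3 := by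
    rw [div_pow, div_le_iff₀ hpos]; linarith
  have key : 3 * ((m : ℝ) / 1000) ^ brk t K / ((m : ℝ) / 1000 - (m' : ℝ) / 1000) * Ball.scale ≤ τ := by
    rw [div_mul_eq_mul_div, div_le_iff₀ (by linarith), div_pow, ← sub_div, mul_div_assoc',
      div_mul_eq_mul_div, div_le_iff₀ hpos]
    have : τ * (((m : ℝ) - m') / 1000) * 1000 ^ brk t K = τ * (m - m') * 1000 ^ brk t K / 1000 := by
      ring
    rw [this, le_div_iff₀ (by norm_num)]
    linarith
  have hm0 : (0 : ℝ) ≤ m' := Nat.cast_nonneg _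
  refine ⟨by linarith, fun b q hq => ⟨?_, ?_⟩⟩
  · refine le_trans ?_ key
    refine mul_le_mul_of_nonneg_right ?_ hs.le
    refine (norm_altSum_le ht (by linarith) (hq.trans (by linarith)) b K hs1).trans ?_
    rw [le_div_iff₀ (by linarith)]
    exact mul_le_of_le_one_right (by positivity) (by linarith)
  · refine le_trans ?_ key
    exact mul_le_mul_of_nonneg_right
      (norm_deriv_altSum_le ht (by linarith) (by linarith) hq b K hs1) hs.le

namespace Ball

def around (a : ℕ) (τ : ℕ) : Ball := ⟨a, bias, τ⟩

lemma mem_around_one {w : ℂ} {τ : ℕ} (h : ‖w‖ * scale ≤ τ) :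
    (around (Nat.add bias scale) τ).Mem (1 - w) := by
  have e : ctr (around (Nat.add bias scale) τ) = (scale : ℂ) := by
    apply Complex.ext
    · change ((bias + scale : ℕ) : ℝ) - bias = _
      simp
    · change ((bias : ℕ) : ℝ) - bias = _
      simp
  rw [Mem, e, sub_mul, one_mul, sub_sub_cancel_left, norm_neg, norm_mul, Complex.norm_natCast]
  exact h

lemma mem_around_zero {w : ℂ} {τ : ℕ} (h : ‖w‖ * scale ≤ τ) : (around bias τ).Mem w := by
  have e : ctr (around bias τ) = 0 := by
    apply Complex.ext <;> simp [ctr, around]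
  rw [Mem, e, sub_zero, norm_mul, Complex.norm_natCast]
  exact h

/-- Balls for the cleared denominator, the clearing factor, and the factor minus the numerator. -/
def evalTree (t K τ : ℕ) (q : Ball) : RingOps.State Ball :=
  ops.eval t K q (around (Nat.add bias scale) τ) (around bias τ)

lemma mem_evalTree {t K τ : ℕ} {s : ℝ} (ht : 1 ≤ t) (hT : TailBound t K τ s) {x : Ball} {q : ℂ}
    (hx : x.Mem q) (hq : ‖q‖ ≤ s) :
    (evalTree t K τ x).den.Mem (clearedDen t K q) ∧
      (sub (evalTree t K τ x).prod (evalTree t K τ x).num).Mem (clearedNum t K q) := by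
  have h := compat.eval t K hx (mem_around_one (hT.2 0 q hq).1) (mem_around_zero (hT.2 1 q hq).1)
  rw [complexOps_eval ht K (hq.trans_lt hT.1)] at h
  refine ⟨h.den, ?_⟩
  have := mem_sub h.prod h.num
  simp only at this
  rwa [mul_sub, mul_one, sub_sub_cancel] at this

/-- Dual numbers: value and derivative are enclosed together, with the Leibniz rule as
multiplication. -/
def jetOps : RingOps (Ball × Ball) where
  one := (one, zero)
  mul x y := (mul x.1 y.1, add (mul x.2 y.1) (mul x.1 y.2))
  sub x y := (sub x.1 y.1, sub x.2 y.2)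

def JetMem (q : ℂ) (j : Ball × Ball) (f : ℂ → ℂ) : Prop :=
  j.1.Mem (f q) ∧ ∃ f', HasDerivAt f f' q ∧ j.2.Mem f'

lemma jet_compat (q : ℂ) : RingOps.Compat jetOps funOps (JetMem q) where
  one := ⟨mem_one, 0, hasDerivAt_const _ _, mem_zero⟩
  mul := by
    rintro x f y g ⟨hx, f', hf, hx'⟩ ⟨hy, g', hg, hy'⟩
    exact ⟨mem_mul hx hy, _, hf.mul hg, mem_add (mem_mul hx' hy) (mem_mul hx hy')⟩
  sub := by
    rintro x f y g ⟨hx, f', hf, hx'⟩ ⟨hy, g', hg, hy'⟩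
    exact ⟨mem_sub hx hy, _, hf.sub hg, mem_sub hx' hy'⟩

def evalJet (t K τ : ℕ) (q : Ball) : RingOps.State (Ball × Ball) :=
  jetOps.eval t K (q, one) (around (Nat.add bias scale) τ, around bias τ)
    (around bias τ, around bias τ)

lemma mem_evalJet {t K τ : ℕ} {s : ℝ} (ht : 1 ≤ t) (hT : TailBound t K τ s) {x : Ball} {q : ℂ}
    (hx : x.Mem q) (hq : ‖q‖ ≤ s) :
    (∃ f', HasDerivAt (clearedDen t K) f' q ∧ (evalJet t K τ x).den.2.Mem f') ∧
      (sub (evalJet t K τ x).prod.1 (evalJet t K τ x).num.1).Mem (clearedNum t K q) := by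
  have hq1 := hq.trans_lt hT.1
  have hN : JetMem q (around (Nat.add bias scale) τ, around bias τ) fun z => 1 - altSum t 0 K z := by
    refine ⟨mem_around_one (hT.2 0 q hq).1, _,
      (differentiableAt_altSum ht 0 K hq1).hasDerivAt.const_sub 1, mem_around_zero ?_⟩
    rw [norm_neg]; exact (hT.2 0 q hq).2
  have hM : JetMem q (around bias τ, around bias τ) (altSum t 1 K) :=
    ⟨mem_around_zero (hT.2 1 q hq).1, _, (differentiableAt_altSum ht 1 K hq1).hasDerivAt,
      mem_around_zero (hT.2 1 q hq).2⟩
  have hid : JetMem q (x, one) id := ⟨hx, 1, hasDerivAt_id q, mem_one⟩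
  have h := (jet_compat q).eval t K hid hN hM
  -- The functions built by the program agree with the cleared functions on the whole unit disc, so
  -- the enclosed derivative is also theirs.
  have hval : ∀ z : ℂ, ‖z‖ < 1 → RingOps.State.Rel (fun (f : ℂ → ℂ) w => f z = w)
      (funOps.eval t K id (fun z => 1 - altSum t 0 K z) (altSum t 1 K))
      ⟨clearedDen t K z, brkProd t K z, brkProd t K z * (1 - treeNum t z)⟩ := by
    intro z hz
    have := funOps_eval t K (fun z => 1 - altSum t 0 K z) (altSum t 1 K) z
    rwa [complexOps_eval ht K hz] at this
  refine ⟨?_, ?_⟩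
  · obtain ⟨-, f', hf', hm⟩ := h.den
    refine ⟨f', hf'.congr_of_eventuallyEq ?_, hm⟩
    filter_upwards [Metric.isOpen_ball.mem_nhds (mem_ball_zero_iff.mpr hq1)] with z hz
    exact ((hval z (mem_ball_zero_iff.mp hz)).den).symm
  · have h1 := h.prod.1
    have h2 := h.num.1
    rw [(hval q hq1).prod] at h1
    rw [(hval q hq1).num] at h2
    have := mem_sub h1 h2
    rwa [mul_sub, mul_one, sub_sub_cancel] at this

/-! ### Squares -/

/-- `z` lies in the square of side `2 h` with lower left corner `(a, b)`. -/
def InSq (a b h : ℕ) (z : ℂ) : Prop :=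
  ((a : ℝ) ≤ z.re * scale + bias ∧ z.re * scale + bias ≤ a + 2 * h) ∧
    ((b : ℝ) ≤ z.im * scale + bias ∧ z.im * scale + bias ≤ b + 2 * h)

/-- Quadtree search on the square of half side `2 ^ k`; the offset `2 ^ (k + 1)` is the full side of
a quarter. -/
def cover (leaf : ℕ → ℕ → ℕ → Bool) : ℕ → ℕ → ℕ → Bool
  | 0, a, b => leaf a b 1
  | k + 1, a, b => leaf a b (Nat.pow 2 (k + 1)) ||
      (cover leaf k a b && cover leaf k (Nat.add a (Nat.pow 2 (k + 1))) b &&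
        cover leaf k a (Nat.add b (Nat.pow 2 (k + 1))) &&
        cover leaf k (Nat.add a (Nat.pow 2 (k + 1))) (Nat.add b (Nat.pow 2 (k + 1))))

lemma exists_leaf_of_cover {leaf : ℕ → ℕ → ℕ → Bool} {k a b : ℕ} (h : cover leaf k a b = true)
    {z : ℂ} (hz : InSq a b (2 ^ k) z) : ∃ a' b' h', leaf a' b' h' = true ∧ InSq a' b' h' z := by
  induction k generalizing a b with
  | zero => exact ⟨a, b, 1, h, hz⟩
  | succ k ih =>
    simp only [cover, Bool.or_eq_true, Bool.and_eq_true] at h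
    rcases h with h | ⟨⟨⟨h1, h2⟩, h3⟩, h4⟩
    · exact ⟨a, b, _, h, hz⟩
    obtain ⟨⟨hz1, hz2⟩, hz3, hz4⟩ := hz
    have hp : ((2 ^ (k + 1) : ℕ) : ℝ) = 2 * ((2 ^ k : ℕ) : ℝ) := by push_cast; ring
    have hc : ∀ x : ℕ, ((Nat.add x (Nat.pow 2 (k + 1)) : ℕ) : ℝ) = x + 2 * ((2 ^ k : ℕ) : ℝ) := by
      intro x; rw [← hp]; exact Nat.cast_add _ _
    rw [hp] at hz2 hz4
    rcases le_total (z.re * scale + bias) (a + 2 * ((2 ^ k : ℕ) : ℝ)) with hx | hx <;>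
      rcases le_total (z.im * scale + bias) (b + 2 * ((2 ^ k : ℕ) : ℝ)) with hy | hy
    · exact ih h1 ⟨⟨hz1, hx⟩, hz3, hy⟩
    · exact ih h3 ⟨⟨hz1, hx⟩, by rwa [hc], by rw [hc]; linarith⟩
    · exact ih h2 ⟨⟨by rwa [hc], by rw [hc]; linarith⟩, hz3, hy⟩
    · exact ih h4 ⟨⟨by rwa [hc], by rw [hc]; linarith⟩, by rwa [hc], by rw [hc]; linarith⟩

/-- Two squares of side `2 ^ 100 ≥ scale` on the two sides of the imaginary axis contain the upper
half of the unit disc. -/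
def halfDiscCover (leaf : ℕ → ℕ → ℕ → Bool) : Bool :=
  cover leaf 99 (Nat.sub bias (Nat.pow 2 100)) bias && cover leaf 99 bias bias

lemma exists_leaf_of_halfDiscCover {leaf : ℕ → ℕ → ℕ → Bool} (h : halfDiscCover leaf = true)
    {z : ℂ} (hz : ‖z‖ ≤ 1) (him : 0 ≤ z.im) :
    ∃ a' b' h', leaf a' b' h' = true ∧ InSq a' b' h' z := by
  simp only [halfDiscCover, Bool.and_eq_true] at h
  have h1 := abs_le.mp ((Complex.abs_re_le_norm z).trans hz)
  have h2 := abs_le.mp ((Complex.abs_im_le_norm z).trans hz)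
  have hs := scale_pos
  have h3 : (scale : ℝ) ≤ 2 * ((2 ^ 99 : ℕ) : ℝ) := by norm_num [scale]
  have h4 : ((Nat.sub bias (Nat.pow 2 100) : ℕ) : ℝ) = bias - 2 * ((2 ^ 99 : ℕ) : ℝ) := by
    change ((bias - 2 ^ 100 : ℕ) : ℝ) = _
    rw [Nat.cast_sub (by norm_num [bias])]; norm_num
  have hy : InSq bias bias (2 ^ 99) z ↔ 0 ≤ z.re := by
    refine ⟨fun h => ?_, fun h => ⟨⟨?_, ?_⟩, ?_, ?_⟩⟩
    · have := h.1.1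
      by_contra hn
      have : z.re * scale < 0 := mul_neg_of_neg_of_pos (not_le.mp hn) hs
      linarith
    all_goals nlinarith
  rcases le_total 0 z.re with hr | hr
  · exact exists_leaf_of_cover h.2 (hy.mpr hr)
  · refine exists_leaf_of_cover h.1 ⟨⟨?_, ?_⟩, ?_, ?_⟩
    · rw [h4]; nlinarith
    · rw [h4]; nlinarith
    · nlinarith
    · nlinarith

/-- The disc around the square. -/
def sqBall (a b h : ℕ) : Ball :=
  ⟨Nat.add a h, Nat.add b h, Nat.add (Nat.div (Nat.mul h 182) 128) 1⟩

/-- `182 / 128` is a rational upper bound for `√2`. -/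
lemma norm_mk_le_of_abs_le {x y h : ℝ} (hx : |x| ≤ h) (hy : |y| ≤ h) :
    ‖(⟨x, y⟩ : ℂ)‖ ≤ h * 182 / 128 := by
  have h0 : 0 ≤ h := (abs_nonneg x).trans hx
  rw [Complex.norm_eq_sqrt_sq_add_sq]
  refine Real.sqrt_le_iff.mpr ⟨by positivity, ?_⟩
  have := sq_le_sq' (by linarith [neg_abs_le x]) ((le_abs_self x).trans hx)
  have := sq_le_sq' (by linarith [neg_abs_le y]) ((le_abs_self y).trans hy)
  simp only
  nlinarith

lemma mem_of_abs_le {a b h : ℕ} {z : ℂ} (h1 : |z.re * scale + bias - a| ≤ h)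
    (h2 : |z.im * scale + bias - b| ≤ h) :
    (⟨a, b, Nat.add (Nat.div (Nat.mul h 182) 128) 1⟩ : Ball).Mem z := by
  have e : z * (scale : ℂ) - ctr ⟨a, b, Nat.add (Nat.div (Nat.mul h 182) 128) 1⟩ =
      ⟨z.re * scale + bias - a, z.im * scale + bias - b⟩ := by
    rw [← Complex.ofReal_natCast]
    apply Complex.ext
    · rw [Complex.sub_re, Complex.re_mul_ofReal]; simp only [ctr]; ring
    · rw [Complex.sub_im, Complex.im_mul_ofReal]; simp only [ctr]; ring
  rw [Mem, e]
  refine (norm_mk_le_of_abs_le h1 h2).trans ?_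
  have := lt_div_add_one (h * 182) 128 (by norm_num)
  refine le_trans (le_of_eq ?_) this
  push_cast
  rfl

lemma InSq.mem {a b h : ℕ} {z : ℂ} (hz : InSq a b h z) : (sqBall a b h).Mem z := by
  have ha : ((Nat.add a h : ℕ) : ℝ) = a + h := Nat.cast_add _ _
  have hb : ((Nat.add b h : ℕ) : ℝ) = b + h := Nat.cast_add _ _
  refine mem_of_abs_le ?_ ?_
  · rw [abs_le, ha]; constructor <;> linarith [hz.1.1, hz.1.2]
  · rw [abs_le, hb]; constructor <;> linarith [hz.2.1, hz.2.2]

end Ball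

/-! ### Tests on balls and squares: zeros, quotients, windows -/

namespace Ball

def isNonzero (x : Ball) : Bool :=
  Nat.blt (Nat.mul x.r x.r) (Nat.add (Nat.mul (mag x.a) (mag x.a)) (Nat.mul (mag x.b) (mag x.b)))

lemma norm_ctr_sq (x : Ball) : ‖ctr x‖ ^ 2 = (mag x.a : ℝ) * mag x.a + (mag x.b : ℝ) * mag x.b := by
  rw [norm_ctr, Real.sq_sqrt (by positivity)]; ring

lemma lt_norm_ctr_of_isNonzero {x : Ball} (h : isNonzero x = true) : (x.r : ℝ) < ‖ctr x‖ := by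
  rw [isNonzero, Nat.blt_eq] at h
  have h' : (x.r : ℝ) * x.r < (mag x.a : ℝ) * mag x.a + (mag x.b : ℝ) * mag x.b := by
    exact_mod_cast h
  rw [← norm_ctr_sq] at h'
  nlinarith [norm_nonneg (ctr x)]

lemma ne_zero_of_isNonzero {x : Ball} (h : isNonzero x = true) {z : ℂ} (hz : x.Mem z) : z ≠ 0 := by
  rintro rfl
  have := lt_norm_ctr_of_isNonzero h
  rw [Mem, zero_mul, zero_sub, norm_neg] at hz
  linarith

/-- `‖m‖ ≤ C * ‖n‖` on balls. -/
def ratioLe (C : ℕ) (m n : Ball) : Bool :=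
  Nat.ble (Nat.mul (Nat.add (nup m) (Nat.add m.r (Nat.mul C n.r)))
      (Nat.add (nup m) (Nat.add m.r (Nat.mul C n.r))))
    (Nat.mul (Nat.mul C C)
      (Nat.add (Nat.mul (mag n.a) (mag n.a)) (Nat.mul (mag n.b) (mag n.b))))

lemma norm_le_of_ratioLe {C : ℕ} {m n : Ball} (h : ratioLe C m n = true) {z w : ℂ} (hz : m.Mem z)
    (hw : n.Mem w) : ‖z‖ ≤ C * ‖w‖ := by
  rw [ratioLe, Nat.ble_eq] at h
  have h' : ((nup m : ℝ) + (m.r + C * n.r)) * (nup m + (m.r + C * n.r)) ≤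
      C * C * ((mag n.a : ℝ) * mag n.a + (mag n.b : ℝ) * mag n.b) := by
    exact_mod_cast h
  rw [← norm_ctr_sq] at h'
  have h1 : (nup m : ℝ) + (m.r + C * n.r) ≤ C * ‖ctr n‖ := by
    refine le_of_sq_le_sq ?_ (by positivity)
    nlinarith
  have hm := norm_ctr_le m
  have hs := scale_pos
  unfold Mem at hz hw
  have e1 : ‖z‖ * scale ≤ nup m + m.r := by
    have : ‖z * (scale : ℂ)‖ ≤ ‖z * (scale : ℂ) - ctr m‖ + ‖ctr m‖ := norm_le_norm_sub_add _ _
    rw [norm_mul, Complex.norm_natCast] at this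
    linarith
  have e2 : ‖ctr n‖ - n.r ≤ ‖w‖ * scale := by
    have : ‖ctr n‖ ≤ ‖ctr n - w * (scale : ℂ)‖ + ‖w * (scale : ℂ)‖ := norm_le_norm_sub_add _ _
    rw [norm_mul, Complex.norm_natCast, norm_sub_rev] at this
    linarith
  have hC : (0 : ℝ) ≤ C := Nat.cast_nonneg _
  refine le_of_mul_le_mul_right ?_ hs
  nlinarith

/-- Lower bound for the distance of the interval `[a, a + 2 h]` from `bias`. -/
def gapLo (a h : ℕ) : ℕ := Nat.add (Nat.sub a bias) (Nat.sub bias (Nat.add a (Nat.add h h)))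

def gapHi (a h : ℕ) : ℕ :=
  bif Nat.ble (mag a) (mag (Nat.add a (Nat.add h h))) then mag (Nat.add a (Nat.add h h)) else mag a

def isOutside (r a b h : ℕ) : Bool :=
  Nat.blt (Nat.mul r r)
    (Nat.add (Nat.mul (gapLo a h) (gapLo a h)) (Nat.mul (gapLo b h) (gapLo b h)))

def isInside (r a b h : ℕ) : Bool :=
  Nat.blt (Nat.add (Nat.mul (gapHi a h) (gapHi a h)) (Nat.mul (gapHi b h) (gapHi b h)))
    (Nat.mul r r)

lemma gapLo_le {a h : ℕ} {x : ℝ} (h1 : (a : ℝ) ≤ x + bias) (h2 : x + bias ≤ a + 2 * h) :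
    (gapLo a h : ℝ) ≤ |x| := by
  change ((a - bias + (bias - (a + (h + h))) : ℕ) : ℝ) ≤ _
  rcases le_total bias a with hb | hb
  · rw [Nat.sub_eq_zero_of_le (show bias ≤ a + (h + h) by omega), add_zero, Nat.cast_sub hb]
    exact le_trans (by linarith) (le_abs_self x)
  · rw [Nat.sub_eq_zero_of_le hb, zero_add]
    rcases le_total bias (a + (h + h)) with hb' | hb'
    · rw [Nat.sub_eq_zero_of_le hb', Nat.cast_zero]; exact abs_nonneg x
    · rw [Nat.cast_sub hb']
      push_cast
      exact le_trans (by linarith) (neg_le_abs x)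

lemma le_gapHi {a h : ℕ} {x : ℝ} (h1 : (a : ℝ) ≤ x + bias) (h2 : x + bias ≤ a + 2 * h) :
    |x| ≤ gapHi a h := by
  have key : |x| ≤ max (mag a : ℝ) (mag (a + (h + h)) : ℝ) := by
    rw [mag_cast, mag_cast]
    have := abs_le_max_abs_abs (show (a : ℝ) - bias ≤ x by linarith)
      (show x ≤ ((a + (h + h) : ℕ) : ℝ) - bias by push_cast; linarith)
    exact this
  refine key.trans ?_
  unfold gapHi
  change _ ≤ ((bif Nat.ble (mag a) (mag (a + (h + h))) then mag (a + (h + h)) else mag a : ℕ) : ℝ)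
  cases hb : Nat.ble (mag a) (mag (a + (h + h)))
  · have : mag (a + (h + h)) ≤ mag a := by
      have : ¬ mag a ≤ mag (a + (h + h)) := fun h' => by
        rw [Nat.ble_eq_true_of_le h'] at hb; simp at hb
      omega
    simp only [cond_false]
    exact max_le le_rfl (by exact_mod_cast this)
  · have : mag a ≤ mag (a + (h + h)) := Nat.le_of_ble_eq_true hb
    simp only [cond_true]
    exact max_le (by exact_mod_cast this) le_rfl

lemma norm_mul_scale_sq (z : ℂ) :
    (‖z‖ * scale) ^ 2 = |z.re * scale| * |z.re * scale| + |z.im * scale| * |z.im * scale| := by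
  rw [mul_pow, ← Complex.normSq_eq_norm_sq, Complex.normSq_apply, abs_mul_abs_self, abs_mul_abs_self]
  ring

lemma InSq.lt_of_isOutside {r a b h : ℕ} {z : ℂ} (hz : InSq a b h z)
    (ho : isOutside r a b h = true) : (r : ℝ) < ‖z‖ * scale := by
  rw [isOutside, Nat.blt_eq] at ho
  have ho' : (r : ℝ) * r < (gapLo a h : ℝ) * gapLo a h + (gapLo b h : ℝ) * gapLo b h := by
    exact_mod_cast ho
  have h1 := gapLo_le hz.1.1 hz.1.2
  have h2 := gapLo_le hz.2.1 hz.2.2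
  have h3 := mul_self_le_mul_self (Nat.cast_nonneg _) h1
  have h4 := mul_self_le_mul_self (Nat.cast_nonneg _) h2
  have h5 := norm_mul_scale_sq z
  have h6 : 0 ≤ ‖z‖ * scale := mul_nonneg (norm_nonneg _) scale_pos.le
  nlinarith

lemma InSq.lt_of_isInside {r a b h : ℕ} {z : ℂ} (hz : InSq a b h z)
    (ho : isInside r a b h = true) : ‖z‖ * scale < r := by
  rw [isInside, Nat.blt_eq] at ho
  have ho' : (gapHi a h : ℝ) * gapHi a h + (gapHi b h : ℝ) * gapHi b h < (r : ℝ) * r := by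
    exact_mod_cast ho
  have h1 := le_gapHi hz.1.1 hz.1.2
  have h2 := le_gapHi hz.2.1 hz.2.2
  have h3 := mul_self_le_mul_self (abs_nonneg _) h1
  have h4 := mul_self_le_mul_self (abs_nonneg _) h2
  have h5 := norm_mul_scale_sq z
  have h6 : 0 ≤ ‖z‖ * scale := mul_nonneg (norm_nonneg _) scale_pos.le
  have h7 : (0 : ℝ) ≤ r := Nat.cast_nonneg _
  nlinarith

/-- The closed square with centre `(E, bias)` and half side `W`. -/
def InWindow (E W : ℕ) (z : ℂ) : Prop :=
  |z.re * scale + bias - E| ≤ W ∧ |z.im * scale + bias - (bias : ℝ)| ≤ W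

def inWindow (E W a b h : ℕ) : Bool :=
  Nat.ble E (Nat.add a W) && Nat.ble (Nat.add a (Nat.add h h)) (Nat.add E W) &&
    Nat.ble bias (Nat.add b W) && Nat.ble (Nat.add b (Nat.add h h)) (Nat.add bias W)

lemma InSq.inWindow {E W a b h : ℕ} {z : ℂ} (hz : InSq a b h z) (hw : inWindow E W a b h = true) :
    InWindow E W z := by
  simp only [Ball.inWindow, Bool.and_eq_true, Nat.ble_eq] at hw
  obtain ⟨⟨⟨h1, h2⟩, h3⟩, h4⟩ := hw
  have h1' : (E : ℝ) ≤ a + W := by exact_mod_cast h1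
  have h2' : (a : ℝ) + (h + h) ≤ E + W := by exact_mod_cast h2
  have h3' : (bias : ℝ) ≤ b + W := by exact_mod_cast h3
  have h4' : (b : ℝ) + (h + h) ≤ bias + W := by exact_mod_cast h4
  obtain ⟨⟨_, _⟩, _, _⟩ := hz
  constructor <;> rw [abs_le] <;> constructor <;> linarith

def zeroLeaf (t K τ r E₁ W₁ E₂ W₂ a b h : ℕ) : Bool :=
  isOutside r a b h || inWindow E₁ W₁ a b h || inWindow E₂ W₂ a b h ||
    isNonzero (evalTree t K τ (sqBall a b h)).den

def boundLeaf (t K τ r₁ r₂ C a b h : ℕ) : Bool :=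
  isOutside r₂ a b h || isInside r₁ a b h ||
    ratioLe C (sub (evalTree t K τ (sqBall a b h)).prod (evalTree t K τ (sqBall a b h)).num)
      (evalTree t K τ (sqBall a b h)).den

lemma inWindow_of_zeroLeaf {t K τ r E₁ W₁ E₂ W₂ : ℕ} {s : ℝ} (ht : 1 ≤ t) (hT : TailBound t K τ s)
    (h : halfDiscCover (zeroLeaf t K τ r E₁ W₁ E₂ W₂) = true) {z : ℂ} (hzs : ‖z‖ ≤ s)
    (hz : ‖z‖ * scale ≤ r) (him : 0 ≤ z.im) (h0 : treeDen t z = 0) :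
    InWindow E₁ W₁ z ∨ InWindow E₂ W₂ z := by
  obtain ⟨a, b, k, hl, hsq⟩ := exists_leaf_of_halfDiscCover h (hzs.trans hT.1.le) him
  simp only [zeroLeaf, Bool.or_eq_true] at hl
  rcases hl with ((hl | hl) | hl) | hl
  · exact absurd (hsq.lt_of_isOutside hl) (not_lt.mpr hz)
  · exact Or.inl (hsq.inWindow hl)
  · exact Or.inr (hsq.inWindow hl)
  · refine absurd ?_ (ne_zero_of_isNonzero hl (mem_evalTree ht hT hsq.mem hzs).1)
    rw [clearedDen, h0, mul_zero]

lemma norm_le_of_boundLeaf {t K τ r₁ r₂ C : ℕ} {s : ℝ} (ht : 1 ≤ t) (hT : TailBound t K τ s)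
    (h : halfDiscCover (boundLeaf t K τ r₁ r₂ C) = true) {z : ℂ} (hzs : ‖z‖ ≤ s)
    (hz₁ : (r₁ : ℝ) ≤ ‖z‖ * scale) (hz₂ : ‖z‖ * scale ≤ r₂) (him : 0 ≤ z.im) :
    ‖treeNum t z‖ ≤ C * ‖treeDen t z‖ := by
  obtain ⟨a, b, k, hl, hsq⟩ := exists_leaf_of_halfDiscCover h (hzs.trans hT.1.le) him
  simp only [boundLeaf, Bool.or_eq_true] at hl
  rcases hl with (hl | hl) | hl
  · exact absurd (hsq.lt_of_isOutside hl) (not_lt.mpr hz₂)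
  · exact absurd (hsq.lt_of_isInside hl) (not_lt.mpr hz₁)
  · have hm := mem_evalTree ht hT hsq.mem hzs
    have := norm_le_of_ratioLe hl hm.2 hm.1
    rw [clearedDen, clearedNum, norm_mul, norm_mul] at this
    have hp := norm_pos_iff.mpr (brkProd_ne_zero ht K (hzs.trans_lt hT.1))
    refine le_of_mul_le_mul_left ?_ hp
    linarith

lemma convex_inWindow (E W : ℕ) : Convex ℝ {z | InWindow E W z} := by
  have hl : ∀ x : ℝ, ∀ a b u v : ℝ, 0 ≤ a → 0 ≤ b → a + b = 1 →
      |u * scale + bias - x| ≤ W → |v * scale + bias - x| ≤ W →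
      |(a * u + b * v) * scale + bias - x| ≤ W := by
    intro x a b u v ha hb hab hu hv
    have e : (a * u + b * v) * scale + bias - x =
        a * (u * scale + bias - x) + b * (v * scale + bias - x) := by
      linear_combination ((bias : ℝ) - x) * (-hab)
    rw [e]
    refine (abs_add_le _ _).trans ?_
    rw [abs_mul, abs_mul, abs_of_nonneg ha, abs_of_nonneg hb]
    nlinarith
  intro z hz w hw a b ha hb hab
  refine ⟨?_, ?_⟩
  · have := hl E a b _ _ ha hb hab hz.1 hw.1
    simpa using this
  · have := hl bias a b _ _ ha hb hab hz.2 hw.2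
    simpa using this

def windowBall (E W : ℕ) : Ball := ⟨E, bias, Nat.add (Nat.div (Nat.mul W 182) 128) 1⟩

lemma InWindow.mem {E W : ℕ} {z : ℂ} (hz : InWindow E W z) : (windowBall E W).Mem z :=
  mem_of_abs_le hz.1 hz.2

/-- All derivatives over the window lie in one disc with centre `c` and radius less than `‖c‖`. On a
convex set the function minus `c * q` then has Lipschitz constant below `‖c‖`, so the function
cannot take a value twice. -/
lemma injOn_clearedDen {t K τ E W : ℕ} {s : ℝ} (ht : 1 ≤ t) (hT : TailBound t K τ s)
    (h : isNonzero (evalJet t K τ (windowBall E W)).den.2 = true) :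
    Set.InjOn (clearedDen t K) ({z | InWindow E W z} ∩ Metric.closedBall 0 s) := by
  set x := (evalJet t K τ (windowBall E W)).den.2 with hx
  have hconv : Convex ℝ ({z | InWindow E W z} ∩ Metric.closedBall (0 : ℂ) s) :=
    (convex_inWindow E W).inter (convex_closedBall 0 s)
  have hs := scale_pos
  have hlt := lt_norm_ctr_of_isNonzero h
  set c : ℂ := ctr x / scale with hc
  have hsc : (scale : ℂ) ≠ 0 := by
    rw [← Complex.ofReal_natCast]; exact Complex.ofReal_ne_zero.mpr hs.ne'
  intro z hz w hw hzw
  have hd : ∀ q ∈ ({z | InWindow E W z} ∩ Metric.closedBall (0 : ℂ) s),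
      ∃ f', HasDerivAt (clearedDen t K) f' q ∧ ‖f' - c‖ ≤ x.r / scale := by
    intro q hq
    obtain ⟨⟨f', hf', hm⟩, -⟩ := mem_evalJet ht hT (InWindow.mem hq.1) (mem_closedBall_zero_iff.mp hq.2)
    refine ⟨f', hf', ?_⟩
    have e : f' - c = (f' * scale - ctr x) / scale := by rw [hc]; field_simp
    rw [e, norm_div, Complex.norm_natCast]
    exact div_le_div_of_nonneg_right hm hs.le
  choose! f' hf' hfc using hd
  have key := hconv.norm_image_sub_le_of_norm_hasDerivWithin_le
    (f := fun q => clearedDen t K q - c * q) (f' := fun q => f' q - c) (C := x.r / scale)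
    (fun q hq => by
      have := (hf' q hq).sub ((hasDerivAt_id q).const_mul c)
      simp only [mul_one] at this
      exact this.hasDerivWithinAt) hfc hz hw
  simp only [hzw] at key
  rw [sub_sub_sub_cancel_left, ← mul_sub, norm_mul, hc, norm_div, Complex.norm_natCast,
    norm_sub_rev z w] at key
  by_contra hne
  have hpos : 0 < ‖w - z‖ := norm_pos_iff.mpr (sub_ne_zero.mpr (Ne.symm hne))
  have := le_of_mul_le_mul_right key hpos
  rw [div_le_div_iff_of_pos_right hs] at this
  linarith

end Ball

/-! ### Real zeros and their residues -/

lemma treeDen_conj (t : ℕ) (q : ℂ) :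
    treeDen t ((starRingEnd ℂ) q) = (starRingEnd ℂ) (treeDen t q) := by
  simp [treeDen, altSum_conj]

lemma treeNum_conj (t : ℕ) (q : ℂ) :
    treeNum t ((starRingEnd ℂ) q) = (starRingEnd ℂ) (treeNum t q) := by
  simp [treeNum, altSum_conj]

lemma treeDen_ofReal_im (t : ℕ) (x : ℝ) : (treeDen t x).im = 0 := by
  simp [treeDen, altSum_ofReal_im]

lemma treeNum_ofReal_im (t : ℕ) (x : ℝ) : (treeNum t x).im = 0 := by
  simp [treeNum, altSum_ofReal_im]

/-- The real part of `I * f` vanishes along the real axis, and its derivative there is `-f'.im`. -/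
lemma HasDerivAt.im_eq_zero_of_ofReal {f : ℂ → ℂ} {f' : ℂ} {x : ℝ} (h : HasDerivAt f f' x)
    (hf : ∀ y : ℝ, (f y).im = 0) : f'.im = 0 := by
  have h1 := (h.const_mul Complex.I).real_of_complex
  simp only [Complex.mul_re, Complex.I_re, Complex.I_im, zero_mul, one_mul, zero_sub, hf,
    neg_zero] at h1
  have := h1.unique (hasDerivAt_const x (0 : ℝ))
  linarith

lemma clearedDen_ofReal (t K : ℕ) (x : ℝ) : (clearedDen t K x).im = 0 ∧
    (clearedDen t K x).re = (∏ k ∈ Finset.range K, (1 - x ^ brk t k)) * (treeDen t x).re := by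
  have : brkProd t K x = ((∏ k ∈ Finset.range K, (1 - x ^ brk t k) : ℝ) : ℂ) := by
    simp [brkProd]
  rw [clearedDen, this]
  constructor
  · rw [Complex.im_ofReal_mul, treeDen_ofReal_im, mul_zero]
  · rw [Complex.re_ofReal_mul]

lemma clearedNum_ofReal_im (t K : ℕ) (x : ℝ) : (clearedNum t K x).im = 0 := by
  have : brkProd t K x = ((∏ k ∈ Finset.range K, (1 - x ^ brk t k) : ℝ) : ℂ) := by
    simp [brkProd]
  rw [clearedNum, this, Complex.im_ofReal_mul, treeNum_ofReal_im, mul_zero]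

lemma continuousOn_treeDen_re {t : ℕ} (ht : 1 ≤ t) {a b : ℝ} (ha : -1 < a) (hb : b < 1) :
    ContinuousOn (fun x : ℝ => (treeDen t x).re) (Set.Icc a b) := by
  intro x hx
  have : ‖(x : ℂ)‖ < 1 := by
    rw [Complex.norm_real, Real.norm_eq_abs, abs_lt]; constructor <;> linarith [hx.1, hx.2]
  exact (Complex.continuous_re.continuousAt.comp ((differentiableAt_treeDen ht this).continuousAt.comp
    Complex.continuous_ofReal.continuousAt)).continuousWithinAt

/-- A zero of the cleared denominator with nonzero derivative is a simple pole; the residue can be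
read off from the cleared functions. -/
lemma isDenZero_of_cleared {t K : ℕ} (ht : 1 ≤ t) {x : ℝ} (hx : |x| < 1) (h0 : treeDen t x = 0)
    {f' : ℂ} (hf : HasDerivAt (clearedDen t K) f' x) (hf0 : f' ≠ 0) :
    IsDenZero t x (-((clearedNum t K x).re / f'.re)) ∧ f'.im = 0 := by
  have hx' : ‖(x : ℂ)‖ < 1 := by simpa using hx
  have him : f'.im = 0 := hf.im_eq_zero_of_ofReal fun y => (clearedDen_ofReal t K y).1
  have hp := brkProd_ne_zero ht K hx'
  have hd := (differentiableAt_treeDen ht hx').hasDerivAt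
  have hbd : DifferentiableAt ℂ (brkProd t K) x := by
    unfold brkProd; fun_prop
  have hprod := hbd.hasDerivAt.mul hd
  rw [h0, mul_zero, zero_add] at hprod
  have he : f' = brkProd t K x * deriv (treeDen t) x := hf.unique hprod
  have hre : (f'.re : ℂ) = f' := Complex.ext rfl (by simp [him])
  have hre2 : ((clearedNum t K x).re : ℂ) = clearedNum t K x :=
    Complex.ext rfl (by simp [clearedNum_ofReal_im])
  refine ⟨⟨h0, ?_, ?_⟩, him⟩
  · intro h; rw [h, mul_zero] at he; exact hf0 he
  · push_cast
    rw [hre, hre2, neg_neg, he, clearedNum]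
    have hd0 : deriv (treeDen t) x ≠ 0 := fun h => by rw [h, mul_zero] at he; exact hf0 he
    field_simp

namespace Ball

def isPos (x : Ball) : Bool := Nat.blt (Nat.add bias x.r) x.a

def isNeg (x : Ball) : Bool := Nat.blt (Nat.add x.a x.r) bias

lemma Mem.abs_re_le {x : Ball} {z : ℂ} (h : x.Mem z) : |z.re * scale - (x.a - bias)| ≤ x.r := by
  have := (Complex.abs_re_le_norm _).trans h
  rwa [Complex.sub_re, ← Complex.ofReal_natCast, Complex.re_mul_ofReal] at this

lemma re_pos_of_isPos {x : Ball} (hx : isPos x = true) {z : ℂ} (h : x.Mem z) : 0 < z.re := by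
  rw [isPos, Nat.blt_eq] at hx
  have hx' : (bias : ℝ) + x.r < x.a := by exact_mod_cast hx
  have := abs_le.mp h.abs_re_le
  exact pos_of_mul_pos_left (by linarith) scale_pos.le

lemma re_neg_of_isNeg {x : Ball} (hx : isNeg x = true) {z : ℂ} (h : x.Mem z) : z.re < 0 := by
  rw [isNeg, Nat.blt_eq] at hx
  have hx' : (x.a : ℝ) + x.r < bias := by exact_mod_cast hx
  have := abs_le.mp h.abs_re_le
  exact neg_of_mul_neg_left (by linarith) scale_pos.le

def realBall (a w : ℕ) : Ball := ⟨Nat.add bias a, bias, w⟩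

lemma mem_realBall {a w : ℕ} {x : ℝ} (h1 : (a : ℝ) ≤ x * scale) (h2 : x * scale ≤ a + w) :
    (realBall a w).Mem (x : ℂ) := by
  have e : (x : ℂ) * (scale : ℂ) - ctr (realBall a w) = ((x * scale - a : ℝ) : ℂ) := by
    rw [← Complex.ofReal_natCast, ← Complex.ofReal_mul]
    apply Complex.ext
    · rw [Complex.sub_re, Complex.ofReal_re, Complex.ofReal_re]
      change _ - (((bias + a : ℕ) : ℝ) - bias) = _
      push_cast; ring
    · rw [Complex.sub_im, Complex.ofReal_im, Complex.ofReal_im]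
      change _ - ((bias : ℝ) - bias) = _
      ring
  rw [Mem, e, Complex.norm_real, Real.norm_eq_abs, abs_of_nonneg (by linarith)]
  change x * scale - a ≤ w
  linarith

/-- With `v = x` and `d = y` up to the radii: `0 < d` and `l ≤ scale * (v / d) ≤ u`. -/
def quotBetween (x y : Ball) (l u : ℕ) : Bool :=
  decide ((y.r : ℤ) < y.a - bias) && decide (0 < l) &&
    decide ((l : ℤ) * (y.a - bias + y.r) ≤ (x.a - bias - x.r) * scale) &&
    decide (((x.a : ℤ) - bias + x.r) * scale ≤ u * (y.a - bias - y.r))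

lemma quot_of_quotBetween {x y : Ball} {l u : ℕ} (h : quotBetween x y l u = true) {z w : ℂ}
    (hz : x.Mem z) (hw : y.Mem w) :
    0 < w.re ∧ 0 < z.re / w.re ∧ (l : ℝ) ≤ z.re / w.re * scale ∧ z.re / w.re * scale ≤ u := by
  simp only [quotBetween, Bool.and_eq_true, decide_eq_true_eq] at h
  obtain ⟨⟨⟨h1, h2⟩, h3⟩, h4⟩ := h
  have h1' : (y.r : ℝ) < y.a - bias := by exact_mod_cast h1
  have h2' : (0 : ℝ) < l := by exact_mod_cast h2
  have h3' : (l : ℝ) * (y.a - bias + y.r) ≤ (x.a - bias - x.r) * scale := by exact_mod_cast h3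
  have h4' : ((x.a : ℝ) - bias + x.r) * scale ≤ u * (y.a - bias - y.r) := by exact_mod_cast h4
  have hs := scale_pos
  obtain ⟨a1, a2⟩ := abs_le.mp hz.abs_re_le
  obtain ⟨b1, b2⟩ := abs_le.mp hw.abs_re_le
  have hw0 : 0 < w.re := pos_of_mul_pos_left (by linarith) hs.le
  have key1 : (l : ℝ) ≤ z.re / w.re * scale := by
    rw [div_mul_eq_mul_div, le_div_iff₀ hw0]
    refine le_of_mul_le_mul_right ?_ hs
    calc (l : ℝ) * w.re * scale = l * (w.re * scale) := by ring
      _ ≤ l * (y.a - bias + y.r) := by gcongr; linarith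
      _ ≤ (x.a - bias - x.r) * scale := h3'
      _ ≤ z.re * scale * scale := by gcongr; linarith
  refine ⟨hw0, pos_of_mul_pos_left (h2'.trans_le key1) hs.le, key1, ?_⟩
  rw [div_mul_eq_mul_div, div_le_iff₀ hw0]
  refine le_of_mul_le_mul_right ?_ hs
  have hu : (0 : ℝ) ≤ u := Nat.cast_nonneg _
  calc z.re * scale * scale ≤ (x.a - bias + x.r) * scale := by gcongr; linarith
    _ ≤ u * (y.a - bias - y.r) := h4'
    _ ≤ u * (w.re * scale) := by gcongr; linarith
    _ = u * w.re * scale := by ring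

/-- A sign change of the denominator on `[a, a + w] / scale`, from plus to minus if `s` is true,
and bounds `l / scale ≤ R ≤ u / scale` for the residue `-R` there. -/
def pointCheck (t K τ : ℕ) (s : Bool) (a w l u : ℕ) : Bool :=
  (bif s then isPos (evalTree t K τ (realBall a 0)).den else isNeg (evalTree t K τ (realBall a 0)).den) &&
  (bif s then isNeg (evalTree t K τ (realBall (a + w) 0)).den
    else isPos (evalTree t K τ (realBall (a + w) 0)).den) &&
  (bif s then quotBetween (sub (evalJet t K τ (realBall a w)).prod.1 (evalJet t K τ (realBall a w)).num.1)
      (sub zero (evalJet t K τ (realBall a w)).den.2) l u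
    else quotBetween (sub zero (sub (evalJet t K τ (realBall a w)).prod.1
      (evalJet t K τ (realBall a w)).num.1)) (evalJet t K τ (realBall a w)).den.2 l u)

/-- The clearing factor is positive on the real points in question, so the signs of the cleared
denominator at the ends give a sign change of `treeDen`. The jet over the whole interval encloses
the residue wherever the zero lies. -/
lemma exists_isDenZero_of_pointCheck {t K τ a w l u : ℕ} {sg : Bool} {s : ℝ} (ht : 1 ≤ t)
    (hT : TailBound t K τ s) (haw : ((a + w : ℕ) : ℝ) ≤ s * scale)
    (h : pointCheck t K τ sg a w l u = true) :
    ∃ x R : ℝ, IsDenZero t x R ∧ 0 < R ∧ (a : ℝ) ≤ x * scale ∧ x * scale ≤ ((a + w : ℕ) : ℝ) ∧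
      (l : ℝ) ≤ R * scale ∧ R * scale ≤ u := by
  have hs := scale_pos
  have hnorm : ∀ x : ℝ, (0 : ℝ) ≤ x * scale → x * scale ≤ ((a + w : ℕ) : ℝ) →
      0 ≤ x ∧ ‖(x : ℂ)‖ ≤ s := by
    intro x h0 h1
    have hx0 : 0 ≤ x := nonneg_of_mul_nonneg_left h0 hs
    refine ⟨hx0, ?_⟩
    rw [Complex.norm_real, Real.norm_eq_abs, abs_of_nonneg hx0]
    exact le_of_mul_le_mul_right (h1.trans haw) hs
  have hprod : ∀ x : ℝ, 0 ≤ x → ‖(x : ℂ)‖ ≤ s → 0 < ∏ k ∈ Finset.range K, (1 - x ^ brk t k) := by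
    intro x h0 h1
    rw [Complex.norm_real, Real.norm_eq_abs, abs_of_nonneg h0] at h1
    refine Finset.prod_pos fun k _ => ?_
    have := pow_lt_one₀ h0 (h1.trans_lt hT.1) (brk_pos ht k).ne'
    linarith
  have hval : ∀ (n : ℕ), (n : ℝ) ≤ ((a + w : ℕ) : ℝ) →
      (evalTree t K τ (realBall n 0)).den.Mem (clearedDen t K ((n / scale : ℝ) : ℂ)) ∧
      ‖((n / scale : ℝ) : ℂ)‖ ≤ s := by
    intro n hn
    have e : (n / scale : ℝ) * scale = n := div_mul_cancel₀ _ hs.ne'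
    have hb := (hnorm (n / scale) (by rw [e]; positivity) (by rwa [e])).2
    exact ⟨(mem_evalTree ht hT (mem_realBall e.ge (by rw [e]; simp)) hb).1, hb⟩
  have hsign : ∀ n : ℕ, (n : ℝ) ≤ ((a + w : ℕ) : ℝ) →
      (isPos (evalTree t K τ (realBall n 0)).den = true → 0 < (treeDen t ((n / scale : ℝ) : ℂ)).re) ∧
      (isNeg (evalTree t K τ (realBall n 0)).den = true → (treeDen t ((n / scale : ℝ) : ℂ)).re < 0) := by
    intro n hn
    obtain ⟨hm, hb⟩ := hval n hn
    have hp := hprod (n / scale) (by positivity) hb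
    have e := (clearedDen_ofReal t K (n / scale)).2
    constructor
    · intro h'
      have := re_pos_of_isPos h' hm
      rw [e] at this
      exact pos_of_mul_pos_right this hp.le
    · intro h'
      have := re_neg_of_isNeg h' hm
      rw [e] at this
      exact neg_of_mul_neg_right this hp.le
  simp only [pointCheck, Bool.and_eq_true] at h
  obtain ⟨⟨h1, h2⟩, h3⟩ := h
  have hle : (a / scale : ℝ) ≤ ((a + w : ℕ) : ℝ) / scale := by
    refine div_le_div_of_nonneg_right ?_ hs.le
    exact_mod_cast Nat.le_add_right a w
  have hcont : ContinuousOn (fun x : ℝ => (treeDen t x).re)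
      (Set.Icc (a / scale : ℝ) (((a + w : ℕ) : ℝ) / scale)) := by
    refine continuousOn_treeDen_re ht (by have : (0 : ℝ) ≤ a / scale := by positivity
                                          linarith) ?_
    exact lt_of_le_of_lt ((div_le_iff₀ hs).mpr haw) hT.1
  have ha : (a : ℝ) ≤ ((a + w : ℕ) : ℝ) := by exact_mod_cast Nat.le_add_right a w
  obtain ⟨x, hx, hx0⟩ : ∃ x ∈ Set.Icc (a / scale : ℝ) (((a + w : ℕ) : ℝ) / scale),
      (treeDen t x).re = 0 := by
    cases sg
    · exact intermediate_value_Icc hle hcont ⟨((hsign a ha).2 h1).le, ((hsign (a + w) le_rfl).1 h2).le⟩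
    · exact intermediate_value_Icc' hle hcont ⟨((hsign (a + w) le_rfl).2 h2).le, ((hsign a ha).1 h1).le⟩
  have hz : treeDen t x = 0 := Complex.ext hx0 (treeDen_ofReal_im t x)
  have hxa : (a : ℝ) ≤ x * scale := by have := hx.1; rwa [div_le_iff₀ hs] at this
  have hxb : x * scale ≤ ((a + w : ℕ) : ℝ) := by have := hx.2; rwa [le_div_iff₀ hs] at this
  obtain ⟨hx0', hxs⟩ := hnorm x ((Nat.cast_nonneg a).trans hxa) hxb
  obtain ⟨⟨f', hf', hfm⟩, hnum⟩ :=
    mem_evalJet ht hT (mem_realBall hxa (by push_cast at hxb; exact hxb)) hxs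
  have hx1 : |x| < 1 := by
    have := hxs.trans_lt hT.1
    simpa using this
  have fin : f'.re ≠ 0 → IsDenZero t x (-((clearedNum t K x).re / f'.re)) := fun h =>
    (isDenZero_of_cleared ht hx1 hz hf' fun h0 => h (by rw [h0]; rfl)).1
  -- The flag decides whether the numerator or the derivative is negated, so that the division is by
  -- a positive number; both cases represent minus numerator over derivative.
  cases sg
  · obtain ⟨q1, q2, q3, q4⟩ := quot_of_quotBetween h3 (mem_sub mem_zero hnum) hfm
    rw [zero_sub, Complex.neg_re, neg_div] at q2 q3 q4
    exact ⟨x, _, fin q1.ne', q2, hxa, hxb, q3, q4⟩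
  · obtain ⟨q1, q2, q3, q4⟩ := quot_of_quotBetween h3 hnum (mem_sub mem_zero hfm)
    rw [zero_sub, Complex.neg_re, div_neg] at q2 q3 q4
    refine ⟨x, _, fin fun h => ?_, q2, hxa, hxb, q3, q4⟩
    rw [zero_sub, Complex.neg_re, h] at q1; simp at q1

end Ball

/-! ### Certificates for `2 ≤ t ≤ 15` -/

open Ball

/-- Data for the verification of `DenZeros`, in units of `1 / scale`: zeros in `[a, a + w]` and
`[b, b + w]`, windows around them, residues in `[l, u]` and `[l', u']`. -/
structure TreeCert where
  K : ℕ
  K' : ℕ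
  τ : ℕ
  m : ℕ
  m' : ℕ
  r₁ : ℕ
  r₂ : ℕ
  a : ℕ
  b : ℕ
  w : ℕ
  τa : ℕ
  ma : ℕ
  τb : ℕ
  mb : ℕ
  W₁ : ℕ
  W₂ : ℕ
  l : ℕ
  u : ℕ
  l' : ℕ
  u' : ℕ

namespace TreeCert

variable (d : TreeCert)

def zeroCheck (t : ℕ) : Bool :=
  halfDiscCover (zeroLeaf t d.K d.τ d.r₂ (Nat.add bias d.a) d.W₁ (Nat.add bias d.b) d.W₂)

def boundCheck (t : ℕ) : Bool :=
  halfDiscCover (boundLeaf t d.K d.τ d.r₁ d.r₂ (5 * t ^ 4))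

/-- At the real zeros the tails are bounded on discs adapted to them, with radii `ma` and `mb` in
thousandths; the added `20` is the room for Cauchy's estimate. -/
def restCheck (t : ℕ) : Bool :=
  tailCheck t d.K d.τ d.m' d.m && tailCheck t d.K' d.τa d.ma (d.ma + 20) &&
    tailCheck t d.K' d.τb d.mb (d.mb + 20) &&
    pointCheck t d.K' d.τa true d.a d.w d.l d.u && pointCheck t d.K' d.τb false d.b d.w d.l' d.u' &&
    isNonzero (evalJet t d.K d.τ (windowBall (Nat.add bias d.a) d.W₁)).den.2 &&
    isNonzero (evalJet t d.K d.τ (windowBall (Nat.add bias d.b) d.W₂)).den.2 &&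
    decide (d.w ≤ d.W₁) && decide (d.w ≤ d.W₂) && decide (scale < 2 * d.a) &&
    decide (d.a + d.w < d.b) && decide (d.b + d.w < d.r₁) &&
    decide (d.r₂ * 1000 ≤ d.m' * scale) && decide ((d.a + d.w) * 1000 ≤ d.ma * scale) &&
    decide ((d.b + d.w) * 1000 ≤ d.mb * scale)

/-- The covering confines every zero of the upper half disc to the two windows, and injectivity
identifies it with the real zero found there. Conjugation transfers this, and the bound on the
circle, to the lower half. -/
theorem denZeros {t : ℕ} (ht : 1 ≤ t) (h₁ : d.zeroCheck t = true) (h₂ : d.boundCheck t = true)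
    (h₃ : d.restCheck t = true) {r : ℝ} (hr₁ : (d.r₁ : ℝ) ≤ r * scale) (hr₂ : r * scale ≤ d.r₂) :
    ∃ α β R R₂ : ℝ, DenZeros t r α β R R₂ ∧
      ((d.a : ℝ) ≤ α * scale ∧ α * scale ≤ ((d.a + d.w : ℕ) : ℝ)) ∧
      ((d.b : ℝ) ≤ β * scale ∧ β * scale ≤ ((d.b + d.w : ℕ) : ℝ)) ∧
      ((d.l : ℝ) ≤ R * scale ∧ R * scale ≤ d.u) ∧ ((d.l' : ℝ) ≤ R₂ * scale ∧ R₂ * scale ≤ d.u') := by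
  simp only [restCheck, Bool.and_eq_true, decide_eq_true_eq] at h₃
  obtain ⟨⟨⟨⟨⟨⟨⟨⟨⟨⟨⟨⟨⟨⟨c1, c2⟩, c3⟩, c4⟩, c5⟩, c6⟩, c7⟩, c8⟩, c9⟩, c10⟩, c11⟩, c12⟩, c13⟩, c14⟩, c15⟩ := h₃
  have hs := scale_pos
  have hT := tailBound_of_check ht c1
  have hTa := tailBound_of_check ht c2
  have hTb := tailBound_of_check ht c3
  have conv : ∀ x m : ℕ, x * 1000 ≤ m * scale → (x : ℝ) ≤ (m : ℝ) / 1000 * scale := by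
    intro x m h
    rw [div_mul_eq_mul_div, le_div_iff₀ (by norm_num)]
    exact_mod_cast h
  obtain ⟨α, R, hα, hR, α1, α2, R1, R2⟩ := exists_isDenZero_of_pointCheck ht hTa (conv _ _ c14) c4
  obtain ⟨β, R₂, hβ, hR₂, β1, β2, R3, R4⟩ := exists_isDenZero_of_pointCheck ht hTb (conv _ _ c15) c5
  have hr2 : r ≤ (d.m' : ℝ) / 1000 := le_of_mul_le_mul_right (hr₂.trans (conv _ _ c13)) hs
  have e10 : (scale : ℝ) < 2 * d.a := by exact_mod_cast c10
  have e11 : ((d.a + d.w : ℕ) : ℝ) < d.b := by exact_mod_cast c11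
  have e12 : ((d.b + d.w : ℕ) : ℝ) < d.r₁ := by exact_mod_cast c12
  have hα12 : 1 / 2 < α := lt_of_mul_lt_mul_right (by linarith) hs.le
  have hαβ : α < β := lt_of_mul_lt_mul_right (by linarith) hs.le
  have hβr : β < r := lt_of_mul_lt_mul_right (by linarith) hs.le
  have hwin : ∀ (c W : ℕ) (x : ℝ), d.w ≤ W → (c : ℝ) ≤ x * scale →
      x * scale ≤ ((c + d.w : ℕ) : ℝ) → InWindow (Nat.add bias c) W (x : ℂ) := by
    intro c W x hW h1 h2
    have hW' : (d.w : ℝ) ≤ W := by exact_mod_cast hW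
    have e : ((Nat.add bias c : ℕ) : ℝ) = bias + c := Nat.cast_add _ _
    push_cast at h2
    refine ⟨?_, ?_⟩
    · rw [Complex.ofReal_re, e, abs_le]; constructor <;> linarith
    · rw [Complex.ofReal_im]; simp
  have hmem : ∀ x : ℝ, 0 ≤ x → x ≤ r → (x : ℂ) ∈ Metric.closedBall (0 : ℂ) ((d.m' : ℝ) / 1000) := by
    intro x h0 h1
    rw [mem_closedBall_zero_iff, Complex.norm_real, Real.norm_eq_abs, abs_of_nonneg h0]
    exact h1.trans hr2
  have upper : ∀ q : ℂ, ‖q‖ ≤ r → 0 ≤ q.im → treeDen t q = 0 → q = α ∨ q = β := by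
    intro q hq him h0
    have hqs := hq.trans hr2
    rcases inWindow_of_zeroLeaf ht hT h₁ hqs
      ((mul_le_mul_of_nonneg_right hq hs.le).trans hr₂) him h0 with hw | hw
    · left
      refine injOn_clearedDen ht hT c6 ⟨hw, mem_closedBall_zero_iff.mpr hqs⟩
        ⟨hwin _ _ _ c8 α1 α2, hmem α (by linarith) (by linarith)⟩ ?_
      rw [clearedDen, clearedDen, h0, hα.zero, mul_zero, mul_zero]
    · right
      refine injOn_clearedDen ht hT c7 ⟨hw, mem_closedBall_zero_iff.mpr hqs⟩
        ⟨hwin _ _ _ c9 β1 β2, hmem β (by linarith) (by linarith)⟩ ?_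
      rw [clearedDen, clearedDen, h0, hβ.zero, mul_zero, mul_zero]
  refine ⟨α, β, R, R₂, ⟨hα12, hαβ, hβr, hr2.trans_lt hT.1, hR, hR₂, hα, hβ, ?_, ?_⟩, ⟨α1, α2⟩,
    ⟨β1, β2⟩, ⟨R1, R2⟩, R3, R4⟩
  · intro q hq h0
    rcases le_total 0 q.im with him | him
    · exact upper q hq him h0
    · have := upper ((starRingEnd ℂ) q) (by rwa [Complex.norm_conj]) (by simpa using him)
        (by rw [treeDen_conj, h0, map_zero])
      refine this.imp (fun h => ?_) fun h => ?_ <;>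
      · have h' := congrArg (starRingEnd ℂ) h
        simpa using h'
  · intro q hq
    have key : ∀ z : ℂ, ‖z‖ = r → 0 ≤ z.im → ‖treeNum t z‖ ≤ 5 * (t : ℝ) ^ 4 * ‖treeDen t z‖ := by
      intro z hz him
      have := norm_le_of_boundLeaf ht hT h₂ (hz.trans_le hr2) (by rwa [hz]) (by rwa [hz]) him
      push_cast at this
      exact this
    rcases le_total 0 q.im with him | him
    · exact key q hq him
    · have := key ((starRingEnd ℂ) q) (by rwa [Complex.norm_conj]) (by simpa using him)
      rwa [treeNum_conj, treeDen_conj, Complex.norm_conj, Complex.norm_conj] at this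

end TreeCert

/-- The entries are approximate data, and the checks below do not presuppose their correctness. In
all certificates the zeros are enclosed with width `10 ^ (-22)` and the residues with width `2 * 10
^ (-18)`. -/
def treeCert2 : TreeCert where
  K := 6
  K' := 6
  τ := 6844367734591635880710948862
  m := 929
  m' := 891
  r₁ := 890471950133570792520035618878
  r₂ := 890471950133570792520035618879
  a := 557367872013993200831441748085
  b := 781525283289419096876329103500
  w := 100000000
  τa := 88
  ma := 558
  τb := 101446257788413123063
  mb := 782
  W₁ := 20000000000000000000000000000
  W₂ := 3000000000000000000000000000
  l := 141853202085409336071577390627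
  u := 141853202085409338071577390627
  l' := 61241041031212696452821884487
  u' := 61241041031212698452821884487

set_option maxRecDepth 100000 in
lemma treeCert2_zero : treeCert2.zeroCheck 2 = true := by decide +kernel

set_option maxRecDepth 100000 in
lemma treeCert2_bound : treeCert2.boundCheck 2 = true := by decide +kernel

set_option maxRecDepth 100000 in
lemma treeCert2_rest : treeCert2.restCheck 2 = true := by decide +kernel

def treeCert3 : TreeCert where
  K := 5
  K' := 5
  τ := 34696700515034059333695
  m := 942
  m' := 911
  r₁ := 910746812386156648451730418943
  r₂ := 910746812386156648451730418944
  a := 520640116625725044834313492585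
  b := 825437079708305334563421700370
  w := 100000000
  τa := 1
  ma := 521
  τb := 548156
  mb := 826
  W₁ := 30000000000000000000000000000
  W₂ := 13000000000000000000000000000
  l := 133868135360513770020211909805
  u := 133868135360513772020211909805
  l' := 50407257100117512340921157031
  u' := 50407257100117514340921157031

set_option maxRecDepth 100000 in
lemma treeCert3_zero : treeCert3.zeroCheck 3 = true := by decide +kernel

set_option maxRecDepth 100000 in
lemma treeCert3_bound : treeCert3.boundCheck 3 = true := by decide +kernel

set_option maxRecDepth 100000 in
lemma treeCert3_rest : treeCert3.restCheck 3 = true := by decide +kernel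

def treeCert4 : TreeCert where
  K := 4
  K' := 4
  τ := 2923461038204221610005076
  m := 950
  m' := 924
  r₁ := 923361034164358264081255771006
  r₂ := 923361034164358264081255771007
  a := 509003053139163117234230849412
  b := 858252424587984589295511948028
  w := 100000000
  τa := 1
  ma := 510
  τb := 11920587480812
  mb := 859
  W₁ := 30000000000000000000000000000
  W₂ := 10000000000000000000000000000
  l := 130524327010950257620497762250
  u := 130524327010950259620497762250
  l' := 42399693097002510987793235035
  u' := 42399693097002512987793235035

set_option maxRecDepth 100000 in
lemma treeCert4_zero : treeCert4.zeroCheck 4 = true := by decide +kernel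

set_option maxRecDepth 100000 in
lemma treeCert4_bound : treeCert4.boundCheck 4 = true := by decide +kernel

set_option maxRecDepth 100000 in
lemma treeCert4_rest : treeCert4.restCheck 4 = true := by decide +kernel

def treeCert5 : TreeCert where
  K := 4
  K' := 4
  τ := 48626
  m := 923
  m' := 882
  -- From `t = 5` on the radius involves `Real.log 2`, so `r₁` and `r₂` are about `2 * 10 ^ (-9)`
  -- apart; for smaller `t` they are consecutive integers.
  r₁ := 881542269150355507373779326251
  r₂ := 881542271150355507373779326251
  a := 504211683529361728630350300057
  b := 881476883993898303697164915163
  w := 100000000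
  τa := 1
  ma := 505
  τb := 1
  mb := 882
  W₁ := 30000000000000000000000000000
  W₂ := 8000000000000000000000000000
  l := 128467864721277744560646904514
  u := 128467864721277746560646904514
  l' := 36331823865163542482201090480
  u' := 36331823865163544482201090480

set_option maxRecDepth 100000 in
lemma treeCert5_zero : treeCert5.zeroCheck 5 = true := by decide +kernel

set_option maxRecDepth 100000 in
lemma treeCert5_bound : treeCert5.boundCheck 5 = true := by decide +kernel

set_option maxRecDepth 100000 in
lemma treeCert5_rest : treeCert5.restCheck 5 = true := by decide +kernel

def treeCert6 : TreeCert where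
  K := 3
  K' := 4
  τ := 1790169501637700708707659
  m := 934
  m' := 899
  r₁ := 898819489480331279920764460006
  r₂ := 898819491480331279920764460006
  a := 502033946424572245336382099240
  b := 898456573051115774188228821993
  w := 100000000
  τa := 1
  ma := 503
  τb := 1
  mb := 899
  W₁ := 30000000000000000000000000000
  W₂ := 6000000000000000000000000000
  l := 127129995255839954418645304439
  u := 127129995255839956418645304439
  l' := 31688553975366321750449167688
  u' := 31688553975366323750449167688

set_option maxRecDepth 100000 in
lemma treeCert6_zero : treeCert6.zeroCheck 6 = true := by decide +kernel

set_option maxRecDepth 100000 in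
lemma treeCert6_bound : treeCert6.boundCheck 6 = true := by decide +kernel

set_option maxRecDepth 100000 in
lemma treeCert6_rest : treeCert6.restCheck 6 = true := by decide +kernel

def treeCert7 : TreeCert where
  K := 3
  K' := 4
  τ := 4172161557513188015939
  m := 942
  m' := 912
  r₁ := 911701127355702916642986941342
  r₂ := 911701129355702916642986941342
  a := 500998211950727225421888436112
  b := 911307809827314806955249374205
  w := 100000000
  τa := 1
  ma := 501
  τb := 1
  mb := 912
  W₁ := 30000000000000000000000000000
  W₂ := 5000000000000000000000000000
  l := 126277686039992198048060127092
  u := 126277686039992200048060127092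
  l' := 28076002752470394750067738877
  u' := 28076002752470396750067738877

set_option maxRecDepth 100000 in
lemma treeCert7_zero : treeCert7.zeroCheck 7 = true := by decide +kernel

set_option maxRecDepth 100000 in
lemma treeCert7_bound : treeCert7.boundCheck 7 = true := by decide +kernel

set_option maxRecDepth 100000 in
lemma treeCert7_rest : treeCert7.restCheck 7 = true := by decide +kernel

def treeCert8 : TreeCert where
  K := 3
  K' := 4
  τ := 5578170190872560644
  m := 949
  m' := 922
  r₁ := 921674509747505979015222450147
  r₂ := 921674511747505979015222450147
  a := 500494101634399706854181531961
  b := 921328460981064577795900864201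
  w := 100000000
  τa := 1
  ma := 501
  τb := 1
  mb := 922
  W₁ := 30000000000000000000000000000
  W₂ := 5000000000000000000000000000
  l := 125750398765899330659188994079
  u := 125750398765899332659188994079
  l' := 25205689048417748078676987886
  u' := 25205689048417750078676987886

set_option maxRecDepth 100000 in
lemma treeCert8_zero : treeCert8.zeroCheck 8 = true := by decide +kernel

set_option maxRecDepth 100000 in
lemma treeCert8_bound : treeCert8.boundCheck 8 = true := by decide +kernel

set_option maxRecDepth 100000 in
lemma treeCert8_rest : treeCert8.restCheck 8 = true := by decide +kernel

def treeCert9 : TreeCert where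
  K := 3
  K' := 4
  τ := 2121178763022522
  m := 954
  m' := 930
  r₁ := 929624257340944277272159177314
  r₂ := 929624259340944277272159177314
  a := 500245704703079536629910193675
  b := 929339969415273695577924307095
  w := 100000000
  τa := 1
  ma := 501
  τb := 1
  mb := 930
  W₁ := 30000000000000000000000000000
  W₂ := 4000000000000000000000000000
  l := 125432805884368218255486811308
  u := 125432805884368220255486811308
  l' := 22875947283150235932813596274
  u' := 22875947283150237932813596274

set_option maxRecDepth 100000 in
lemma treeCert9_zero : treeCert9.zeroCheck 9 = true := by decide +kernel

set_option maxRecDepth 100000 in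
lemma treeCert9_bound : treeCert9.boundCheck 9 = true := by decide +kernel

set_option maxRecDepth 100000 in
lemma treeCert9_rest : treeCert9.restCheck 9 = true := by decide +kernel

def treeCert10 : TreeCert where
  K := 3
  K' := 4
  τ := 861333107043
  m := 959
  m' := 937
  r₁ := 936109367090864596725624266360
  r₂ := 936109369090864596725624266360
  a := 500122489623488477266995305586
  b := 935881441965383202399267637846
  w := 100000000
  τa := 1
  ma := 501
  τb := 1
  mb := 936
  W₁ := 30000000000000000000000000000
  W₂ := 4000000000000000000000000000
  l := 125245829500563506291784341812
  u := 125245829500563508291784341812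
  l' := 20947592564418943645779177624
  u' := 20947592564418945645779177624

set_option maxRecDepth 100000 in
lemma treeCert10_zero : treeCert10.zeroCheck 10 = true := by decide +kernel

set_option maxRecDepth 100000 in
lemma treeCert10_bound : treeCert10.boundCheck 10 = true := by decide +kernel

set_option maxRecDepth 100000 in
lemma treeCert10_rest : treeCert10.restCheck 10 = true := by decide +kernel

def treeCert11 : TreeCert where
  K := 3
  K' := 4
  τ := 35026499
  m := 962
  m' := 942
  r₁ := 941500364733812254120586686762
  r₂ := 941500366733812254120586686762
  a := 500061147213297622762787370176
  b := 941318654885461956796023519204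
  w := 100000000
  τa := 1
  ma := 501
  τb := 1
  mb := 942
  W₁ := 30000000000000000000000000000
  W₂ := 3000000000000000000000000000
  l := 125137834022261789093792529598
  u := 125137834022261791093792529598
  l' := 19323973668761836577772444348
  u' := 19323973668761838577772444348

set_option maxRecDepth 100000 in
lemma treeCert11_zero : treeCert11.zeroCheck 11 = true := by decide +kernel

set_option maxRecDepth 100000 in
lemma treeCert11_bound : treeCert11.boundCheck 11 = true := by decide +kernel

set_option maxRecDepth 100000 in
lemma treeCert11_rest : treeCert11.restCheck 11 = true := by decide +kernel

def treeCert12 : TreeCert where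
  K := 3
  K' := 4
  τ := 1138
  m := 965
  m' := 947
  r₁ := 946052541359523392607586939417
  r₂ := 946052543359523392607586939417
  a := 500030547422923707404001425381
  b := 945907194310503209177724877401
  w := 100000000
  τa := 1
  ma := 501
  τb := 1
  mb := 946
  W₁ := 30000000000000000000000000000
  W₂ := 3000000000000000000000000000
  l := 125076442807504986350797490143
  u := 125076442807504988350797490143
  l' := 17936894467515711093529964781
  u' := 17936894467515713093529964781

set_option maxRecDepth 100000 in
lemma treeCert12_zero : treeCert12.zeroCheck 12 = true := by decide +kernel

set_option maxRecDepth 100000 in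
lemma treeCert12_bound : treeCert12.boundCheck 12 = true := by decide +kernel

set_option maxRecDepth 100000 in
lemma treeCert12_rest : treeCert12.restCheck 12 = true := by decide +kernel

def treeCert13 : TreeCert where
  K := 3
  K' := 4
  τ := 1
  m := 967
  m' := 950
  r₁ := 949947510461023201425963710574
  r₂ := 949947512461023201425963710574
  a := 500015266711306718739766553689
  b := 949830353110272229117961770033
  w := 100000000
  τa := 1
  ma := 501
  τb := 1
  mb := 950
  W₁ := 30000000000000000000000000000
  W₂ := 3000000000000000000000000000
  l := 125042005025453899068941995886
  u := 125042005025453901068941995886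
  l' := 16737225359201191337466569618
  u' := 16737225359201193337466569618

set_option maxRecDepth 100000 in
lemma treeCert13_zero : treeCert13.zeroCheck 13 = true := by decide +kernel

set_option maxRecDepth 100000 in
lemma treeCert13_bound : treeCert13.boundCheck 13 = true := by decide +kernel

set_option maxRecDepth 100000 in
lemma treeCert13_rest : treeCert13.restCheck 13 = true := by decide +kernel

def treeCert14 : TreeCert where
  K := 3
  K' := 4
  τ := 1
  m := 970
  m' := 954
  r₁ := 953317994206652157333724859701
  r₂ := 953317996206652157333724859701
  a := 500007631490849434731964718187
  b := 953222644689660255356984944955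
  w := 100000000
  τa := 1
  ma := 501
  τb := 1
  mb := 954
  W₁ := 30000000000000000000000000000
  W₂ := 2000000000000000000000000000
  l := 125022900676630851452874657574
  u := 125022900676630853452874657574
  l' := 15688769144485842895450972775
  u' := 15688769144485844895450972775

set_option maxRecDepth 100000 in
lemma treeCert14_zero : treeCert14.zeroCheck 14 = true := by decide +kernel

set_option maxRecDepth 100000 in
lemma treeCert14_bound : treeCert14.boundCheck 14 = true := by decide +kernel

set_option maxRecDepth 100000 in
lemma treeCert14_rest : treeCert14.restCheck 14 = true := by decide +kernel

def treeCert15 : TreeCert where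
  K := 3
  K' := 4
  τ := 1
  m := 972
  m' := 957
  r₁ := 956263235924122739611784970597
  r₂ := 956263237924122739611784970597
  a := 500003815250355894682477662971
  b := 956184833293566234467834834530
  w := 100000000
  τa := 1
  ma := 501
  τb := 1
  mb := 957
  W₁ := 30000000000000000000000000000
  W₂ := 2000000000000000000000000000
  l := 125012401332463427723606258472
  u := 125012401332463429723606258472
  l' := 14764262493643187227486900535
  u' := 14764262493643189227486900535

set_option maxRecDepth 100000 in
lemma treeCert15_zero : treeCert15.zeroCheck 15 = true := by decide +kernel

set_option maxRecDepth 100000 in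
lemma treeCert15_bound : treeCert15.boundCheck 15 = true := by decide +kernel

set_option maxRecDepth 100000 in
lemma treeCert15_rest : treeCert15.restCheck 15 = true := by decide +kernel

/-! ### Comparison of the certificates with the stated constants -/

lemma rThree_eq {t : ℕ} (ht : 5 ≤ t) :
    rThree t = 1 + Real.log 2 / t - (Real.log 2 - Real.log 2 ^ 2) / (2 * (t : ℝ) ^ 2) := by
  unfold rThree
  split
  · omega
  · omega
  · omega
  · rfl

/-- The numerical part of the theorem. -/
structure TreeNumerics (t : ℕ) (ρ ρ₂ R R₂ : ℝ) : Prop where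
  rho : 3 ≤ t → |ρ - (2 - 1 / 2 ^ (t + 1) - ((t : ℝ) + 3) / 2 ^ (2 * t + 3)
    - (3 * (t : ℝ) ^ 2 + 19 * t + 24) / 2 ^ (3 * t + 6))| ≤ 0.28 * (t : ℝ) ^ 3 / 2 ^ (4 * t)
  rho_two : t = 2 → |ρ - 1.794147187541686| ≤ 1 / 10 ^ 15
  res : 6 ≤ t → |R - (1 / 8 + ((t : ℝ) - 2) / 2 ^ (t + 5)
    + (2 * (t : ℝ) ^ 2 + 3 * t - 5) / 2 ^ (2 * t + 7)
    + (9 * (t : ℝ) ^ 3 + 45 * (t : ℝ) ^ 2 + 20 * t - 68) / 2 ^ (3 * t + 10))|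
      ≤ (t : ℝ) ^ 4 / (50 * 2 ^ (4 * t))
  res_small : t ≤ 5 → |R - resTable t| ≤ 1 / 10 ^ 16
  rho₂ : 16 ≤ t → |ρ₂ - (1 + Real.log 2 / t - (Real.log 2 - Real.log 2 ^ 2) / (2 * (t : ℝ) ^ 2)
    + (4 * Real.log 2 ^ 3 + 3 * Real.log 2 ^ 2 + 6 * Real.log 2) / (24 * (t : ℝ) ^ 3)
    + (2 * Real.log 2 ^ 4 + 54 * Real.log 2 ^ 3 - 27 * Real.log 2 ^ 2 - 6 * Real.log 2)
        / (48 * (t : ℝ) ^ 4))| ≤ 0.26 / (t : ℝ) ^ 5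
  rho₂_small : t ≤ 15 → |ρ₂ - rhoTwoTable t| ≤ 1 / 10 ^ 15
  res₂ : |R₂ - (1 / (4 * (t : ℝ)) - (4 * Real.log 2 + 1) / (8 * (t : ℝ) ^ 2))| ≤ 0.77 / (t : ℝ) ^ 3

/-- The numerical part of the theorem in terms of the data of a certificate. -/
structure TreeCert.Numerics (t : ℕ) (d : TreeCert) : Prop where
  r : (d.r₁ : ℝ) * rThree t ≤ Ball.scale ∧ Ball.scale ≤ d.r₂ * rThree t
  rho : 3 ≤ t →
    ((2 - 1 / 2 ^ (t + 1) - ((t : ℝ) + 3) / 2 ^ (2 * t + 3)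
      - (3 * (t : ℝ) ^ 2 + 19 * t + 24) / 2 ^ (3 * t + 6)) - 0.28 * (t : ℝ) ^ 3 / 2 ^ (4 * t)) *
        (d.a + d.w) ≤ Ball.scale ∧
    Ball.scale ≤ ((2 - 1 / 2 ^ (t + 1) - ((t : ℝ) + 3) / 2 ^ (2 * t + 3)
      - (3 * (t : ℝ) ^ 2 + 19 * t + 24) / 2 ^ (3 * t + 6)) + 0.28 * (t : ℝ) ^ 3 / 2 ^ (4 * t)) * d.a
  rho_two : t = 2 → ((1.794147187541686 : ℝ) - 1 / 10 ^ 15) * (d.a + d.w) ≤ Ball.scale ∧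
    Ball.scale ≤ ((1.794147187541686 : ℝ) + 1 / 10 ^ 15) * d.a
  res : 6 ≤ t →
    ((1 / 8 + ((t : ℝ) - 2) / 2 ^ (t + 5) + (2 * (t : ℝ) ^ 2 + 3 * t - 5) / 2 ^ (2 * t + 7)
      + (9 * (t : ℝ) ^ 3 + 45 * (t : ℝ) ^ 2 + 20 * t - 68) / 2 ^ (3 * t + 10))
      - (t : ℝ) ^ 4 / (50 * 2 ^ (4 * t))) * Ball.scale ≤ d.l ∧
    d.u ≤ ((1 / 8 + ((t : ℝ) - 2) / 2 ^ (t + 5) + (2 * (t : ℝ) ^ 2 + 3 * t - 5) / 2 ^ (2 * t + 7)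
      + (9 * (t : ℝ) ^ 3 + 45 * (t : ℝ) ^ 2 + 20 * t - 68) / 2 ^ (3 * t + 10))
      + (t : ℝ) ^ 4 / (50 * 2 ^ (4 * t))) * Ball.scale
  res_small : t ≤ 5 → (resTable t - 1 / 10 ^ 16) * Ball.scale ≤ d.l ∧
    d.u ≤ (resTable t + 1 / 10 ^ 16) * Ball.scale
  rho₂_small : (rhoTwoTable t - 1 / 10 ^ 15) * (d.b + d.w) ≤ Ball.scale ∧
    Ball.scale ≤ (rhoTwoTable t + 1 / 10 ^ 15) * d.b
  res₂ : ((1 / (4 * (t : ℝ)) - (4 * Real.log 2 + 1) / (8 * (t : ℝ) ^ 2)) - 0.77 / (t : ℝ) ^ 3) *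
      Ball.scale ≤ d.l' ∧
    d.u' ≤ ((1 / (4 * (t : ℝ)) - (4 * Real.log 2 + 1) / (8 * (t : ℝ) ^ 2)) + 0.77 / (t : ℝ) ^ 3) *
      Ball.scale

lemma abs_inv_sub_le {x s a a' c e : ℝ} (hs : 0 < s) (ha : 0 < a) (h1 : a ≤ x * s)
    (h2 : x * s ≤ a') (h : (c - e) * a' ≤ s ∧ s ≤ (c + e) * a) : |1 / x - c| ≤ e := by
  have hx : 0 < x := pos_of_mul_pos_left (ha.trans_le h1) hs.le
  have ha' : 0 < a' := ha.trans_le (h1.trans h2)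
  have e1 : s / a' ≤ 1 / x := by rw [div_le_div_iff₀ ha' hx]; linarith
  have e2 : 1 / x ≤ s / a := by rw [div_le_div_iff₀ hx ha]; linarith
  have e3 : c - e ≤ s / a' := by rw [le_div_iff₀ ha']; exact h.1
  have e4 : s / a ≤ c + e := by rw [div_le_iff₀ ha]; exact h.2
  rw [abs_le]; constructor <;> linarith

lemma abs_sub_le_of_scaled {x s l u c e : ℝ} (hs : 0 < s) (h1 : l ≤ x * s) (h2 : x * s ≤ u)
    (h : (c - e) * s ≤ l ∧ u ≤ (c + e) * s) : |x - c| ≤ e := by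
  have e1 : c - e ≤ x := le_of_mul_le_mul_right (h.1.trans h1) hs
  have e2 : x ≤ c + e := le_of_mul_le_mul_right (h2.trans h.2) hs
  rw [abs_le]; constructor <;> linarith

theorem TreeCert.exists_denZeros {t : ℕ} (ht : 1 ≤ t) (ht' : t ≤ 15) (d : TreeCert)
    (h₁ : d.zeroCheck t = true) (h₂ : d.boundCheck t = true) (h₃ : d.restCheck t = true)
    (h : d.Numerics t) :
    ∃ α β R R₂ : ℝ, DenZeros t (1 / rThree t) α β R R₂ ∧ TreeNumerics t (1 / α) (1 / β) R R₂ := by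
  have hs := Ball.scale_pos
  have hr : 0 < rThree t := by
    by_contra hn
    have := mul_nonpos_of_nonneg_of_nonpos (Nat.cast_nonneg (α := ℝ) d.r₂) (not_lt.mp hn)
    linarith [h.r.2]
  have hr1 : (d.r₁ : ℝ) ≤ 1 / rThree t * Ball.scale := by
    rw [div_mul_eq_mul_div, one_mul, le_div_iff₀ hr]; exact h.r.1
  have hr2 : 1 / rThree t * Ball.scale ≤ (d.r₂ : ℝ) := by
    rw [div_mul_eq_mul_div, one_mul, div_le_iff₀ hr]; exact h.r.2
  obtain ⟨α, β, R, R₂, hz, ⟨α1, α2⟩, ⟨β1, β2⟩, ⟨R1, R2⟩, R3, R4⟩ := d.denZeros ht h₁ h₂ h₃ hr1 hr2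
  push_cast at α2 β2
  have ha : (0 : ℝ) < d.a := by
    have := hz.half_lt
    have hn : (d.a : ℝ) ≠ 0 := by
      intro h0
      simp only [restCheck, Bool.and_eq_true, decide_eq_true_eq] at h₃
      have := h₃.1.1.1.1.1.2
      have h0' : d.a = 0 := by exact_mod_cast h0
      omega
    positivity
  have hb : (0 : ℝ) < d.b := by
    simp only [restCheck, Bool.and_eq_true, decide_eq_true_eq] at h₃
    have := h₃.1.1.1.1.2
    have h0' : 0 < d.b := by omega
    exact_mod_cast h0'
  exact ⟨α, β, R, R₂, hz, ⟨fun h3 => abs_inv_sub_le hs ha α1 α2 (h.rho h3),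
    fun h3 => abs_inv_sub_le hs ha α1 α2 (h.rho_two h3),
    fun h3 => abs_sub_le_of_scaled hs R1 R2 (h.res h3),
    fun h3 => abs_sub_le_of_scaled hs R1 R2 (h.res_small h3), fun h3 => absurd h3 (by omega),
    fun _ => abs_inv_sub_le hs hb β1 β2 h.rho₂_small, abs_sub_le_of_scaled hs R3 R4 h.res₂⟩⟩

lemma log_two_bounds : 0.6931471803 < Real.log 2 ∧ Real.log 2 < 0.6931471808 :=
  ⟨Real.log_two_gt_d9, Real.log_two_lt_d9⟩

lemma treeCert2_numerics : treeCert2.Numerics 2 := by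
  obtain ⟨h1, h2⟩ := log_two_bounds
  have h3 := mul_pos (sub_pos.mpr h1) (sub_pos.mpr h2)
  have h4 := sq_nonneg (Real.log 2 - 0.6931471803)
  constructor <;>
    (simp only [treeCert2, Ball.scale, rhoTwoTable, resTable, rThree]; norm_num <;>
      constructor <;> linarith)

lemma treeCert3_numerics : treeCert3.Numerics 3 := by
  obtain ⟨h1, h2⟩ := log_two_bounds
  have h3 := mul_pos (sub_pos.mpr h1) (sub_pos.mpr h2)
  have h4 := sq_nonneg (Real.log 2 - 0.6931471803)
  constructor <;>
    (simp only [treeCert3, Ball.scale, rhoTwoTable, resTable, rThree]; norm_num <;>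
      constructor <;> linarith)

lemma treeCert4_numerics : treeCert4.Numerics 4 := by
  obtain ⟨h1, h2⟩ := log_two_bounds
  have h3 := mul_pos (sub_pos.mpr h1) (sub_pos.mpr h2)
  have h4 := sq_nonneg (Real.log 2 - 0.6931471803)
  constructor <;>
    (simp only [treeCert4, Ball.scale, rhoTwoTable, resTable, rThree]; norm_num <;>
      constructor <;> linarith)

lemma treeCert5_numerics : treeCert5.Numerics 5 := by
  obtain ⟨h1, h2⟩ := log_two_bounds
  -- Secant above and tangent below: these two facts bound `Real.log 2 ^ 2`, which enters through
  -- `rThree`, by linear expressions in `Real.log 2`.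
  have h3 := mul_pos (sub_pos.mpr h1) (sub_pos.mpr h2)
  have h4 := sq_nonneg (Real.log 2 - 0.6931471803)
  constructor <;>
    (simp only [treeCert5, Ball.scale, rhoTwoTable, resTable, rThree]; norm_num <;>
      constructor <;> linarith)

lemma treeCert6_numerics : treeCert6.Numerics 6 := by
  obtain ⟨h1, h2⟩ := log_two_bounds
  have h3 := mul_pos (sub_pos.mpr h1) (sub_pos.mpr h2)
  have h4 := sq_nonneg (Real.log 2 - 0.6931471803)
  constructor <;>
    (simp only [treeCert6, Ball.scale, rhoTwoTable, resTable, rThree]; norm_num <;>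
      constructor <;> linarith)

lemma treeCert7_numerics : treeCert7.Numerics 7 := by
  obtain ⟨h1, h2⟩ := log_two_bounds
  have h3 := mul_pos (sub_pos.mpr h1) (sub_pos.mpr h2)
  have h4 := sq_nonneg (Real.log 2 - 0.6931471803)
  constructor <;>
    (simp only [treeCert7, Ball.scale, rhoTwoTable, resTable, rThree]; norm_num <;>
      constructor <;> linarith)

lemma treeCert8_numerics : treeCert8.Numerics 8 := by
  obtain ⟨h1, h2⟩ := log_two_bounds
  have h3 := mul_pos (sub_pos.mpr h1) (sub_pos.mpr h2)
  have h4 := sq_nonneg (Real.log 2 - 0.6931471803)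
  constructor <;>
    (simp only [treeCert8, Ball.scale, rhoTwoTable, resTable, rThree]; norm_num <;>
      constructor <;> linarith)

lemma treeCert9_numerics : treeCert9.Numerics 9 := by
  obtain ⟨h1, h2⟩ := log_two_bounds
  have h3 := mul_pos (sub_pos.mpr h1) (sub_pos.mpr h2)
  have h4 := sq_nonneg (Real.log 2 - 0.6931471803)
  constructor <;>
    (simp only [treeCert9, Ball.scale, rhoTwoTable, resTable, rThree]; norm_num <;>
      constructor <;> linarith)

lemma treeCert10_numerics : treeCert10.Numerics 10 := by
  obtain ⟨h1, h2⟩ := log_two_bounds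
  have h3 := mul_pos (sub_pos.mpr h1) (sub_pos.mpr h2)
  have h4 := sq_nonneg (Real.log 2 - 0.6931471803)
  constructor <;>
    (simp only [treeCert10, Ball.scale, rhoTwoTable, resTable, rThree]; norm_num <;>
      constructor <;> linarith)

lemma treeCert11_numerics : treeCert11.Numerics 11 := by
  obtain ⟨h1, h2⟩ := log_two_bounds
  have h3 := mul_pos (sub_pos.mpr h1) (sub_pos.mpr h2)
  have h4 := sq_nonneg (Real.log 2 - 0.6931471803)
  constructor <;>
    (simp only [treeCert11, Ball.scale, rhoTwoTable, resTable, rThree]; norm_num <;>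
      constructor <;> linarith)

lemma treeCert12_numerics : treeCert12.Numerics 12 := by
  obtain ⟨h1, h2⟩ := log_two_bounds
  have h3 := mul_pos (sub_pos.mpr h1) (sub_pos.mpr h2)
  have h4 := sq_nonneg (Real.log 2 - 0.6931471803)
  constructor <;>
    (simp only [treeCert12, Ball.scale, rhoTwoTable, resTable, rThree]; norm_num <;>
      constructor <;> linarith)

lemma treeCert13_numerics : treeCert13.Numerics 13 := by
  obtain ⟨h1, h2⟩ := log_two_bounds
  have h3 := mul_pos (sub_pos.mpr h1) (sub_pos.mpr h2)
  have h4 := sq_nonneg (Real.log 2 - 0.6931471803)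
  constructor <;>
    (simp only [treeCert13, Ball.scale, rhoTwoTable, resTable, rThree]; norm_num <;>
      constructor <;> linarith)

lemma treeCert14_numerics : treeCert14.Numerics 14 := by
  obtain ⟨h1, h2⟩ := log_two_bounds
  have h3 := mul_pos (sub_pos.mpr h1) (sub_pos.mpr h2)
  have h4 := sq_nonneg (Real.log 2 - 0.6931471803)
  constructor <;>
    (simp only [treeCert14, Ball.scale, rhoTwoTable, resTable, rThree]; norm_num <;>
      constructor <;> linarith)

lemma treeCert15_numerics : treeCert15.Numerics 15 := by
  obtain ⟨h1, h2⟩ := log_two_bounds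
  have h3 := mul_pos (sub_pos.mpr h1) (sub_pos.mpr h2)
  have h4 := sq_nonneg (Real.log 2 - 0.6931471803)
  constructor <;>
    (simp only [treeCert15, Ball.scale, rhoTwoTable, resTable, rThree]; norm_num <;>
      constructor <;> linarith)

theorem exists_denZeros_of_le {t : ℕ} (ht : 2 ≤ t) (ht' : t ≤ 15) :
    ∃ α β R R₂ : ℝ, DenZeros t (1 / rThree t) α β R R₂ ∧ TreeNumerics t (1 / α) (1 / β) R R₂ := by
  interval_cases t
  · exact treeCert2.exists_denZeros (by norm_num) (by norm_num) treeCert2_zero treeCert2_bound treeCert2_rest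
      treeCert2_numerics
  · exact treeCert3.exists_denZeros (by norm_num) (by norm_num) treeCert3_zero treeCert3_bound treeCert3_rest
      treeCert3_numerics
  · exact treeCert4.exists_denZeros (by norm_num) (by norm_num) treeCert4_zero treeCert4_bound treeCert4_rest
      treeCert4_numerics
  · exact treeCert5.exists_denZeros (by norm_num) (by norm_num) treeCert5_zero treeCert5_bound treeCert5_rest
      treeCert5_numerics
  · exact treeCert6.exists_denZeros (by norm_num) (by norm_num) treeCert6_zero treeCert6_bound treeCert6_rest
      treeCert6_numerics
  · exact treeCert7.exists_denZeros (by norm_num) (by norm_num) treeCert7_zero treeCert7_bound treeCert7_rest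
      treeCert7_numerics
  · exact treeCert8.exists_denZeros (by norm_num) (by norm_num) treeCert8_zero treeCert8_bound treeCert8_rest
      treeCert8_numerics
  · exact treeCert9.exists_denZeros (by norm_num) (by norm_num) treeCert9_zero treeCert9_bound treeCert9_rest
      treeCert9_numerics
  · exact treeCert10.exists_denZeros (by norm_num) (by norm_num) treeCert10_zero treeCert10_bound treeCert10_rest
      treeCert10_numerics
  · exact treeCert11.exists_denZeros (by norm_num) (by norm_num) treeCert11_zero treeCert11_bound treeCert11_rest
      treeCert11_numerics
  · exact treeCert12.exists_denZeros (by norm_num) (by norm_num) treeCert12_zero treeCert12_bound treeCert12_rest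
      treeCert12_numerics
  · exact treeCert13.exists_denZeros (by norm_num) (by norm_num) treeCert13_zero treeCert13_bound treeCert13_rest
      treeCert13_numerics
  · exact treeCert14.exists_denZeros (by norm_num) (by norm_num) treeCert14_zero treeCert14_bound treeCert14_rest
      treeCert14_numerics
  · exact treeCert15.exists_denZeros (by norm_num) (by norm_num) treeCert15_zero treeCert15_bound treeCert15_rest
      treeCert15_numerics

/-! ### Interval evaluation of polynomial expressions -/

/-- Polynomial expressions with nonnegative rational constants. -/
inductive IExpr where
  | var (i : ℕ)
  | rat (n d : ℕ)
  | add (e f : IExpr)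
  | sub (e f : IExpr)
  | mul (e f : IExpr)

namespace IExpr

instance : Add IExpr := ⟨add⟩
instance : Sub IExpr := ⟨sub⟩
instance : Mul IExpr := ⟨mul⟩

noncomputable def eval (v : ℕ → ℝ) : IExpr → ℝ
  | var i => v i
  | rat n d => n / d
  | add e f => eval v e + eval v f
  | sub e f => eval v e - eval v f
  | mul e f => eval v e * eval v f

def evalBall (v : ℕ → Ball) : IExpr → Ball
  | var i => v i
  | rat n d => Ball.realBall (Nat.div (Nat.mul n Ball.scale) d) 1
  | add e f => Ball.add (evalBall v e) (evalBall v f)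
  | sub e f => Ball.sub (evalBall v e) (evalBall v f)
  | mul e f => Ball.mul (evalBall v e) (evalBall v f)

@[simp] lemma eval_var (v : ℕ → ℝ) (i : ℕ) : (var i).eval v = v i := rfl
@[simp] lemma eval_rat (v : ℕ → ℝ) (n d : ℕ) : (rat n d).eval v = n / d := rfl
@[simp] lemma eval_add (v : ℕ → ℝ) (e f : IExpr) : (e + f).eval v = e.eval v + f.eval v := rfl
@[simp] lemma eval_sub (v : ℕ → ℝ) (e f : IExpr) : (e - f).eval v = e.eval v - f.eval v := rfl
@[simp] lemma eval_mul (v : ℕ → ℝ) (e f : IExpr) : (e * f).eval v = e.eval v * f.eval v := rfl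

lemma mem_rat (n d : ℕ) : (Ball.realBall (Nat.div (Nat.mul n Ball.scale) d) 1).Mem
    (((n / d : ℝ) : ℝ) : ℂ) := by
  have e : (n / d : ℝ) * Ball.scale = ((n * Ball.scale : ℕ) : ℝ) / d := by push_cast; ring
  refine Ball.mem_realBall ?_ ?_
  · rw [e]; exact Nat.cast_div_le
  · rw [e]
    rcases Nat.eq_zero_or_pos d with rfl | hd
    · simp only [Nat.cast_zero, div_zero]; positivity
    · have := Ball.lt_div_add_one (n * Ball.scale) d hd
      exact this.trans (le_of_eq (Nat.cast_add _ _))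

lemma mem_evalBall {v : ℕ → ℝ} {b : ℕ → Ball} (h : ∀ i, (b i).Mem (v i)) (e : IExpr) :
    (e.evalBall b).Mem ((e.eval v : ℝ) : ℂ) := by
  induction e with
  | var i => exact h i
  | rat n d => exact mem_rat n d
  | add e f he hf => rw [eval, Complex.ofReal_add]; exact Ball.mem_add he hf
  | sub e f he hf => rw [eval, Complex.ofReal_sub]; exact Ball.mem_sub he hf
  | mul e f he hf => rw [eval, Complex.ofReal_mul]; exact Ball.mem_mul he hf

/-- Interval environment: `var 0` lies in `[a, a + w] / scale`, the other variables in the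
intervals of the list. -/
def env (a w : ℕ) (l : List (ℕ × ℕ)) : ℕ → Ball
  | 0 => Ball.realBall a w
  | i + 1 => Ball.realBall (l.getD i (0, 0)).1 (l.getD i (0, 0)).2

def values (x : ℝ) (l : List ℝ) : ℕ → ℝ
  | 0 => x
  | i + 1 => l.getD i 0

def InBox (x : ℝ) (p : ℕ × ℕ) : Prop := (p.1 : ℝ) ≤ x * Ball.scale ∧ x * Ball.scale ≤ p.1 + p.2

/-- Positivity on `N` intervals of length `h / scale` for the first variable. -/
def posCheck (e : IExpr) (N h : ℕ) (l : List (ℕ × ℕ)) : Bool :=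
  (List.range N).all fun j => Ball.isPos (e.evalBall (env (j * h) h l))

lemma mem_env {a w : ℕ} {x : ℝ} {l : List (ℕ × ℕ)} {y : List ℝ} (hx : InBox x (a, w))
    (hy : List.Forall₂ InBox y l) (i : ℕ) : (env a w l i).Mem (values x y i) := by
  cases i with
  | zero => exact Ball.mem_realBall hx.1 hx.2
  | succ i =>
    simp only [env, values]
    induction hy generalizing i with
    | nil =>
      refine Ball.mem_realBall ?_ ?_ <;> simp
    | cons h _ ih =>
      cases i with
      | zero => exact Ball.mem_realBall h.1 h.2
      | succ i => exact ih i

lemma eval_pos_of_posCheck {e : IExpr} {N h : ℕ} {l : List (ℕ × ℕ)} (hc : e.posCheck N h l = true)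
    {x : ℝ} {y : List ℝ} (hx0 : 0 ≤ x) (hx : x * Ball.scale < N * h) (hy : List.Forall₂ InBox y l) :
    0 < e.eval (values x y) := by
  have hh : (0 : ℝ) < h := by
    by_contra hn
    have h0 : (h : ℝ) = 0 := le_antisymm (not_lt.mp hn) (Nat.cast_nonneg _)
    rw [h0, mul_zero] at hx
    have := mul_nonneg hx0 Ball.scale_pos.le
    linarith
  have hs0 : 0 ≤ x * Ball.scale / h := div_nonneg (mul_nonneg hx0 Ball.scale_pos.le) hh.le
  obtain ⟨j, hj⟩ : ∃ j, j = ⌊x * Ball.scale / h⌋₊ := ⟨_, rfl⟩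
  have h1 : (j : ℝ) ≤ x * Ball.scale / h := hj ▸ Nat.floor_le hs0
  have h2 : x * Ball.scale / h < j + 1 := hj ▸ Nat.lt_floor_add_one _
  rw [le_div_iff₀ hh] at h1
  rw [div_lt_iff₀ hh] at h2
  have hjN : j < N := by
    have : (j : ℝ) < N := lt_of_mul_lt_mul_right (h1.trans_lt hx) hh.le
    exact_mod_cast this
  have hp := List.all_eq_true.mp hc j (List.mem_range.mpr hjN)
  have hm := mem_evalBall (mem_env (w := h) (a := j * h) ⟨by push_cast; exact h1, by push_cast; linarith⟩ hy) e
  simpa using Ball.re_pos_of_isPos hp hm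

end IExpr

lemma inBox_log_two : IExpr.InBox (Real.log 2) (693147180300000000000000000000, 500000000000000000000) := by
  obtain ⟨h1, h2⟩ := log_two_bounds
  constructor <;> norm_num [Ball.scale] <;> linarith

/-! ### The range `t ≥ 16`: clearing two factors -/

/-- Equality holds at `t = 16`. With `z = 1 / t` this turns exponentially small tails into multiples
of `z ^ 4`. -/
lemma pow_four_le_two_pow {t : ℕ} (ht : 16 ≤ t) : t ^ 4 ≤ 2 ^ t := by
  induction t, ht using Nat.le_induction with
  | base => norm_num
  | succ t ht ih =>
    have h : (t + 1) ^ 4 ≤ 2 * t ^ 4 := by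
      have h1 : 16 * (t + 1) ≤ 17 * t := by omega
      have h2 : (16 * (t + 1)) ^ 4 ≤ (17 * t) ^ 4 := Nat.pow_le_pow_left h1 4
      rw [mul_pow, mul_pow] at h2
      norm_num at h2
      omega
    rw [pow_succ 2]
    omega

lemma brk_one (t : ℕ) : brk t 1 = t + 1 := by simp [brk]

lemma brk_two (t : ℕ) : brk t 2 = t * (t + 1) + 1 := by simp [brk]

/-- Two factors suffice for large `t`, since the remaining tail starts with exponent `t * (t + 1) +
1`. -/
lemma clearedDen_two {t : ℕ} (ht : 1 ≤ t) {q : ℂ} (hq : ‖q‖ < 1) :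
    clearedDen t 2 q =
      (1 - 2 * q) * (1 - q ^ (t + 1)) + q ^ (t + 2) * (1 - altSum t 0 2 q) := by
  have h0 : 1 - q ≠ 0 := by simpa using one_sub_pow_ne_zero hq one_pos
  have h1 := one_sub_pow_ne_zero hq (Nat.succ_pos t)
  rw [clearedDen, treeDen, altSum_eq ht hq, altSum_eq ht hq]
  simp only [brkProd, Finset.prod_range_succ, Finset.prod_range_zero, brkRatio, brk_one, zero_mul,
    pow_zero, Nat.reduceAdd, zero_add, one_mul]
  simp only [brk, pow_one]
  simp only [Nat.succ_eq_add_one] at h1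
  field_simp
  ring

lemma clearedNum_two {t : ℕ} (ht : 1 ≤ t) {q : ℂ} (hq : ‖q‖ < 1) :
    clearedNum t 2 q = (1 - q ^ (t + 1)) * (1 - q - q ^ 2) + q * (q ^ (t + 1)) ^ 2 -
      q * q ^ (t + 1) * altSum t 1 2 q := by
  have h0 : 1 - q ≠ 0 := by simpa using one_sub_pow_ne_zero hq one_pos
  have h1 := one_sub_pow_ne_zero hq (Nat.succ_pos t)
  rw [clearedNum, treeNum, altSum_eq ht hq, altSum_eq ht hq]
  simp only [brkProd, Finset.prod_range_succ, Finset.prod_range_zero, brkRatio, brk_one, one_mul,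
    Nat.reduceAdd, zero_add]
  simp only [brk, pow_one]
  simp only [Nat.succ_eq_add_one] at h1
  field_simp
  ring

lemma altSum_ofReal (t b i : ℕ) (x : ℝ) : altSum t b i (x : ℂ) = ((altSum t b i (x : ℂ)).re : ℂ) :=
  Complex.ext rfl (by simp [altSum_ofReal_im])

lemma altSum_zero_re_eq {t : ℕ} (ht : 1 ≤ t) {x : ℝ} (hx0 : 0 ≤ x) (hx : x < 1) (i : ℕ) :
    (altSum t 0 i (x : ℂ)).re =
      x ^ brk t i / (1 - x ^ brk t i) * (1 - (altSum t 0 (i + 1) (x : ℂ)).re) := by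
  have hq : ‖(x : ℂ)‖ < 1 := by rwa [Complex.norm_real, Real.norm_of_nonneg hx0]
  have h := altSum_eq ht hq 0 i
  rw [altSum_ofReal t 0 i, altSum_ofReal t 0 (i + 1), brkRatio] at h
  simp only [zero_mul, pow_zero] at h
  exact_mod_cast h

lemma pow_brk_le {t : ℕ} (ht : 1 ≤ t) {x : ℝ} (hx0 : 0 ≤ x) (hx : x < 1) {i j : ℕ} (hij : i ≤ j)
    {c : ℝ} (h : x ^ brk t i ≤ c) : x ^ brk t j ≤ c :=
  (pow_le_pow_of_le_one hx0 hx.le (brk_mono ht hij)).trans h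

lemma altSum_zero_re_le_one {t : ℕ} (ht : 1 ≤ t) {x : ℝ} (hx0 : 0 ≤ x) (hx : x < 1) {i : ℕ}
    (h : x ^ brk t i ≤ 1 / 3) : (altSum t 0 i (x : ℂ)).re ≤ 1 := by
  have := norm_altSum_le ht hx (q := (x : ℂ)) (by rw [Complex.norm_real, Real.norm_of_nonneg hx0])
    0 i h
  linarith [Complex.re_le_norm (altSum t 0 i (x : ℂ))]

/-- One step of the recursion: the next tail is at most one, so the alternating series has the sign
of its first term. The sign of the tail makes one of the two tests for the second zero free of error
terms. -/
lemma altSum_zero_re_nonneg {t : ℕ} (ht : 1 ≤ t) {x : ℝ} (hx0 : 0 ≤ x) (hx : x < 1) {i : ℕ}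
    (h : x ^ brk t i ≤ 1 / 3) : 0 ≤ (altSum t 0 i (x : ℂ)).re := by
  rw [altSum_zero_re_eq ht hx0 hx]
  have := altSum_zero_re_le_one ht hx0 hx (pow_brk_le ht hx0 hx i.le_succ h)
  exact mul_nonneg (div_nonneg (by positivity) (by linarith)) (by linarith)

lemma altSum_zero_re_le {t : ℕ} (ht : 1 ≤ t) {x : ℝ} (hx0 : 0 ≤ x) (hx : x < 1) {i : ℕ}
    (h : x ^ brk t i ≤ 1 / 3) : (altSum t 0 i (x : ℂ)).re ≤ x ^ brk t i / (1 - x ^ brk t i) := by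
  rw [altSum_zero_re_eq ht hx0 hx]
  have := altSum_zero_re_nonneg ht hx0 hx (pow_brk_le ht hx0 hx i.le_succ h)
  exact mul_le_of_le_one_right (div_nonneg (by positivity) (by linarith)) (by linarith)

/-- The function `clearedDen t 2` on the real line. -/
noncomputable def redDen (t : ℕ) (x : ℝ) : ℝ :=
  (1 - 2 * x) * (1 - x ^ (t + 1)) + x ^ (t + 2) * (1 - (altSum t 0 2 (x : ℂ)).re)

lemma redDen_eq {t : ℕ} (ht : 1 ≤ t) {x : ℝ} (hx0 : 0 ≤ x) (hx : x < 1) :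
    redDen t x = (1 - x) * (1 - x ^ (t + 1)) * (treeDen t x).re := by
  have hq : ‖(x : ℂ)‖ < 1 := by rwa [Complex.norm_real, Real.norm_of_nonneg hx0]
  have h := clearedDen_two ht hq
  rw [altSum_ofReal t 0 2] at h
  have h' : clearedDen t 2 (x : ℂ) = (redDen t x : ℂ) := by rw [h, redDen]; push_cast; ring
  have h2 := (clearedDen_ofReal t 2 x).2
  rw [h', Complex.ofReal_re] at h2
  rw [h2]
  simp [Finset.prod_range_succ, brk]

lemma treeDen_eq_zero_of_redDen {t : ℕ} (ht : 1 ≤ t) {x : ℝ} (hx0 : 0 ≤ x) (hx : x < 1)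
    (h : redDen t x = 0) : treeDen t x = 0 := by
  rw [redDen_eq ht hx0 hx] at h
  have h1 : 0 < 1 - x ^ (t + 1) := sub_pos.mpr (pow_lt_one₀ hx0 hx (by omega))
  have h2 : (treeDen t x).re = 0 := by
    rcases mul_eq_zero.mp h with h | h
    · have := mul_pos (sub_pos.mpr hx) h1
      linarith
    · exact h
  exact Complex.ext h2 (treeDen_ofReal_im t x)

lemma continuousOn_redDen {t : ℕ} (ht : 1 ≤ t) {a b : ℝ} (ha : 0 ≤ a) (hb : b < 1) :
    ContinuousOn (redDen t) (Set.Icc a b) := by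
  have h := continuousOn_treeDen_re ht (a := a) (b := b) (by linarith) hb
  have h' : ContinuousOn (fun x : ℝ => (1 - x) * (1 - x ^ (t + 1)) * (treeDen t x).re)
      (Set.Icc a b) := ContinuousOn.mul (by fun_prop) h
  exact h'.congr fun x hx => redDen_eq ht (ha.trans hx.1) (hx.2.trans_lt hb)

/-! ### The second zero for `t ≥ 16` -/

/-- `7 / 160` is the value of `7 / 10 * z` at `z = 1 / 16`, and `160 / 153 = 1 / (1 - 7 / 160)`. -/
lemma log_remainder_le {z u a : ℝ} (hu0 : 0 ≤ u) (hu1 : u ≤ 7 / 160) (hu2 : u ≤ a * z)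
    (k : ℕ) : u ^ k / (1 - u) ≤ 160 / 153 * a ^ k * z ^ k := by
  rw [div_le_iff₀ (by linarith)]
  have h1 : u ^ k ≤ (a * z) ^ k := pow_le_pow_left₀ hu0 hu2 k
  rw [mul_pow] at h1
  have h2 : 0 ≤ a ^ k * z ^ k := (pow_nonneg hu0 k).trans h1
  have h3 := mul_le_mul_of_nonneg_left hu1 h2
  linarith

/-- Taylor expansion in `u = z * v`. The coefficients `1 / 2, 3 / 8, 7 / 24, …` are `(1 - 2 ^ (-k))
/ k` and come from `log (1 - u) - log (1 - u / 2)`. The first logarithm needs one more term, because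
its factor `n` has size `1 / z`. -/
lemma abs_log_expansion_le {z v n : ℝ} (hz : 0 < z) (hz' : z ≤ 1 / 16) (hv : 0 ≤ v)
    (hv' : v ≤ 7 / 10) (hn : n * z = 1 + z) :
    |n * Real.log (1 + z * v) - Real.log (1 - z * v / 2) + Real.log (1 - z * v) -
      ((1 + z) * (v - z * v ^ 2 / 2 + z ^ 2 * v ^ 3 / 3 - z ^ 3 * v ^ 4 / 4 + z ^ 4 * v ^ 5 / 5
        - z ^ 5 * v ^ 6 / 6) - (z * v / 2 + 3 / 8 * (z ^ 2 * v ^ 2) + 7 / 24 * (z ^ 3 * v ^ 3)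
        + 15 / 64 * (z ^ 4 * v ^ 4) + 31 / 160 * (z ^ 5 * v ^ 5)))| ≤ z ^ 6 / 4 := by
  obtain ⟨u, hu⟩ : ∃ u, u = z * v := ⟨_, rfl⟩
  have hu0 : 0 ≤ u := by rw [hu]; positivity
  have hu2 : u ≤ 7 / 10 * z := by rw [hu]; nlinarith
  have hu1 : u ≤ 7 / 160 := by linarith
  have n0 : 0 < n := by
    by_contra h
    have := mul_nonpos_of_nonpos_of_nonneg (not_lt.mp h) hz.le
    linarith
  have e1 := Real.abs_log_sub_add_sum_range_le (x := -u) (by rw [abs_neg, abs_of_nonneg hu0]; linarith) 6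
  have e2 := Real.abs_log_sub_add_sum_range_le (x := u / 2) (by rw [abs_of_nonneg (by linarith)]; linarith) 5
  have e3 := Real.abs_log_sub_add_sum_range_le (x := u) (by rw [abs_of_nonneg hu0]; linarith) 5
  rw [abs_neg, abs_of_nonneg hu0] at e1
  rw [abs_of_nonneg (by linarith : 0 ≤ u / 2)] at e2
  rw [abs_of_nonneg hu0] at e3
  have e1' := abs_le.mp (e1.trans (log_remainder_le hu0 hu1 hu2 7))
  have e2' := abs_le.mp (e2.trans (log_remainder_le (a := 7 / 20) (z := z) (by linarith)
    (by linarith) (by linarith) 6))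
  have e3' := abs_le.mp (e3.trans (log_remainder_le hu0 hu1 hu2 6))
  simp only [Finset.sum_range_succ, Finset.sum_range_zero, sub_neg_eq_add] at e1' e2' e3'
  norm_num at e1' e2' e3'
  have h6 : 0 ≤ z ^ 6 := by positivity
  have h7 : z ^ 7 ≤ 1 / 16 * z ^ 6 := by
    rw [pow_succ z 6]
    have := mul_le_mul_of_nonneg_left hz' h6
    linarith
  have hnz : n * z ^ 7 = z ^ 6 + z ^ 7 := by linear_combination z ^ 6 * hn
  obtain ⟨A, hA⟩ : ∃ A, A = Real.log (1 + u) := ⟨_, rfl⟩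
  obtain ⟨S, hS⟩ : ∃ S, S = u - u ^ 2 / 2 + u ^ 3 / 3 - u ^ 4 / 4 + u ^ 5 / 5 - u ^ 6 / 6 := ⟨_, rfl⟩
  have hnS : n * S = (1 + z) * (v - z * v ^ 2 / 2 + z ^ 2 * v ^ 3 / 3 - z ^ 3 * v ^ 4 / 4
      + z ^ 4 * v ^ 5 / 5 - z ^ 5 * v ^ 6 / 6) := by
    rw [hS, hu]
    linear_combination (v - z * v ^ 2 / 2 + z ^ 2 * v ^ 3 / 3 - z ^ 3 * v ^ 4 / 4
      + z ^ 4 * v ^ 5 / 5 - z ^ 5 * v ^ 6 / 6) * hn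
  have hc := log_remainder_le hu0 hu1 hu2 7
  have d1 : A - S ≤ 160 / 153 * (7 / 10) ^ 7 * z ^ 7 := by
    rw [hA, hS]; norm_num; linarith [e1'.2]
  have d2 : -(160 / 153 * (7 / 10) ^ 7 * z ^ 7) ≤ A - S := by
    rw [hA, hS]; norm_num; linarith [e1'.1]
  have f1 := mul_le_mul_of_nonneg_left d1 n0.le
  have f2 := mul_le_mul_of_nonneg_left d2 n0.le
  have f1' : n * A - n * S ≤ 160 / 153 * (7 / 10) ^ 7 * (z ^ 6 + z ^ 7) := by
    rw [← hnz]; linarith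
  have f2' : -(160 / 153 * (7 / 10) ^ 7 * (z ^ 6 + z ^ 7)) ≤ n * A - n * S := by
    rw [← hnz]; linarith
  rw [hnS] at f1' f2'
  have m2 : z ^ 2 * v ^ 2 = u ^ 2 := by rw [hu]; ring
  have m3 : z ^ 3 * v ^ 3 = u ^ 3 := by rw [hu]; ring
  have m4 : z ^ 4 * v ^ 4 = u ^ 4 := by rw [hu]; ring
  have m5 : z ^ 5 * v ^ 5 = u ^ 5 := by rw [hu]; ring
  rw [m2, m3, m4, m5, ← hu, ← hA]
  generalize (1 + z) * (v - z * v ^ 2 / 2 + z ^ 2 * v ^ 3 / 3 - z ^ 3 * v ^ 4 / 4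
      + z ^ 4 * v ^ 5 / 5 - z ^ 5 * v ^ 6 / 6) = B at f1' f2' ⊢
  norm_num at f1' f2'
  rw [abs_le]
  constructor <;> linarith [e2'.1, e2'.2, e3'.1, e3'.2]

/-- The coefficient of `z ^ 4` of the logarithmic equation for the second zero. -/
noncomputable def phiFour (L z σ v v1 v2 v3 c2 : ℝ) : ℝ :=
  σ + v3 * (1 - 2 * L) / 2 - v2 * (v1 + c2) / 2 - 7 / 8 * (2 * L * v2 + v1 ^ 2) + L ^ 2 * v2
    + L * v1 ^ 2 + z * v1 ^ 3 / 3 + v1 * (v ^ 2 + v * L + L ^ 2) / 24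
    - v1 * (v + L) * (v ^ 2 + L ^ 2) / 4 - v ^ 4 / 4 + v ^ 5 / 5 - 15 * v ^ 4 / 64
    + z * (v ^ 5 / 5 - v ^ 6 / 6 - 31 * v ^ 5 / 160) - z ^ 2 * v ^ 6 / 6

/-- The constants `c2`, `c3`, `c4` are those that cancel the terms of order `z`, `z ^ 2`, `z ^ 3`.
Each of `s1`, `s2`, `s3` extracts one more factor `z` from what is left. -/
lemma phiFour_eq {L z σ v v1 v2 v3 c2 c3 c4 : ℝ} (hv : v = L + z * v1) (h1 : v1 = c2 + z * v2)
    (h2 : v2 = c3 + z * v3) (h3 : v3 = c4 + σ * z) (hc2 : c2 = -(L - L ^ 2) / 2)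
    (hc3 : c3 = (4 * L ^ 3 + 3 * L ^ 2 + 6 * L) / 24)
    (hc4 : c4 = (2 * L ^ 4 + 54 * L ^ 3 - 27 * L ^ 2 - 6 * L) / 48) :
    (1 + z) * (v - z * v ^ 2 / 2 + z ^ 2 * v ^ 3 / 3 - z ^ 3 * v ^ 4 / 4 + z ^ 4 * v ^ 5 / 5
        - z ^ 5 * v ^ 6 / 6) - (z * v / 2 + 3 / 8 * (z ^ 2 * v ^ 2) + 7 / 24 * (z ^ 3 * v ^ 3)
        + 15 / 64 * (z ^ 4 * v ^ 4) + 31 / 160 * (z ^ 5 * v ^ 5)) - L =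
      z ^ 4 * phiFour L z σ v v1 v2 v3 c2 := by
  set H2 := v ^ 3 / 3 - 7 * v ^ 2 / 8 with hH2
  set H3 := v ^ 3 / 24 - v ^ 4 / 4 with hH3
  have s1 : v1 + (v - v ^ 2) / 2 = z * (v2 + v1 * (1 - v - L) / 2) := by
    rw [hv]; linear_combination h1 + hc2
  have s2 : v2 + v1 * (1 - v - L) / 2 + H2 = z * (v3 + v2 * (1 - 2 * L) / 2 - v1 ^ 2 / 2
      + v1 * (v ^ 2 + v * L + L ^ 2) / 3 - 7 * v1 * (v + L) / 8) := by
    rw [hH2, hv]; linear_combination h2 + (1 - 2 * L) / 2 * h1 + hc3 + (1 - 2 * L) / 2 * hc2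
  have s3 : v3 + v2 * (1 - 2 * L) / 2 - v1 ^ 2 / 2
      + v1 * (v ^ 2 + v * L + L ^ 2) / 3 - 7 * v1 * (v + L) / 8 + H3 = z * (σ +
      v3 * (1 - 2 * L) / 2 - v2 * (v1 + c2) / 2 - 7 / 8 * (2 * L * v2 + v1 ^ 2) + L ^ 2 * v2
    + L * v1 ^ 2 + z * v1 ^ 3 / 3 + v1 * (v ^ 2 + v * L + L ^ 2) / 24
    - v1 * (v + L) * (v ^ 2 + L ^ 2) / 4) := by
    rw [hH3, hv]
    linear_combination h3 + (1 - 2 * L) / 2 * h2 + (-(v1 + c2) / 2 + L ^ 2 - 7 * L / 4) * h1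
      + hc4 + (1 - 2 * L) / 2 * hc3 + (-(c2 - (L - L ^ 2) / 2) / 2 + L ^ 2 - 7 * L / 4) * hc2
  rw [phiFour]
  linear_combination hv + z * s1 + z ^ 2 * s2 + z ^ 3 * s3

namespace IExpr

/-- Here `var 0` is `z` and `var 1` is `Real.log 2`; the expressions follow the nested definition of
`v3`, `v2`, `v1`. -/
def shiftFour (σ : IExpr) : IExpr :=
  rat 1 24 * (var 1 * var 1 * var 1 * var 1) + rat 9 8 * (var 1 * var 1 * var 1)
    - rat 9 16 * (var 1 * var 1) - rat 1 8 * var 1 + σ * var 0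

def shiftThree (v3 : IExpr) : IExpr :=
  rat 1 6 * (var 1 * var 1 * var 1) + rat 1 8 * (var 1 * var 1) + rat 1 4 * var 1 + var 0 * v3

def shiftTwo (v2 : IExpr) : IExpr := rat 1 2 * (var 1 * var 1) - rat 1 2 * var 1 + var 0 * v2

def phi (σ v v1 v2 v3 : IExpr) : IExpr :=
  σ + v3 * (rat 1 2 - var 1) - rat 1 2 * v2 * (v1 + rat 1 2 * (var 1 * var 1) - rat 1 2 * var 1)
    - rat 7 8 * (rat 2 1 * var 1 * v2 + v1 * v1) + var 1 * var 1 * v2 + var 1 * (v1 * v1)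
    + rat 1 3 * var 0 * (v1 * v1 * v1)
    + rat 1 24 * v1 * (v * v + v * var 1 + var 1 * var 1)
    - rat 1 4 * v1 * (v + var 1) * (v * v + var 1 * var 1)
    - rat 31 64 * (v * v * v * v) + rat 1 5 * (v * v * v * v * v)
    + var 0 * (rat 1 160 * (v * v * v * v * v) - rat 1 6 * (v * v * v * v * v * v))
    - rat 1 6 * (var 0 * var 0) * (v * v * v * v * v * v)

def phiAt (σ : IExpr) : IExpr :=
  phi σ (var 1 + var 0 * shiftTwo (shiftThree (shiftFour σ)))
    (shiftTwo (shiftThree (shiftFour σ))) (shiftThree (shiftFour σ)) (shiftFour σ)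

lemma eval_phiAt {L z σ v v1 v2 v3 c2 c3 c4 : ℝ} {s : IExpr} (hs : s.eval (values z [L]) = σ)
    (hv : v = L + z * v1) (h1 : v1 = c2 + z * v2)
    (h2 : v2 = c3 + z * v3) (h3 : v3 = c4 + σ * z) (hc2 : c2 = -(L - L ^ 2) / 2)
    (hc3 : c3 = (4 * L ^ 3 + 3 * L ^ 2 + 6 * L) / 24)
    (hc4 : c4 = (2 * L ^ 4 + 54 * L ^ 3 - 27 * L ^ 2 - 6 * L) / 48) :
    (phiAt s).eval (values z [L]) = phiFour L z σ v v1 v2 v3 c2 := by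
  have x0 : (values z [L]) 0 = z := rfl
  have x1 : (values z [L]) 1 = L := rfl
  have e3 : (shiftFour s).eval (values z [L]) = v3 := by
    simp only [shiftFour, eval_add, eval_sub, eval_mul, eval_rat, eval_var, x0, x1, hs]
    rw [h3, hc4]; push_cast; ring
  have e2 : (shiftThree (shiftFour s)).eval (values z [L]) = v2 := by
    rw [shiftThree]
    simp only [eval_add, eval_mul, eval_rat, eval_var, x0, x1, e3]
    rw [h2, hc3]; push_cast; ring
  have e1 : (shiftTwo (shiftThree (shiftFour s))).eval (values z [L]) = v1 := by
    rw [shiftTwo]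
    simp only [eval_add, eval_sub, eval_mul, eval_rat, eval_var, x0, x1, e2]
    rw [h1, hc2]; push_cast; ring
  simp only [phiAt, phi, eval_add, eval_sub, eval_mul, eval_rat, eval_var, x0, x1, hs, e1, e2, e3,
    ← hv]
  rw [phiFour, hc2]; push_cast; ring

end IExpr

-- Intervals of length `1 / 16000` cover `[0, 1 / 16]`, with one extra interval for the right end.
-- The margin `0.005` is narrow, hence the fine grid; in the other direction a margin of `0.45`
-- permits length `1 / 4000`.
set_option maxRecDepth 100000 in
lemma phiAt_upper : (IExpr.phiAt (.rat 26 100) - .rat 5 1000).posCheck 1001 62500000000000000000000000 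
    [(693147180300000000000000000000, 500000000000000000000)] = true := by decide +kernel

set_option maxRecDepth 100000 in
lemma phiAt_lower : (.rat 0 1 - .rat 45 100 - IExpr.phiAt (.rat 0 1 - .rat 26 100)).posCheck 251 250000000000000000000000000
    [(693147180300000000000000000000, 500000000000000000000)] = true := by decide +kernel

lemma sub_sq_half_le_log_one_add {u : ℝ} (hu : 0 ≤ u) : u - u ^ 2 / 2 ≤ Real.log (1 + u) := by
  refine le_trans ?_ (Real.le_log_one_add_of_nonneg hu)
  rw [le_div_iff₀ (by linarith)]
  have : 0 ≤ u ^ 3 := by positivity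
  nlinarith

lemma pow_succ_le_exp {t : ℕ} {x v z : ℝ} (hz : 0 < z) (hzt : t * z = 1) (hx : 0 < x)
    (hv : 0 ≤ v) (hxv : x * (1 + z * v) ≤ 1) :
    (t + 1 : ℕ) * Real.log x ≤ -((1 + z) * (v - z * v ^ 2 / 2)) := by
  have h0 : 0 ≤ z * v := by positivity
  have h1 : x ≤ (1 + z * v)⁻¹ := by
    rw [inv_eq_one_div, le_div_iff₀ (by linarith)]; exact hxv
  have h2 : Real.log x ≤ -Real.log (1 + z * v) := by
    rw [← Real.log_inv]; exact Real.log_le_log hx h1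
  have h3 := sub_sq_half_le_log_one_add h0
  have h4 : Real.log x ≤ -(z * (v - z * v ^ 2 / 2)) := by
    have : z * v - (z * v) ^ 2 / 2 = z * (v - z * v ^ 2 / 2) := by ring
    linarith
  have h5 := mul_le_mul_of_nonneg_left h4 (Nat.cast_nonneg (α := ℝ) (t + 1))
  refine h5.trans (le_of_eq ?_)
  push_cast
  linear_combination -(v - z * v ^ 2 / 2) * hzt

lemma pow_succ_le_half {t : ℕ} {x v z : ℝ} (hz : 0 < z) (hzt : t * z = 1) (hx : 0 < x)
    (hv : 0 ≤ v) (hxv : x * (1 + z * v) ≤ 1) (hL : Real.log 2 ≤ (1 + z) * (v - z * v ^ 2 / 2)) :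
    x ^ (t + 1) ≤ 1 / 2 := by
  have h := pow_succ_le_exp hz hzt hx hv hxv
  rw [← Real.log_le_log_iff (by positivity) (by norm_num), Real.log_pow, one_div, Real.log_inv]
  linarith

/-- `brk t 2` exceeds `t * (t + 1)`, and `x ^ (t + 1)` is at most `exp (-c * z) / 2`; the `t`-th
power gives the claim because `t * z = 1`. -/
lemma pow_brk_two_le {t : ℕ} {x v z c : ℝ} (hz : 0 < z) (hzt : t * z = 1) (hx : 0 < x) (hx1 : x ≤ 1)
    (hv : 0 ≤ v) (hxv : x * (1 + z * v) ≤ 1)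
    (hL : Real.log 2 + c * z ≤ (1 + z) * (v - z * v ^ 2 / 2)) :
    x ^ brk t 2 ≤ Real.exp (-c) / 2 ^ t := by
  have h := pow_succ_le_exp hz hzt hx hv hxv
  have h1 : x ^ brk t 2 ≤ x ^ (t * (t + 1)) :=
    pow_le_pow_of_le_one hx.le hx1 (by rw [brk_two]; omega)
  refine h1.trans ?_
  rw [← Real.log_le_log_iff (by positivity) (by positivity), Real.log_pow,
    Real.log_div (Real.exp_ne_zero _) (by positivity), Real.log_exp, Real.log_pow]
  have h2 : (t + 1 : ℕ) * Real.log x ≤ -(Real.log 2 + c * z) := by linarith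
  have h3 := mul_le_mul_of_nonneg_left h2 (Nat.cast_nonneg (α := ℝ) t)
  rw [Nat.cast_mul, mul_assoc]
  refine h3.trans (le_of_eq ?_)
  linear_combination -c * hzt

/-- With `x = 1 / (1 + u)` and tail `ω` the zero equation reads `(1 - u) * (1 + u) ^ (t + 1) = 2 - u
- ω`; for `ω = 0` its logarithm is `logGap (t + 1) u = 0`. -/
lemma redDen_mul_pow (t : ℕ) {u : ℝ} (hu : 0 ≤ u) :
    redDen t (1 / (1 + u)) * (1 + u) ^ (t + 2) =
      1 - (altSum t 0 2 ((1 / (1 + u) : ℝ) : ℂ)).re - (1 - u) * ((1 + u) ^ (t + 1) - 1) := by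
  have h : (1 + u) ≠ 0 := by positivity
  rw [redDen]
  generalize (altSum t 0 2 ((1 / (1 + u) : ℝ) : ℂ)).re = w
  rw [div_pow, div_pow, one_pow, one_pow, pow_succ (1 + u) (t + 1)]
  field_simp
  ring

/-- `log ((1 - u) (1 + u) ^ n / (2 - u))`. -/
noncomputable def logGap (n : ℕ) (u : ℝ) : ℝ :=
  n * Real.log (1 + u) - Real.log (1 - u / 2) + Real.log (1 - u) - Real.log 2

lemma exp_logGap (n : ℕ) {u : ℝ} (hu : 0 ≤ u) (hu1 : u < 1) :
    (2 - u) * Real.exp (logGap n u) = (1 - u) * (1 + u) ^ n := by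
  have h1 : 0 < 1 - u / 2 := by linarith
  have h2 : 0 < 1 - u := by linarith
  rw [logGap, Real.exp_sub, Real.exp_add, Real.exp_sub, ← Real.log_pow, Real.exp_log (by positivity),
    Real.exp_log h1, Real.exp_log h2, Real.exp_log (by norm_num)]
  have h3 : 2 - u ≠ 0 := by linarith
  field_simp

lemma redDen_neg_of_logGap {t : ℕ} (ht : 1 ≤ t) {u : ℝ} (hu : 0 < u) (hu1 : u < 1)
    (hw : (1 / (1 + u)) ^ brk t 2 ≤ 1 / 3) (h : 0 < logGap (t + 1) u) :
    redDen t (1 / (1 + u)) < 0 := by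
  have e := redDen_mul_pow t hu.le
  have hx1 : 1 / (1 + u) < 1 := by rw [div_lt_one (by linarith)]; linarith
  have hw0 := altSum_zero_re_nonneg ht (by positivity : 0 ≤ 1 / (1 + u)) hx1 hw
  have h1 := exp_logGap (t + 1) hu.le hu1
  have h2 := Real.one_lt_exp_iff.mpr h
  have h3 : redDen t (1 / (1 + u)) * (1 + u) ^ (t + 2) < 0 := by rw [e]; nlinarith
  exact neg_of_mul_neg_left h3 (by positivity)

/-- Here the nonnegative tail acts against the claim, so a quantitative gap `a` is needed; `exp (-a)
≤ 1 / (1 + a)` turns it into room for the tail. -/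
lemma redDen_pos_of_logGap {t : ℕ} {u a : ℝ} (hu : 0 < u) (hu1 : u < 1)
    (ha : 0 ≤ a) (h : logGap (t + 1) u ≤ -a)
    (hwa : (altSum t 0 2 ((1 / (1 + u) : ℝ) : ℂ)).re * (1 + a) < (2 - u) * a) :
    0 < redDen t (1 / (1 + u)) := by
  have e := redDen_mul_pow t hu.le
  have h1 := exp_logGap (t + 1) hu.le hu1
  have h2 : Real.exp (logGap (t + 1) u) * (1 + a) ≤ 1 := by
    have h4 := Real.exp_le_exp.mpr h
    have h5 : (1 + a) ≤ Real.exp a := by linarith [Real.add_one_le_exp a]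
    calc Real.exp (logGap (t + 1) u) * (1 + a) ≤ Real.exp (-a) * Real.exp a := by gcongr
      _ = 1 := by rw [← Real.exp_add]; simp
  have h3 : 0 < (redDen t (1 / (1 + u)) * (1 + u) ^ (t + 2)) * (1 + a) := by
    rw [e]; nlinarith
  exact pos_of_mul_pos_left (pos_of_mul_pos_left h3 (by linarith)) (by positivity)

/-- The second zero is sought among the numbers `1 / (1 + z * shift L z σ)`. -/
structure IsShift (L z σ v v1 v2 v3 c2 c3 c4 : ℝ) : Prop where
  v : v = L + z * v1
  v1 : v1 = c2 + z * v2
  v2 : v2 = c3 + z * v3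
  v3 : v3 = c4 + σ * z
  c2 : c2 = -(L - L ^ 2) / 2
  c3 : c3 = (4 * L ^ 3 + 3 * L ^ 2 + 6 * L) / 24
  c4 : c4 = (2 * L ^ 4 + 54 * L ^ 3 - 27 * L ^ 2 - 6 * L) / 48

lemma log_two_pow_bounds : 0.48045 < Real.log 2 ^ 2 ∧ Real.log 2 ^ 2 < 0.48046 ∧
    0.33302 < Real.log 2 ^ 3 ∧ Real.log 2 ^ 3 < 0.33303 ∧
    0.23083 < Real.log 2 ^ 4 ∧ Real.log 2 ^ 4 < 0.23084 := by
  obtain ⟨h1, h2⟩ := log_two_bounds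
  have h0 : (0 : ℝ) ≤ 0.6931471803 := by norm_num
  have h0' : 0 ≤ Real.log 2 := by linarith
  refine ⟨?_, ?_, ?_, ?_, ?_, ?_⟩
  · refine lt_of_lt_of_le ?_ (pow_le_pow_left₀ h0 h1.le 2); norm_num
  · refine lt_of_le_of_lt (pow_le_pow_left₀ h0' h2.le 2) ?_; norm_num
  · refine lt_of_lt_of_le ?_ (pow_le_pow_left₀ h0 h1.le 3); norm_num
  · refine lt_of_le_of_lt (pow_le_pow_left₀ h0' h2.le 3) ?_; norm_num
  · refine lt_of_lt_of_le ?_ (pow_le_pow_left₀ h0 h1.le 4); norm_num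
  · refine lt_of_le_of_lt (pow_le_pow_left₀ h0' h2.le 4) ?_; norm_num

lemma IsShift.bounds {z σ v v1 v2 v3 c2 c3 c4 : ℝ}
    (h : IsShift (Real.log 2) z σ v v1 v2 v3 c2 c3 c4) (hz : 0 < z) (hz' : z ≤ 1 / 16)
    (hσ : |σ| ≤ 0.26) :
    (0.6864 ≤ v ∧ v ≤ 0.69315) ∧ (-0.1064 ≤ v1 ∧ v1 ≤ -0.088) ∧ (0.288 ≤ v2 ∧ v2 ≤ 0.292) := by
  obtain ⟨h1, h2⟩ := log_two_bounds
  obtain ⟨h3, h4, h5, h6, h7, h8⟩ := log_two_pow_bounds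
  obtain ⟨s1, s2⟩ := abs_le.mp hσ
  have c2b : -0.10635 ≤ c2 ∧ c2 ≤ -0.10634 := by rw [h.c2]; constructor <;> linarith
  have c3b : 0.2888 ≤ c3 ∧ c3 ≤ 0.2889 := by rw [h.c3]; constructor <;> linarith
  have c4b : 0.0273 ≤ c4 ∧ c4 ≤ 0.0274 := by rw [h.c4]; constructor <;> linarith
  have v3b : 0 ≤ v3 ∧ v3 ≤ 0.045 := by rw [h.v3]; constructor <;> nlinarith
  have v2b : 0.288 ≤ v2 ∧ v2 ≤ 0.292 := by rw [h.v2]; constructor <;> nlinarith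
  have v1b : -0.1064 ≤ v1 ∧ v1 ≤ -0.088 := by rw [h.v1]; constructor <;> nlinarith
  refine ⟨?_, v1b, v2b⟩
  rw [h.v]; constructor <;> nlinarith

lemma abs_logGap_sub_le {t : ℕ} {z σ v v1 v2 v3 c2 c3 c4 : ℝ}
    (h : IsShift (Real.log 2) z σ v v1 v2 v3 c2 c3 c4) (hz : 0 < z) (hz' : z ≤ 1 / 16)
    (hzt : t * z = 1) (hσ : |σ| ≤ 0.26) :
    |logGap (t + 1) (z * v) - z ^ 4 * phiFour (Real.log 2) z σ v v1 v2 v3 c2| ≤ z ^ 4 / 1000 := by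
  obtain ⟨⟨b1, b2⟩, -, -⟩ := h.bounds hz hz' hσ
  have hn : ((t + 1 : ℕ) : ℝ) * z = 1 + z := by push_cast; linarith
  have := abs_log_expansion_le hz hz' (by linarith) (by linarith) hn
  rw [← phiFour_eq h.v h.v1 h.v2 h.v3 h.c2 h.c3 h.c4, logGap]
  refine le_trans (le_of_eq ?_) (this.trans ?_)
  · congr 1; ring
  · have h4 : 0 ≤ z ^ 4 := by positivity
    have : z ^ 2 ≤ 1 / 256 := by nlinarith
    nlinarith

lemma phiFour_upper {z v v1 v2 v3 c2 c3 c4 : ℝ}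
    (h : IsShift (Real.log 2) z 0.26 v v1 v2 v3 c2 c3 c4) (hz : 0 < z) (hz' : z ≤ 1 / 16) :
    0.005 < phiFour (Real.log 2) z 0.26 v v1 v2 v3 c2 := by
  have hc := IExpr.eval_pos_of_posCheck phiAt_upper (x := z) (y := [Real.log 2]) hz.le
    (by norm_num [Ball.scale]; linarith) (.cons inBox_log_two .nil)
  rw [IExpr.eval_sub, IExpr.eval_phiAt (σ := 0.26) (by norm_num) h.v h.v1 h.v2 h.v3 h.c2 h.c3 h.c4]
    at hc
  norm_num at hc ⊢
  linarith

lemma phiFour_lower {z v v1 v2 v3 c2 c3 c4 : ℝ}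
    (h : IsShift (Real.log 2) z (-0.26) v v1 v2 v3 c2 c3 c4) (hz : 0 < z) (hz' : z ≤ 1 / 16) :
    phiFour (Real.log 2) z (-0.26) v v1 v2 v3 c2 < -0.45 := by
  have hc := IExpr.eval_pos_of_posCheck phiAt_lower (x := z) (y := [Real.log 2]) hz.le
    (by norm_num [Ball.scale]; linarith) (.cons inBox_log_two .nil)
  rw [IExpr.eval_sub, IExpr.eval_phiAt (σ := -0.26) (by norm_num) h.v h.v1 h.v2 h.v3 h.c2 h.c3 h.c4]
    at hc
  norm_num at hc ⊢
  linarith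

lemma exp_neg_346_le : Real.exp (-0.346) ≤ 0.7076 := by
  have h := Real.sum_le_exp_of_nonneg (x := 0.346) (by norm_num) 5
  simp only [Finset.sum_range_succ, Finset.sum_range_zero, Nat.factorial] at h
  norm_num at h
  rw [Real.exp_neg, inv_eq_one_div, div_le_iff₀ (Real.exp_pos _)]
  norm_num
  linarith

/-- To first order in `z` the right side is `log 2 + (log 2 / 2) * z`, and `0.346` lies just below
`log 2 / 2`. Thus the tail at the second zero is of size about `2 ^ (-t) / √2`. -/
lemma IsShift.log_le {z σ v v1 v2 v3 c2 c3 c4 : ℝ}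
    (h : IsShift (Real.log 2) z σ v v1 v2 v3 c2 c3 c4) (hz : 0 < z) (hz' : z ≤ 1 / 16)
    (hσ : |σ| ≤ 0.26) : Real.log 2 + 0.346 * z ≤ (1 + z) * (v - z * v ^ 2 / 2) := by
  obtain ⟨⟨b1, b2⟩, ⟨b3, b4⟩, b5, b6⟩ := h.bounds hz hz' hσ
  obtain ⟨h1, h2⟩ := log_two_bounds
  obtain ⟨h3, h4, h5, h6, h7, h8⟩ := log_two_pow_bounds
  obtain ⟨p, hp⟩ : ∃ p, p = z * v1 := ⟨_, rfl⟩
  have p1 : z * (-0.10635 + 0.288 * z) ≤ p := by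
    rw [hp]; refine mul_le_mul_of_nonneg_left ?_ hz.le
    rw [h.v1, h.c2]; nlinarith
  have p2 : p ≤ 0 := by rw [hp]; nlinarith
  have p3 : -0.007 ≤ p := by rw [hp]; nlinarith
  have hv : v ^ 2 ≤ 0.48046 + 1.35 * p := by
    rw [h.v, ← hp]; nlinarith
  have hk : 0 ≤ 1 + z - 0.675 * (z * (1 + z)) := by nlinarith
  have k1 := mul_le_mul_of_nonneg_right p1 hk
  have k2 := mul_le_mul_of_nonneg_left hv (by positivity : 0 ≤ z * (1 + z))
  have hvL : v = Real.log 2 + p := by rw [hp]; exact h.v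
  have k3 : 0.346 ≤ (-0.10635 + 0.288 * z) * (1 + z - 0.675 * (z * (1 + z))) + 0.69314
      - 0.24023 * (1 + z) := by nlinarith [mul_pos hz hz, mul_pos hz (mul_pos hz hz)]
  have k4 := mul_le_mul_of_nonneg_left k3 hz.le
  have k5 := mul_lt_mul_of_pos_left h1 hz
  have e : (1 + z) * (v - z * v ^ 2 / 2) = v + z * v - z * (1 + z) * v ^ 2 / 2 := by ring
  rw [e, hvL] 
  rw [hvL] at k2
  nlinarith

lemma IsShift.pow_brk_le {t : ℕ} {z σ v v1 v2 v3 c2 c3 c4 x : ℝ}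
    (h : IsShift (Real.log 2) z σ v v1 v2 v3 c2 c3 c4) (hz : 0 < z) (hz' : z ≤ 1 / 16)
    (hzt : t * z = 1) (hσ : |σ| ≤ 0.26) (hx : 0 < x) (hx1 : x * (1 + z * v) ≤ 1) :
    x ^ brk t 2 ≤ 0.7076 * (1 / 2 ^ t) := by
  obtain ⟨⟨b1, b2⟩, -, -⟩ := h.bounds hz hz' hσ
  have h0 : 0 ≤ x * (z * v) := mul_nonneg hx.le (mul_nonneg hz.le (by linarith))
  refine (pow_brk_two_le hz hzt hx (by linarith) (by linarith) hx1 (h.log_le hz hz' hσ)).trans ?_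
  have := exp_neg_346_le
  rw [← div_eq_mul_one_div]
  gcongr

lemma inv_two_pow_le {t : ℕ} (ht : 16 ≤ t) {z : ℝ} (hzt : t * z = 1) : 1 / 2 ^ t ≤ z ^ 4 := by
  have h : ((t ^ 4 : ℕ) : ℝ) ≤ ((2 ^ t : ℕ) : ℝ) := by exact_mod_cast pow_four_le_two_pow ht
  push_cast at h
  rw [div_le_iff₀ (by positivity)]
  calc (1 : ℝ) = (t * z) ^ 4 := by rw [hzt, one_pow]
    _ = z ^ 4 * t ^ 4 := by ring
    _ ≤ z ^ 4 * 2 ^ t := by gcongr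

/-- `1 / x` is the approximation to the second zero with error term `σ / t ^ 5`. -/
def IsShiftedInv (t : ℕ) (σ x : ℝ) : Prop :=
  ∃ v v1 v2 v3 c2 c3 c4, IsShift (Real.log 2) (1 / t) σ v v1 v2 v3 c2 c3 c4 ∧
    x = 1 / (1 + 1 / t * v)

lemma redDen_neg_of_isShiftedInv {t : ℕ} (ht : 16 ≤ t) {x : ℝ} (h : IsShiftedInv t 0.26 x) :
    redDen t x < 0 := by
  obtain ⟨v, v1, v2, v3, c2, c3, c4, h, rfl⟩ := h
  have ht' : (16 : ℝ) ≤ t := by exact_mod_cast ht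
  obtain ⟨z, hz⟩ : ∃ z : ℝ, z = 1 / t := ⟨_, rfl⟩
  rw [← hz] at h ⊢
  have z0 : 0 < z := by rw [hz]; positivity
  have z1 : z ≤ 1 / 16 := by rw [hz]; exact one_div_le_one_div_of_le (by norm_num) ht'
  have hzt : t * z = 1 := by rw [hz]; field_simp
  have hσ : |(0.26 : ℝ)| ≤ 0.26 := by rw [abs_of_pos] <;> norm_num
  obtain ⟨⟨b1, b2⟩, -, -⟩ := h.bounds z0 z1 hσ
  have hu0 : 0 < z * v := mul_pos z0 (by linarith)
  have hu1 : z * v ≤ 1 / 16 := by nlinarith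
  have hp := h.pow_brk_le z0 z1 hzt hσ (x := 1 / (1 + z * v)) (by positivity)
    (by rw [one_div_mul_cancel (by positivity)])
  have h2 := inv_two_pow_le ht hzt
  have z4 : z ^ 4 ≤ (1 / 16) ^ 4 := pow_le_pow_left₀ z0.le z1 4
  refine redDen_neg_of_logGap (by omega) hu0 (by linarith) ?_ ?_
  · norm_num at z4; linarith
  · have h3 := (abs_le.mp (abs_logGap_sub_le h z0 z1 hzt hσ)).1
    have h4 := phiFour_upper h z0 z1
    have h5 := mul_lt_mul_of_pos_left h4 (pow_pos z0 4)
    have := pow_pos z0 4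
    linarith

lemma redDen_pos_of_isShiftedInv {t : ℕ} (ht : 16 ≤ t) {x : ℝ} (h : IsShiftedInv t (-0.26) x) :
    0 < redDen t x := by
  obtain ⟨v, v1, v2, v3, c2, c3, c4, h, rfl⟩ := h
  have ht' : (16 : ℝ) ≤ t := by exact_mod_cast ht
  obtain ⟨z, hz⟩ : ∃ z : ℝ, z = 1 / t := ⟨_, rfl⟩
  rw [← hz] at h ⊢
  have z0 : 0 < z := by rw [hz]; positivity
  have z1 : z ≤ 1 / 16 := by rw [hz]; exact one_div_le_one_div_of_le (by norm_num) ht'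
  have hzt : t * z = 1 := by rw [hz]; field_simp
  have hσ : |(-0.26 : ℝ)| ≤ 0.26 := by rw [abs_of_neg] <;> norm_num
  obtain ⟨⟨b1, b2⟩, -, -⟩ := h.bounds z0 z1 hσ
  have hu0 : 0 < z * v := mul_pos z0 (by linarith)
  have hu1 : z * v ≤ 1 / 16 := by nlinarith
  have hx1 : 1 / (1 + z * v) < 1 := by rw [div_lt_one (by linarith)]; linarith
  have hp := h.pow_brk_le z0 z1 hzt hσ (x := 1 / (1 + z * v)) (by positivity)
    (by rw [one_div_mul_cancel (by positivity)])
  have h2 := inv_two_pow_le ht hzt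
  have z4 : z ^ 4 ≤ (1 / 16) ^ 4 := pow_le_pow_left₀ z0.le z1 4
  have z40 : 0 < z ^ 4 := pow_pos z0 4
  have hp' : (1 / (1 + z * v)) ^ brk t 2 ≤ 0.7076 * z ^ 4 := by
    linarith
  norm_num at z4
  have h3 := altSum_zero_re_le (by omega : 1 ≤ t) (by positivity) hx1 (i := 2) (by linarith)
  have h4 : (1 / (1 + z * v)) ^ brk t 2 / (1 - (1 / (1 + z * v)) ^ brk t 2) ≤ 0.72 * z ^ 4 := by
    rw [div_le_iff₀ (by linarith)]
    nlinarith
  -- The coefficient `-0.45` with error `0.001` leaves `0.44`, and `0.44 * (2 - u)` still exceeds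
  -- the tail constant `0.72`.
  refine redDen_pos_of_logGap (a := 0.44 * z ^ 4) hu0 (by linarith) (by positivity) ?_ ?_
  · have h3 := (abs_le.mp (abs_logGap_sub_le h z0 z1 hzt hσ)).2
    have h4 := phiFour_lower h z0 z1
    have h5 := mul_lt_mul_of_pos_left h4 (pow_pos z0 4)
    linarith
  · have h5 := mul_le_mul_of_nonneg_right (h3.trans h4) (by positivity : 0 ≤ 1 + 0.44 * z ^ 4)
    refine h5.trans_lt ?_
    nlinarith

lemma exists_isShiftedInv (t : ℕ) (σ : ℝ) : ∃ x, IsShiftedInv t σ x :=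
  ⟨_, _, _, _, _, _, _, _, ⟨rfl, rfl, rfl, rfl, rfl, rfl, rfl⟩, rfl⟩

lemma IsShiftedInv.inv_eq {t : ℕ} {σ x : ℝ} (h : IsShiftedInv t σ x) :
    1 / x = 1 + Real.log 2 / t - (Real.log 2 - Real.log 2 ^ 2) / (2 * (t : ℝ) ^ 2)
            + (4 * Real.log 2 ^ 3 + 3 * Real.log 2 ^ 2 + 6 * Real.log 2) / (24 * (t : ℝ) ^ 3)
            + (2 * Real.log 2 ^ 4 + 54 * Real.log 2 ^ 3 - 27 * Real.log 2 ^ 2 - 6 * Real.log 2)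
                / (48 * (t : ℝ) ^ 4) + σ / (t : ℝ) ^ 5 := by
  obtain ⟨v, v1, v2, v3, c2, c3, c4, ⟨rfl, rfl, rfl, rfl, rfl, rfl, rfl⟩, rfl⟩ := h
  rw [one_div_one_div]
  generalize Real.log 2 = L
  ring

lemma IsShiftedInv.mem_Ioo {t : ℕ} (ht : 16 ≤ t) {σ x : ℝ} (h : IsShiftedInv t σ x)
    (hσ : |σ| ≤ 0.26) : 0 < x ∧ x < 1 := by
  obtain ⟨v, v1, v2, v3, c2, c3, c4, h, rfl⟩ := h
  have ht' : (16 : ℝ) ≤ t := by exact_mod_cast ht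
  have z0 : (0 : ℝ) < 1 / t := by positivity
  obtain ⟨⟨b1, -⟩, -, -⟩ := h.bounds z0 (one_div_le_one_div_of_le (by norm_num) ht') hσ
  have : 0 < 1 / (t : ℝ) * v := mul_pos z0 (by linarith)
  exact ⟨by positivity, by rw [div_lt_one (by linarith)]; linarith⟩

/-- The intermediate value theorem applies between the approximations with `σ = 0.26` and `σ =
-0.26`. As `1 / x` is affine in `σ`, the zero itself is an approximation for some `σ` in between, so
all estimates for shifts apply to it. -/
lemma exists_second_zero {t : ℕ} (ht : 16 ≤ t) :
    ∃ β σ : ℝ, |σ| ≤ 0.26 ∧ IsShiftedInv t σ β ∧ redDen t β = 0 := by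
  obtain ⟨x, hx⟩ := exists_isShiftedInv t 0.26
  obtain ⟨y, hy⟩ := exists_isShiftedInv t (-0.26)
  have hx' := redDen_neg_of_isShiftedInv ht hx
  have hy' := redDen_pos_of_isShiftedInv ht hy
  have hxI := hx.mem_Ioo ht (by norm_num [abs_of_pos])
  have hyI := hy.mem_Ioo ht (by norm_num [abs_of_neg])
  have hxe := hx.inv_eq
  have hye := hy.inv_eq
  have t0 : (0 : ℝ) < t := by exact_mod_cast (by omega : 0 < t)
  have t5 : (0 : ℝ) < t ^ 5 := by positivity
  have hs : (0 : ℝ) < 0.26 / t ^ 5 := by positivity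
  rw [neg_div] at hye
  have hxy : x ≤ y := by
    rw [← one_div_le_one_div hyI.1 hxI.1]; linarith
  obtain ⟨β, ⟨h1, h2⟩, h0⟩ := intermediate_value_Icc hxy
    (continuousOn_redDen (by omega) hxI.1.le hyI.2) ⟨hx'.le, hy'.le⟩
  have hβ : 0 < β := hxI.1.trans_le h1
  have e1 := one_div_le_one_div_of_le hxI.1 h1
  have e2 := one_div_le_one_div_of_le hβ h2
  obtain ⟨σ, hσ⟩ : ∃ σ, σ = (1 / β - (1 / x - 0.26 / t ^ 5)) * t ^ 5 := ⟨_, rfl⟩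
  have hσ' : σ / t ^ 5 = 1 / β - (1 / x - 0.26 / t ^ 5) := by
    rw [hσ, mul_div_cancel_right₀ _ t5.ne']
  obtain ⟨w, hw⟩ := exists_isShiftedInv t σ
  have hwe := hw.inv_eq
  have : w = β := by
    have : 1 / w = 1 / β := by linarith
    simpa using this
  refine ⟨β, σ, ?_, this ▸ hw, h0⟩
  rw [abs_le]
  constructor
  · rw [← div_le_div_iff_of_pos_right t5, neg_div]; linarith
  · rw [← div_le_div_iff_of_pos_right t5]; linarith

/-! ### The dominant zero for `t ≥ 16` -/

/-- Bonferroni inequalities, by induction: multiplication by `1 - a` leaves a surplus with a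
nonnegative binomial coefficient. -/
lemma one_sub_pow_bounds {a : ℝ} (h0 : 0 ≤ a) (h1 : a ≤ 1) (n : ℕ) :
    (1 - a) ^ n ≤ 1 - n * a + n * (n - 1) / 2 * a ^ 2 ∧
    1 - n * a + n * (n - 1) / 2 * a ^ 2 - n * (n - 1) * (n - 2) / 6 * a ^ 3 ≤ (1 - a) ^ n := by
  induction n with
  | zero => simp
  | succ n ih =>
    have hC : (0 : ℝ) ≤ n * (n - 1) / 2 := by
      rcases n with _ | n
      · simp
      · push_cast; rw [add_sub_cancel_right]; positivity
    have hD : (0 : ℝ) ≤ n * (n - 1) * (n - 2) / 6 := by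
      rcases n with _ | _ | n
      · simp
      · simp
      · push_cast
        have : (n : ℝ) + 1 + 1 - 2 = n := by ring
        rw [add_sub_cancel_right, this]; positivity
    have h2 : 0 ≤ 1 - a := by linarith
    have e1 := mul_le_mul_of_nonneg_right ih.1 h2
    have e2 := mul_le_mul_of_nonneg_right ih.2 h2
    have e3 := mul_nonneg hC (pow_nonneg h0 3)
    have e4 := mul_nonneg hD (pow_nonneg h0 4)
    rw [pow_succ (1 - a)]
    push_cast
    constructor
    · refine e1.trans (le_of_sub_nonneg ?_)
      refine e3.trans (le_of_eq ?_)
      ring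
    · refine (le_of_sub_nonneg ?_ : _ ≤ _).trans e2
      refine e4.trans (le_of_eq ?_)
      ring

/-- The dominant zero is sought among the numbers `1 / (2 - y * d)` where `y = 2 ^ (-t - 1)`,
`s = t * y` and `z = 1 / t`. -/
structure IsDominantShift (z s d d1 d2 d3 : ℝ) : Prop where
  d : d = 1 + s * d1
  d1 : d1 = (1 + 3 * z) / 2 + s * d2
  d2 : d2 = (3 + 19 * z + 24 * z ^ 2) / 8 + s * d3

lemma IsDominantShift.bounds {z s d d1 d2 d3 : ℝ} (h : IsDominantShift z s d d1 d2 d3) (hz : 0 ≤ z)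
    (hz' : z ≤ 1 / 16) (hs : 0 ≤ s) (hs' : s ≤ 1 / 8192) (h3 : 0 ≤ d3) (h3' : d3 ≤ 1) :
    (1 ≤ d ∧ d ≤ 1.0001) ∧ (0.5 ≤ d1 ∧ d1 ≤ 0.595) ∧ (0.375 ≤ d2 ∧ d2 ≤ 0.536) := by
  have b2 : 0.375 ≤ d2 ∧ d2 ≤ 0.536 := by rw [h.d2]; constructor <;> nlinarith
  have b1 : 0.5 ≤ d1 ∧ d1 ≤ 0.595 := by rw [h.d1]; constructor <;> nlinarith
  refine ⟨?_, b1, b2⟩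
  rw [h.d]; constructor <;> nlinarith

/-- The constant terms of `d`, `d1`, `d2` cancel the orders `1`, `s` and `s ^ 2`, so the remainder
starts with `s ^ 3` and contains `d3` with coefficient one. -/
lemma IsDominantShift.expansion {z s d d1 d2 d3 : ℝ} (h : IsDominantShift z s d d1 d2 d3) :
    d * (1 - (1 + z) * s * d / 2 + (1 + z) * s ^ 2 * d ^ 2 / 8 - s * z) - 1 =
      s ^ 3 * (d3 - (1 + 2 * z) * d2 - (1 + z) * d1 ^ 2 / 2
        + (1 + z) * d1 * (d ^ 2 + d + 1) / 8) := by
  have h1 : d1 - (1 + z) * d ^ 2 / 2 - z * d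
      = s * (d2 - (1 + z) * (2 * d1 + s * d1 ^ 2) / 2 - z * d1) := by
    rw [h.d]; linear_combination h.d1
  have h2 : d2 - (1 + z) * (2 * d1 + s * d1 ^ 2) / 2 - z * d1 + (1 + z) * d ^ 3 / 8
      = s * (d3 - (1 + 2 * z) * d2 - (1 + z) * d1 ^ 2 / 2
        + (1 + z) * d1 * (d ^ 2 + d + 1) / 8) := by
    linear_combination h.d2 - (1 + 2 * z) * h.d1 + (1 + z) * (d ^ 2 + d + 1) / 8 * h.d
  linear_combination h.d + s * h1 + s ^ 2 * h2

/-- Apart from `d3` the coefficient of `s ^ 3` lies in `[-0.7, -0.2]`. Hence `d3 = 0` and `d3 = 1`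
give opposite signs, even after the truncation error `0.1` and the tail. -/
lemma IsDominantShift.rest_bounds {z s d d1 d2 d3 : ℝ} (h : IsDominantShift z s d d1 d2 d3)
    (hz : 0 ≤ z) (hz' : z ≤ 1 / 16) (hs : 0 ≤ s) (hs' : s ≤ 1 / 8192) (h3 : 0 ≤ d3)
    (h3' : d3 ≤ 1) :
    -(1 + 2 * z) * d2 - (1 + z) * d1 ^ 2 / 2 + (1 + z) * d1 * (d ^ 2 + d + 1) / 8 ≤ -0.2 ∧
    -0.7 ≤ -(1 + 2 * z) * d2 - (1 + z) * d1 ^ 2 / 2 + (1 + z) * d1 * (d ^ 2 + d + 1) / 8 ∧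
    (1 + z) * (1 - z) * d ^ 4 / 48 ≤ 0.1 := by
  obtain ⟨⟨b1, b2⟩, ⟨b3, b4⟩, b5, b6⟩ := h.bounds hz hz' hs hs' h3 h3'
  obtain ⟨k, hk⟩ : ∃ k, k = (d ^ 2 + d + 1) / 8 := ⟨_, rfl⟩
  have k1 : 0.375 ≤ k := by rw [hk]; nlinarith
  have k2 : k ≤ 0.376 := by rw [hk]; nlinarith
  obtain ⟨m, hm⟩ : ∃ m, m = d1 * (k - d1 / 2) := ⟨_, rfl⟩
  have m1 : m ≤ 0.08 := by
    rw [hm]; calc d1 * (k - d1 / 2) ≤ d1 * 0.126 := by gcongr; linarith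
      _ ≤ _ := by linarith
  have m2 : 0 ≤ m := by rw [hm]; exact mul_nonneg (by linarith) (by linarith)
  have e : -(1 + 2 * z) * d2 - (1 + z) * d1 ^ 2 / 2 + (1 + z) * d1 * (d ^ 2 + d + 1) / 8
      = -(1 + 2 * z) * d2 + (1 + z) * m := by rw [hm, hk]; ring
  rw [e]
  have d4 : d ^ 4 ≤ 1.0001 ^ 4 := pow_le_pow_left₀ (by linarith) b2 4
  have d40 : 0 ≤ d ^ 4 := by positivity
  norm_num at d4
  have zm := mul_le_mul hz' m1 m2 (by norm_num)
  have zm0 := mul_nonneg hz m2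
  have zd := mul_le_mul hz' b6 (by linarith) (by norm_num)
  have zd0 := mul_nonneg hz (by linarith : 0 ≤ d2)
  have zz := mul_nonneg (mul_nonneg hz hz) d40
  refine ⟨?_, ?_, ?_⟩ <;> linarith

lemma redDen_mul_pow' {t : ℕ} {y d : ℝ} (hy : y = 1 / 2 ^ (t + 1)) (hd : y * d < 2) :
    redDen t (1 / (2 - y * d)) * (2 - y * d) ^ (t + 2) =
      1 - (altSum t 0 2 ((1 / (2 - y * d) : ℝ) : ℂ)).re -
        d * ((1 - y * d / 2) ^ (t + 1) - y) := by
  have h : 2 - y * d ≠ 0 := by linarith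
  have e : (2 - y * d) ^ (t + 1) * y = (1 - y * d / 2) ^ (t + 1) := by
    rw [hy, one_div, ← inv_pow, ← mul_pow]; congr 1; ring
  rw [← e, redDen]
  generalize (altSum t 0 2 ((1 / (2 - y * d) : ℝ) : ℂ)).re = w
  rw [div_pow, div_pow, one_pow, one_pow, pow_succ (2 - y * d) (t + 1)]
  field_simp
  ring

/-- `x` is the approximation to the dominant zero with error parameter `c`. -/
def IsDominantApprox (t : ℕ) (c x : ℝ) : Prop :=
  ∃ d d1 d2, IsDominantShift (1 / t) (t / 2 ^ (t + 1)) d d1 d2 c ∧ x = 1 / (2 - 1 / 2 ^ (t + 1) * d)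

lemma half_pow_bounds {t : ℕ} (ht : 16 ≤ t) {y : ℝ} (hy : y = 1 / 2 ^ (t + 1)) :
    0 < y ∧ y ≤ 1 / 131072 ∧ t * y ≤ 1 / 8192 := by
  have h1 : ((t ^ 4 : ℕ) : ℝ) ≤ ((2 ^ t : ℕ) : ℝ) := by exact_mod_cast pow_four_le_two_pow ht
  push_cast at h1
  have ht' : (16 : ℝ) ≤ t := by exact_mod_cast ht
  have h2 : (16 : ℝ) ^ 3 * t ≤ t ^ 4 := by
    rw [pow_succ (t : ℝ) 3]; gcongr
  have h3 : (2 : ℝ) ^ t * 2 * y = 1 := by rw [hy, pow_succ]; field_simp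
  have hy0 : 0 < y := by rw [hy]; positivity
  refine ⟨hy0, ?_, ?_⟩ <;> nlinarith

/-- Bernoulli's inequality gives `x ^ (t + 1) ≤ 2 * y`, and `brk t 2 ≥ 16 * (t + 1)`. -/
lemma pow_brk_two_le_pow {t : ℕ} (ht : 16 ≤ t) {y d x : ℝ} (hy : y = 1 / 2 ^ (t + 1)) (hd : 0 ≤ d)
    (hd' : d ≤ 2) (hx : x = 1 / (2 - y * d)) : x ^ brk t 2 ≤ (2 * y) ^ 16 := by
  obtain ⟨y0, y1, y2⟩ := half_pow_bounds ht hy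
  have hyd : y * d ≤ 2 * y := by nlinarith
  have hyd0 : 0 ≤ y * d := by positivity
  have hx0 : 0 ≤ x := by rw [hx]; exact div_nonneg zero_le_one (by linarith)
  have hx1 : x ≤ 1 := by rw [hx, div_le_one (by linarith)]; linarith
  have hb := one_add_mul_le_pow (a := -(y * d / 2)) (by linarith) (t + 1)
  have hn : x ^ (t + 1) ≤ 2 * y := by
    have e : x ^ (t + 1) * (1 + -(y * d / 2)) ^ (t + 1) = y := by
      have : 2 - y * d ≠ 0 := by linarith
      have e2 : x * (1 + -(y * d / 2)) = 1 / 2 := by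
        rw [hx]; field_simp; ring
      rw [← mul_pow, e2, hy, div_pow, one_pow]
    have h2 : 1 / 2 ≤ (1 + -(y * d / 2)) ^ (t + 1) := by
      refine le_trans ?_ hb
      push_cast
      nlinarith
    have := mul_le_mul_of_nonneg_left h2 (pow_nonneg hx0 (t + 1))
    linarith
  calc x ^ brk t 2 ≤ x ^ ((t + 1) * 16) :=
        pow_le_pow_of_le_one hx0 hx1 (by rw [brk_two]; nlinarith)
    _ = (x ^ (t + 1)) ^ 16 := pow_mul _ _ _
    _ ≤ (2 * y) ^ 16 := pow_le_pow_left₀ (pow_nonneg hx0 _) hn 16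

lemma two_mul_pow_le {y : ℝ} (hy : 0 < y) (hy' : y ≤ 1 / 131072) :
    (2 * y) ^ 16 ≤ y ^ 8 / 10 ^ 20 := by
  have h : y ^ 8 ≤ (1 / 131072) ^ 8 := pow_le_pow_left₀ hy.le hy' 8
  have h8 : 0 ≤ y ^ 8 := by positivity
  have := mul_le_mul_of_nonneg_left h h8
  calc (2 * y) ^ 16 = 65536 * (y ^ 8 * y ^ 8) := by ring
    _ ≤ 65536 * (y ^ 8 * (1 / 131072) ^ 8) := by gcongr
    _ ≤ _ := by nlinarith

lemma dominant_pow_bounds {t : ℕ} {s z y d : ℝ} (hzt : t * z = 1) (hyz : y = s * z)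
    (h0 : 0 ≤ y * d) (h1 : y * d ≤ 2) (hd : 0 ≤ d) :
    d * ((1 - y * d / 2) ^ (t + 1) - y) ≤
      d * (1 - (1 + z) * s * d / 2 + (1 + z) * s ^ 2 * d ^ 2 / 8 - s * z) ∧
    d * (1 - (1 + z) * s * d / 2 + (1 + z) * s ^ 2 * d ^ 2 / 8 - s * z) -
      s ^ 3 * ((1 + z) * (1 - z) * d ^ 4 / 48) ≤ d * ((1 - y * d / 2) ^ (t + 1) - y) := by
  have hpw := one_sub_pow_bounds (a := y * d / 2) (by linarith) (by linarith) (t + 1)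
  have c1 : ((t + 1 : ℕ) : ℝ) * (y * d / 2) = (1 + z) * s * d / 2 := by
    rw [hyz]; push_cast; linear_combination (s * d / 2) * hzt
  have c2 : ((t + 1 : ℕ) : ℝ) * ((t + 1 : ℕ) - 1) / 2 * (y * d / 2) ^ 2 =
      (1 + z) * s ^ 2 * d ^ 2 / 8 := by
    rw [hyz]; push_cast
    linear_combination (s ^ 2 * d ^ 2 / 8) * (t * z + 1 + z) * hzt
  have c3 : ((t + 1 : ℕ) : ℝ) * ((t + 1 : ℕ) - 1) * ((t + 1 : ℕ) - 2) / 6 * (y * d / 2) ^ 3 =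
      (1 + z) * (1 - z) * s ^ 3 * d ^ 3 / 48 := by
    rw [hyz]; push_cast
    linear_combination (s ^ 3 * d ^ 3 / 48) * (t ^ 2 * z ^ 2 + t * z + 1 - z ^ 2) * hzt
  rw [c1, c2, c3] at hpw
  constructor
  · refine mul_le_mul_of_nonneg_left ?_ hd
    linarith [hpw.1]
  · have := mul_le_mul_of_nonneg_left hpw.2 hd
    have e : d * y = d * (s * z) := by rw [hyz]
    linarith

/-- The parameters of an approximation to the dominant zero. -/
structure DominantData (t : ℕ) (z s y d d1 d2 c x : ℝ) : Prop where
  shift : IsDominantShift z s d d1 d2 c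
  z_pos : 0 < z
  z_le : z ≤ 1 / 16
  tz : t * z = 1
  y_eq : y = 1 / 2 ^ (t + 1)
  s_eq : s = t * y
  yz : y = s * z
  y_pos : 0 < y
  y_le : y ≤ 1 / 131072
  s_pos : 0 < s
  s_le : s ≤ 1 / 8192
  d_bd : 1 ≤ d ∧ d ≤ 1.0001
  x_eq : x = 1 / (2 - y * d)

lemma IsDominantApprox.exists_data {t : ℕ} (ht : 16 ≤ t) {c x : ℝ} (h : IsDominantApprox t c x)
    (hc : 0 ≤ c) (hc' : c ≤ 1) : ∃ z s y d d1 d2, DominantData t z s y d d1 d2 c x := by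
  obtain ⟨d, d1, d2, h, hx⟩ := h
  have ht' : (16 : ℝ) ≤ t := by exact_mod_cast ht
  obtain ⟨y, hy⟩ : ∃ y : ℝ, y = 1 / 2 ^ (t + 1) := ⟨_, rfl⟩
  obtain ⟨z, hz⟩ : ∃ z : ℝ, z = 1 / t := ⟨_, rfl⟩
  obtain ⟨s, hs⟩ : ∃ s : ℝ, s = t * y := ⟨_, rfl⟩
  rw [show (t : ℝ) / 2 ^ (t + 1) = s by rw [hs, hy]; ring, ← hz] at h
  rw [← hy] at hx
  have z0 : 0 < z := by rw [hz]; positivity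
  have z1 : z ≤ 1 / 16 := by rw [hz]; exact one_div_le_one_div_of_le (by norm_num) ht'
  have hzt : t * z = 1 := by rw [hz]; field_simp
  obtain ⟨y0, y1, y2⟩ := half_pow_bounds ht hy
  rw [← hs] at y2
  have s0 : 0 < s := by rw [hs]; positivity
  exact ⟨z, s, y, d, d1, d2, h, z0, z1, hzt, hy, hs, by rw [hs]; linear_combination -y * hzt, y0,
    y1, s0, y2, (h.bounds z0.le z1 s0.le y2 hc hc').1, hx⟩

lemma DominantData.yd {t : ℕ} {z s y d d1 d2 c x : ℝ} (h : DominantData t z s y d d1 d2 c x) :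
    0 < y * d ∧ y * d ≤ 2 * y := by
  have := h.d_bd
  have := h.y_pos
  constructor
  · exact mul_pos h.y_pos (by linarith)
  · nlinarith

lemma DominantData.x_bounds {t : ℕ} {z s y d d1 d2 c x : ℝ} (h : DominantData t z s y d d1 d2 c x) :
    1 / 2 < x ∧ x ≤ 0.50001 := by
  have := h.yd
  have := h.y_le
  rw [h.x_eq]
  constructor
  · rw [div_lt_div_iff₀ (by norm_num) (by linarith)]; linarith
  · rw [div_le_iff₀ (by linarith)]; linarith

lemma DominantData.pow_brk_le {t : ℕ} (ht : 16 ≤ t) {z s y d d1 d2 c x : ℝ}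
    (h : DominantData t z s y d d1 d2 c x) : x ^ brk t 2 ≤ y ^ 8 / 10 ^ 20 := by
  have := h.d_bd
  exact (pow_brk_two_le_pow ht h.y_eq (by linarith) (by linarith) h.x_eq).trans
    (two_mul_pow_le h.y_pos h.y_le)

lemma DominantData.pow_brk_le' {t : ℕ} (ht : 16 ≤ t) {z s y d d1 d2 c x : ℝ}
    (h : DominantData t z s y d d1 d2 c x) : x ^ brk t 2 ≤ y * s ^ 4 / 10 ^ 20 := by
  refine (h.pow_brk_le ht).trans ?_
  have hy0 := h.y_pos
  have hys : y ≤ s := by rw [h.yz]; nlinarith [h.s_pos, h.z_le]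
  have e1 : y ^ 8 ≤ y ^ 5 := pow_le_pow_of_le_one hy0.le (by linarith [h.y_le]) (by norm_num)
  have e2 : y ^ 4 ≤ s ^ 4 := pow_le_pow_left₀ hy0.le hys 4
  have e3 := mul_le_mul_of_nonneg_left e2 hy0.le
  rw [div_le_div_iff_of_pos_right (by norm_num)]
  calc y ^ 8 ≤ y * y ^ 4 := e1.trans (le_of_eq (by ring))
    _ ≤ _ := e3

lemma DominantData.omega_bounds {t : ℕ} (ht : 16 ≤ t) {z s y d d1 d2 c x : ℝ}
    (h : DominantData t z s y d d1 d2 c x) :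
    0 ≤ (altSum t 0 2 (x : ℂ)).re ∧ (altSum t 0 2 (x : ℂ)).re ≤ s ^ 4 / 1000 := by
  have hp := h.pow_brk_le' ht
  obtain ⟨x0, x1⟩ := h.x_bounds
  have hs0 := pow_pos h.s_pos 4
  have hs1 : s ^ 4 ≤ 1 := pow_le_one₀ h.s_pos.le (by linarith [h.s_le])
  have hys : y * s ^ 4 / 10 ^ 20 ≤ s ^ 4 / 2000 := by
    rw [div_le_div_iff₀ (by norm_num) (by norm_num)]
    have := mul_le_mul_of_nonneg_right h.y_le hs0.le
    linarith
  have hw1 := altSum_zero_re_le (by omega : 1 ≤ t) (by linarith) (by linarith : x < 1) (i := 2)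
    (by linarith)
  refine ⟨altSum_zero_re_nonneg (by omega) (by linarith) (by linarith) (by linarith), hw1.trans ?_⟩
  rw [div_le_iff₀ (by linarith)]
  have := mul_le_mul_of_nonneg_left (by linarith : x ^ brk t 2 ≤ 1 / 2)
    (by positivity : 0 ≤ s ^ 4 / 1000)
  linarith

lemma redDen_pos_of_isDominantApprox {t : ℕ} (ht : 16 ≤ t) {x : ℝ} (h : IsDominantApprox t 0 x) :
    0 < redDen t x := by
  obtain ⟨z, s, y, d, d1, d2, h⟩ := h.exists_data ht le_rfl zero_le_one
  obtain ⟨w0, w1⟩ := h.omega_bounds ht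
  obtain ⟨r1, -, -⟩ := h.shift.rest_bounds h.z_pos.le h.z_le h.s_pos.le h.s_le le_rfl zero_le_one
  obtain ⟨e1, -⟩ := dominant_pow_bounds h.tz h.yz h.yd.1.le (by linarith [h.yd.2, h.y_le])
    (by linarith [h.d_bd.1])
  have hex := h.shift.expansion
  have he := redDen_mul_pow' h.y_eq (d := d) (by linarith [h.yd.2, h.y_le])
  rw [← h.x_eq] at he
  have s3 := pow_pos h.s_pos 3
  have s4 : s ^ 4 ≤ s ^ 3 := pow_le_pow_of_le_one h.s_pos.le (by linarith [h.s_le]) (by norm_num)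
  have := mul_le_mul_of_nonneg_left r1 s3.le
  refine pos_of_mul_pos_left (b := (2 - y * d) ^ (t + 2)) ?_
    (pow_pos (by linarith [h.yd.2, h.y_le]) _).le
  rw [he]
  linarith

lemma redDen_neg_of_isDominantApprox {t : ℕ} (ht : 16 ≤ t) {x : ℝ} (h : IsDominantApprox t 1 x) :
    redDen t x < 0 := by
  obtain ⟨z, s, y, d, d1, d2, h⟩ := h.exists_data ht zero_le_one le_rfl
  obtain ⟨w0, w1⟩ := h.omega_bounds ht
  obtain ⟨-, r1, r2⟩ := h.shift.rest_bounds h.z_pos.le h.z_le h.s_pos.le h.s_le zero_le_one le_rfl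
  obtain ⟨-, e1⟩ := dominant_pow_bounds h.tz h.yz h.yd.1.le (by linarith [h.yd.2, h.y_le])
    (by linarith [h.d_bd.1])
  have hex := h.shift.expansion
  have he := redDen_mul_pow' h.y_eq (d := d) (by linarith [h.yd.2, h.y_le])
  rw [← h.x_eq] at he
  have s3 := pow_pos h.s_pos 3
  have f1 := mul_le_mul_of_nonneg_left r1 s3.le
  have f2 := mul_le_mul_of_nonneg_left r2 s3.le
  refine neg_of_mul_neg_left (b := (2 - y * d) ^ (t + 2)) ?_
    (pow_pos (by linarith [h.yd.2, h.y_le]) _).le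
  rw [he]
  linarith

lemma exists_isDominantApprox (t : ℕ) (c : ℝ) : ∃ x, IsDominantApprox t c x :=
  ⟨_, _, _, _, ⟨rfl, rfl, rfl⟩, rfl⟩

lemma IsDominantApprox.inv_eq {t : ℕ} {c x : ℝ} (h : IsDominantApprox t c x) :
    1 / x = 2 - 1 / 2 ^ (t + 1) * (1 + t / 2 ^ (t + 1) * ((1 + 3 * (1 / t)) / 2 +
      t / 2 ^ (t + 1) * ((3 + 19 * (1 / t) + 24 * (1 / t) ^ 2) / 8)))
        - t ^ 3 / (2 ^ (t + 1)) ^ 4 * c := by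
  obtain ⟨d, d1, d2, ⟨rfl, rfl, rfl⟩, rfl⟩ := h
  rw [one_div_one_div]
  ring

/-- As for the second zero, `1 / x` is affine in the free coefficient `c`, so the zero found between
`c = 0` and `c = 1` is itself of the approximating form. -/
lemma exists_first_zero {t : ℕ} (ht : 16 ≤ t) :
    ∃ α c : ℝ, 0 ≤ c ∧ c ≤ 1 ∧ IsDominantApprox t c α ∧ redDen t α = 0 := by
  obtain ⟨x, hx⟩ := exists_isDominantApprox t 0
  obtain ⟨y, hy⟩ := exists_isDominantApprox t 1
  have hx' := redDen_pos_of_isDominantApprox ht hx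
  have hy' := redDen_neg_of_isDominantApprox ht hy
  obtain ⟨x1, x2⟩ : 1 / 2 < x ∧ x ≤ 0.50001 := by
    obtain ⟨_, _, _, _, _, _, h⟩ := hx.exists_data ht le_rfl zero_le_one
    exact h.x_bounds
  obtain ⟨y1, y2⟩ : 1 / 2 < y ∧ y ≤ 0.50001 := by
    obtain ⟨_, _, _, _, _, _, h⟩ := hy.exists_data ht zero_le_one le_rfl
    exact h.x_bounds
  have hxe := hx.inv_eq
  have hye := hy.inv_eq
  have t0 : (0 : ℝ) < t := by exact_mod_cast (by omega : 0 < t)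
  obtain ⟨k, hk⟩ : ∃ k : ℝ, k = t ^ 3 / (2 ^ (t + 1)) ^ 4 := ⟨_, rfl⟩
  have k0 : 0 < k := by rw [hk]; positivity
  rw [← hk] at hxe hye
  have hxy : x ≤ y := by
    rw [← one_div_le_one_div (by linarith) (by linarith)]; linarith
  obtain ⟨α, ⟨h1, h2⟩, h0⟩ := intermediate_value_Icc' hxy
    (continuousOn_redDen (by omega) (by linarith) (by linarith)) ⟨hy'.le, hx'.le⟩
  have hα : 0 < α := by linarith
  have e1 := one_div_le_one_div_of_le (by linarith) h1
  have e2 := one_div_le_one_div_of_le hα h2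
  obtain ⟨c, hc⟩ : ∃ c, c = (1 / x - 1 / α) / k := ⟨_, rfl⟩
  have hc' : k * c = 1 / x - 1 / α := by rw [hc, mul_div_cancel₀ _ k0.ne']
  obtain ⟨w, hw⟩ := exists_isDominantApprox t c
  have hwe := hw.inv_eq
  rw [← hk] at hwe
  have : w = α := by
    have : 1 / w = 1 / α := by linarith
    simpa using this
  refine ⟨α, c, ?_, ?_, this ▸ hw, h0⟩
  · rw [hc]; exact div_nonneg (by linarith) k0.le
  · rw [hc, div_le_one k0]; linarith

lemma IsDominantApprox.abs_sub_le {t : ℕ} {c x : ℝ} (ht : 16 ≤ t) (h : IsDominantApprox t c x)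
    (hc : 0 ≤ c) (hc' : c ≤ 1) :
    |1 / x - (2 - 1 / 2 ^ (t + 1) - ((t : ℝ) + 3) / 2 ^ (2 * t + 3)
      - (3 * (t : ℝ) ^ 2 + 19 * t + 24) / 2 ^ (3 * t + 6))| ≤ 0.28 * (t : ℝ) ^ 3 / 2 ^ (4 * t) := by
  have t0 : (t : ℝ) ≠ 0 := by exact_mod_cast (by omega : t ≠ 0)
  rw [h.inv_eq]
  -- The error is exactly `c / 16` times `t ^ 3 / 2 ^ (4 * t)`, well below the factor `0.28`.
  have e : (2 - 1 / 2 ^ (t + 1) * (1 + t / 2 ^ (t + 1) * ((1 + 3 * (1 / t)) / 2 +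
      t / 2 ^ (t + 1) * ((3 + 19 * (1 / t) + 24 * (1 / t) ^ 2) / 8)))
        - t ^ 3 / (2 ^ (t + 1)) ^ 4 * c : ℝ) - (2 - 1 / 2 ^ (t + 1) - ((t : ℝ) + 3) / 2 ^ (2 * t + 3)
      - (3 * (t : ℝ) ^ 2 + 19 * t + 24) / 2 ^ (3 * t + 6)) = -(t ^ 3 / 2 ^ (4 * t) * (c / 16)) := by
    have p2 : (2 : ℝ) ^ (2 * t + 3) = (2 ^ t) ^ 2 * 8 := by rw [pow_add, mul_comm 2 t, pow_mul]; norm_num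
    have p3 : (2 : ℝ) ^ (3 * t + 6) = (2 ^ t) ^ 3 * 64 := by rw [pow_add, mul_comm 3 t, pow_mul]; norm_num
    have p4 : (2 : ℝ) ^ (4 * t) = (2 ^ t) ^ 4 := by rw [mul_comm 4 t, pow_mul]
    rw [p2, p3, p4, pow_succ]
    field_simp
    ring
  rw [e, abs_neg, abs_of_nonneg (by positivity), mul_div_right_comm]
  have hk : (0 : ℝ) ≤ t ^ 3 / 2 ^ (4 * t) := by positivity
  have : 0.28 / 2 ^ (4 * t) * (t : ℝ) ^ 3 = t ^ 3 / 2 ^ (4 * t) * 0.28 := by ring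
  rw [this]
  exact mul_le_mul_of_nonneg_left (by linarith) hk

/-! ### Residues for `t ≥ 16` -/

/-- Cauchy's estimate with radius `x / e`: enlarging `x` by the factor `1 + 1 / e` multiplies `x ^
e` by at most `exp 1 < 2.72`, and `8.16 = 3 * 2.72`. -/
lemma norm_deriv_altSum_two_le {t : ℕ} (ht : 1 ≤ t) (b : ℕ) {x e : ℝ} (he : e = brk t 2)
    (hx0 : 0 < x) (hx : x * (1 + 1 / e) < 1) (hp : x ^ brk t 2 ≤ 1 / 9) {q : ℂ} (hq : ‖q‖ ≤ x) :
    ‖deriv (altSum t b 2) q‖ ≤ 8.16 * (e * x ^ brk t 2) / x := by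
  have e0 : 0 < e := by rw [he]; exact_mod_cast brk_pos ht 2
  have h1 : (1 + 1 / e) ^ brk t 2 ≤ 2.72 := by
    have h2 : (1 + 1 / e) ^ brk t 2 ≤ Real.exp (1 / e) ^ brk t 2 :=
      pow_le_pow_left₀ (by positivity) (by linarith [Real.add_one_le_exp (1 / e)]) _
    rw [← Real.exp_nat_mul, ← he, mul_one_div_cancel e0.ne'] at h2
    have := Real.exp_one_lt_d9
    exact h2.trans (by norm_num at this ⊢; linarith)
  have hpw : (x * (1 + 1 / e)) ^ brk t 2 ≤ 2.72 * x ^ brk t 2 := by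
    rw [mul_pow, mul_comm]; gcongr
  have hs : x < x * (1 + 1 / e) := by
    have : 0 < x * (1 / e) := by positivity
    linarith
  refine (norm_deriv_altSum_le ht hx hs hq b 2 (by norm_num at hpw ⊢; linarith)).trans ?_
  have hd : x * (1 + 1 / e) - x = x / e := by ring
  rw [hd, div_div_eq_mul_div]
  refine div_le_div_of_nonneg_right ?_ hx0.le
  nlinarith

lemma hasDerivAt_clearedDen_two {t : ℕ} (ht : 1 ≤ t) {q : ℂ} (hq : ‖q‖ < 1) :
    HasDerivAt (clearedDen t 2) (-2 * (1 - q ^ (t + 1)) + (1 - 2 * q) * -((t + 1) * q ^ t)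
      + ((t + 2) * q ^ (t + 1) * (1 - altSum t 0 2 q)
        + q ^ (t + 2) * -deriv (altSum t 0 2) q)) q := by
  have hw := (differentiableAt_altSum ht 0 2 hq).hasDerivAt
  have h1 : HasDerivAt (fun q : ℂ => 1 - 2 * q) (-2) q := by
    simpa using ((hasDerivAt_id q).const_mul 2).const_sub 1
  have h2 : HasDerivAt (fun q : ℂ => 1 - q ^ (t + 1)) (-((t + 1) * q ^ t)) q := by
    simpa using (hasDerivAt_pow (t + 1) q).const_sub 1
  have h3 : HasDerivAt (fun q : ℂ => q ^ (t + 2)) ((t + 2) * q ^ (t + 1)) q := by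
    have := hasDerivAt_pow (t + 2) q
    simpa using this
  have h := (h1.mul h2).add (h3.mul (hw.const_sub 1))
  refine h.congr_of_eventuallyEq ?_
  filter_upwards [(continuous_norm.tendsto q).eventually_lt_const hq] with p hp
  simp [clearedDen_two ht hp]

/-- Numerator and denominator of the residue at a real zero `1 / (2 - δ)`. -/
noncomputable def resNum (δ w S : ℝ) : ℝ :=
  (1 - w) * (1 - w + δ) * (1 - 3 * δ + δ ^ 2) + (2 - δ) * δ ^ 2 - (2 - δ) * δ * (1 - w + δ) * S

noncomputable def resDen (t : ℕ) (δ w w' : ℝ) : ℝ :=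
  (2 - δ) ^ 2 * (1 - w + δ) * (2 * (1 - w) - (t + 1) * δ ^ 2 - (t + 2) * δ * (1 - w))
    + (2 - δ) * δ * (1 - w + δ) * w'

lemma isDenZero_of_redDen {t : ℕ} (ht : 1 ≤ t) {x δ w w' S : ℝ} (hx0 : 0 < x) (hx : x < 1)
    (h0 : redDen t x = 0) (hδ : x = 1 / (2 - δ)) (hw : w = (altSum t 0 2 (x : ℂ)).re)
    (hw' : w' = (deriv (altSum t 0 2) (x : ℂ)).re) (hS : S = (altSum t 1 2 (x : ℂ)).re)
    (hne : resDen t δ w w' ≠ 0) : IsDenZero t x (resNum δ w S / resDen t δ w w') := by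
  have hq : ‖(x : ℂ)‖ < 1 := by rwa [Complex.norm_real, Real.norm_of_nonneg hx0.le]
  have hd := hasDerivAt_clearedDen_two ht hq
  set f' := -2 * (1 - (x : ℂ) ^ (t + 1)) + (1 - 2 * (x : ℂ)) * -((t + 1) * (x : ℂ) ^ t)
      + ((t + 2) * (x : ℂ) ^ (t + 1) * (1 - altSum t 0 2 x)
        + (x : ℂ) ^ (t + 2) * -deriv (altSum t 0 2) x) with hf'
  have hδ0 : 2 - δ ≠ 0 := by
    intro h; rw [h, div_zero] at hδ; linarith
  -- At a zero the equation determines `x ^ (t + 1)` as `δ / (1 - w + δ)`. Substituting this removes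
  -- all powers with exponent `t`, and residues become rational in `δ`, `w`, `w'`, `S`.
  have hX : x ^ (t + 1) * (1 - w + δ) = δ := by
    have e1 : x * (2 - δ) = 1 := by rw [hδ]; field_simp
    have e2 : x * (x ^ (t + 1) * (1 - w + δ) - δ) = 0 := by
      rw [redDen, ← hw, pow_succ x (t + 1)] at h0
      linear_combination h0 + (1 - x ^ (t + 1)) * e1
    rcases mul_eq_zero.mp e2 with h | h <;> linarith
  have hre : f'.re = -2 * (1 - x ^ (t + 1)) + (1 - 2 * x) * -((t + 1) * x ^ t)
      + ((t + 2) * x ^ (t + 1) * (1 - w) + x ^ (t + 2) * -w') := by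
    rw [hf', altSum_ofReal t 0 2, ← hw]
    have e : ∀ c : ℂ, ((x : ℂ) ^ (t + 2) * -c).re = x ^ (t + 2) * -c.re := by
      intro c
      rw [← Complex.ofReal_pow, Complex.re_ofReal_mul, Complex.neg_re]
    rw [Complex.add_re, Complex.add_re _ ((x : ℂ) ^ (t + 2) * _), e, ← hw']
    congr 1
    · rw [← Complex.ofReal_re (-2 * (1 - x ^ (t + 1)) + (1 - 2 * x) * -((t + 1) * x ^ t))]
      push_cast; rfl
    · congr 1
      rw [← Complex.ofReal_re ((t + 2) * x ^ (t + 1) * (1 - w))]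
      push_cast; rfl
  have hN : (clearedNum t 2 x).re = (1 - x ^ (t + 1)) * (1 - x - x ^ 2) + x * (x ^ (t + 1)) ^ 2
      - x * x ^ (t + 1) * S := by
    rw [clearedNum_two ht hq, altSum_ofReal t 1 2, ← hS, ← Complex.ofReal_re ((1 - x ^ (t + 1)) *
      (1 - x - x ^ 2) + x * (x ^ (t + 1)) ^ 2 - x * x ^ (t + 1) * S)]
    push_cast; rfl
  have hxt : x ^ (t + 1) = x ^ t * x := pow_succ _ _
  have hρ : 1 / x = 2 - δ := by rw [hδ, one_div_one_div]
  have hx2 : x * (2 - δ) = 1 := by rw [hδ]; field_simp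
  have hA : resDen t δ w w' = -f'.re * ((1 - w + δ) * (2 - δ)) ^ 2 := by
    have e1 : (1 - 2 * x) * x ^ t = -δ * x ^ (t + 1) := by
      rw [hxt]; linear_combination -x ^ t * hx2
    have e2 : x ^ (t + 2) = x ^ (t + 1) * x := pow_succ _ _
    have e3 : f'.re = -2 * (1 - x ^ (t + 1)) + (t + 1) * δ * x ^ (t + 1)
        + ((t + 2) * x ^ (t + 1) * (1 - w) - x ^ (t + 1) * x * w') := by
      rw [hre, e2]; linear_combination -(t + 1) * e1
    rw [e3, resDen]
    linear_combination (2 - δ) ^ 2 * (1 - w + δ) * (2 + (t + 1) * δ + (t + 2) * (1 - w)) * hX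
      - (2 - δ) * (1 - w + δ) * w' * hX
      - (2 - δ) * (1 - w + δ) ^ 2 * w' * x ^ (t + 1) * hx2
  have hB : resNum δ w S = (clearedNum t 2 x).re * ((1 - w + δ) * (2 - δ)) ^ 2 := by
    have e1 : (1 - x - x ^ 2) * (2 - δ) ^ 2 = 1 - 3 * δ + δ ^ 2 := by
      linear_combination (-(2 - δ) - x * (2 - δ) - 1) * hx2
    have e2 : (clearedNum t 2 x).re * ((1 - w + δ) * (2 - δ)) ^ 2 =
        ((1 - w + δ) - x ^ (t + 1) * (1 - w + δ)) * (1 - w + δ) * ((1 - x - x ^ 2) * (2 - δ) ^ 2)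
        + x * (2 - δ) * (2 - δ) * (x ^ (t + 1) * (1 - w + δ)) ^ 2
        - x * (2 - δ) * (2 - δ) * (x ^ (t + 1) * (1 - w + δ)) * (1 - w + δ) * S := by
      rw [hN]; ring
    rw [e2, hX, e1, hx2, resNum]
    ring
  have hk : ((1 - w + δ) * (2 - δ)) ^ 2 ≠ 0 := fun h => hne (by rw [hA, h, mul_zero])
  have hf0 : f'.re ≠ 0 := fun h => hne (by rw [hA, h, neg_zero, zero_mul])
  have hf0' : f' ≠ 0 := fun h => hf0 (by rw [h, Complex.zero_re])
  have hz := (isDenZero_of_cleared ht (by rwa [abs_of_pos hx0])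
    (treeDen_eq_zero_of_redDen ht hx0.le hx h0) hd hf0').1
  have : resNum δ w S / resDen t δ w w' = -((clearedNum t 2 x).re / f'.re) := by
    rw [hA, hB, mul_div_mul_right _ _ hk, div_neg]
  rw [this]
  exact hz

/-- The parameters of an approximation to the second zero. -/
structure SecondData (t : ℕ) (z v v1 v2 x : ℝ) : Prop where
  z_pos : 0 < z
  z_le : z ≤ 1 / 16
  tz : t * z = 1
  v_eq : v = Real.log 2 + z * v1
  v1_eq : v1 = -(Real.log 2 - Real.log 2 ^ 2) / 2 + z * v2
  v_bd : 0.6864 ≤ v ∧ v ≤ 0.69315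
  v2_bd : 0.288 ≤ v2 ∧ v2 ≤ 0.292
  x_eq : x = 1 / (1 + z * v)
  pow_le : x ^ brk t 2 ≤ 0.7076 * z ^ 4

lemma IsShiftedInv.exists_data {t : ℕ} (ht : 16 ≤ t) {σ x : ℝ} (h : IsShiftedInv t σ x)
    (hσ : |σ| ≤ 0.26) : ∃ z v v1 v2, SecondData t z v v1 v2 x := by
  obtain ⟨v, v1, v2, v3, c2, c3, c4, h, hx⟩ := h
  have ht' : (16 : ℝ) ≤ t := by exact_mod_cast ht
  obtain ⟨z, hz⟩ : ∃ z : ℝ, z = 1 / t := ⟨_, rfl⟩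
  rw [← hz] at h hx
  have z0 : 0 < z := by rw [hz]; positivity
  have z1 : z ≤ 1 / 16 := by rw [hz]; exact one_div_le_one_div_of_le (by norm_num) ht'
  have hzt : t * z = 1 := by rw [hz]; field_simp
  obtain ⟨b1, -, b3⟩ := h.bounds z0 z1 hσ
  have hu0 : 0 < z * v := mul_pos z0 (by linarith)
  have hp := h.pow_brk_le z0 z1 hzt hσ (x := x) (by rw [hx]; positivity)
    (by rw [hx, one_div_mul_cancel (by positivity)])
  have h2 := inv_two_pow_le ht hzt
  exact ⟨z, v, v1, v2, z0, z1, hzt, h.v, by rw [h.v1, h.c2], b1, b3, hx, by linarith⟩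

namespace SecondData

variable {t : ℕ} {z v v1 v2 x : ℝ}

lemma x_bounds (h : SecondData t z v v1 v2 x) : 0.958 ≤ x ∧ x < 1 ∧ x * (1 + z * v) = 1 := by
  have h1 : 0 < z * v := mul_pos h.z_pos (by linarith [h.v_bd.1])
  have h2 : z * v ≤ 1 / 16 * 0.69315 :=
    mul_le_mul h.z_le h.v_bd.2 (by linarith [h.v_bd.1]) (by norm_num)
  rw [h.x_eq]
  refine ⟨?_, ?_, one_div_mul_cancel (by positivity)⟩
  · rw [le_div_iff₀ (by linarith)]; linarith
  · rw [div_lt_one (by linarith)]; linarith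

lemma z_four_le (h : SecondData t z v v1 v2 x) : z ^ 4 ≤ 1 / 65536 := by
  have := pow_le_pow_left₀ h.z_pos.le h.z_le 4
  norm_num at this ⊢
  exact this

lemma omega_bounds (h : SecondData t z v v1 v2 x) (ht : 16 ≤ t) :
    0 ≤ (altSum t 0 2 (x : ℂ)).re ∧ (altSum t 0 2 (x : ℂ)).re ≤ 0.71 * z ^ 4 := by
  obtain ⟨x0, x1, -⟩ := h.x_bounds
  have hp := h.pow_le
  have z4 := h.z_four_le
  have z40 := pow_pos h.z_pos 4
  have hw1 := altSum_zero_re_le (by omega : 1 ≤ t) (by linarith) x1 (i := 2) (by linarith)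
  refine ⟨altSum_zero_re_nonneg (by omega) (by linarith) (by linarith) (by linarith), hw1.trans ?_⟩
  rw [div_le_iff₀ (by linarith)]
  have := mul_le_mul_of_nonneg_left (by linarith : x ^ brk t 2 ≤ 0.0001)
    (by positivity : 0 ≤ 0.71 * z ^ 4)
  linarith

lemma abs_sum_le (h : SecondData t z v v1 v2 x) (ht : 16 ≤ t) :
    |(altSum t 1 2 (x : ℂ)).re| ≤ 2.13 * z ^ 4 := by
  obtain ⟨x0, x1, -⟩ := h.x_bounds
  have hp := h.pow_le
  have z4 := h.z_four_le
  have := norm_altSum_le (by omega : 1 ≤ t) x1 (q := (x : ℂ))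
    (by rw [Complex.norm_real, Real.norm_of_nonneg (by linarith)]) 1 2 (by linarith)
  exact (Complex.abs_re_le_norm _).trans (by linarith [pow_pos h.z_pos 4])

lemma abs_deriv_le (h : SecondData t z v v1 v2 x) (ht : 16 ≤ t) :
    |(deriv (altSum t 0 2) (x : ℂ)).re| ≤ 6.6 * z ^ 2 := by
  obtain ⟨x0, x1, hx⟩ := h.x_bounds
  have hz := h.z_pos
  have hz1 := h.z_le
  obtain ⟨e, he⟩ : ∃ e : ℝ, e = brk t 2 := ⟨_, rfl⟩
  have he' : e * z ^ 2 = 1 + z + z ^ 2 := by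
    rw [he, brk_two]; push_cast; linear_combination (t * z + 1 + z) * h.tz
  have z20 : 0 < z ^ 2 := by positivity
  have z2 : z ^ 2 ≤ 1 / 16 * z := by nlinarith
  have e0 : 0 < e := by
    by_contra hn
    have := mul_nonpos_of_nonpos_of_nonneg (not_lt.mp hn) z20.le
    linarith
  have h1e : 1 / e ≤ z ^ 2 := by
    rw [div_le_iff₀ e0]; linarith
  have hx1e : x * (1 + 1 / e) < 1 := by
    have : x * (1 + 1 / e) < x * (1 + z * v) := by
      refine mul_lt_mul_of_pos_left ?_ (by linarith)
      nlinarith [h.v_bd.1]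
    linarith
  have hp := h.pow_le
  have z4 := h.z_four_le
  have hd := norm_deriv_altSum_two_le (by omega : 1 ≤ t) 0 he (by linarith) hx1e (by linarith)
    (q := (x : ℂ)) (by rw [Complex.norm_real, Real.norm_of_nonneg (by linarith)])
  refine (Complex.abs_re_le_norm _).trans (hd.trans ?_)
  rw [div_le_iff₀ (by linarith)]
  have h1 : e * x ^ brk t 2 ≤ e * (0.7076 * z ^ 4) := mul_le_mul_of_nonneg_left hp e0.le
  have h2 : e * (0.7076 * z ^ 4) = 0.7076 * ((1 + z + z ^ 2) * z ^ 2) := by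
    rw [← he']; ring
  have h3 : (1 + z + z ^ 2) * z ^ 2 ≤ 1.0665 * z ^ 2 :=
    mul_le_mul_of_nonneg_right (by linarith) z20.le
  have h4 : 6.6 * z ^ 2 * 0.958 ≤ 6.6 * z ^ 2 * x := mul_le_mul_of_nonneg_left x0 (by positivity)
  linarith

end SecondData

/-- Second order term in the comparison of the second residue with
`z * (1 / 4 - (4 * L + 1) / 8 * z + κ * z ^ 2)`. -/
noncomputable def resTwoRest (L z v v1 κ : ℝ) : ℝ :=
  -2 * v1 - (v ^ 2 - 4 * v + z * v ^ 2 - z * v ^ 3) / 2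
    - (3 * v - z ^ 2 * v ^ 3) * (1 - 3 * v + z * (v ^ 2 - 4 * v + z * v ^ 2)) / 4
    + (4 * L + 1) / 8 * (2 * (1 + z * (v ^ 2 - 4 * v + z * v ^ 2 - z * v ^ 3))
      + z * ((3 * v - z ^ 2 * v ^ 3) * (1 - 3 * v + z * (v ^ 2 - 4 * v + z * v ^ 2))))
    - κ * ((2 + z * (3 * v - z ^ 2 * v ^ 3)) * (2 + z * (1 - 3 * v + z * (v ^ 2 - 4 * v + z * v ^ 2))))

/-- The coefficients `1 / 4` and `(4 * L + 1) / 8` are those that cancel the orders `1` and `z`. -/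
lemma resTwoRest_eq {L z v v1 : ℝ} (κ : ℝ) (hv : v = L + z * v1) :
    (1 - 2 * (z * v)) - (1 / 4 - (4 * L + 1) / 8 * z + κ * z ^ 2) * ((1 + z * v) ^ 2 * (2 - z * v) *
      ((1 + z) * (1 - z * v) * (2 - z * v) - z * (1 + z * v))) = z ^ 2 * resTwoRest L z v v1 κ := by
  rw [resTwoRest]
  linear_combination -2 * z * hv

namespace IExpr

def resTwo (v v1 fk j F : IExpr) (κ : IExpr) : IExpr :=
  rat 0 1 - rat 2 1 * v1 - rat 1 2 * j - rat 1 4 * fk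
    + (rat 1 2 * var 1 + rat 1 8) * (rat 2 1 * (rat 1 1 + var 0 * j) + var 0 * fk) - κ * F

def vv1 : IExpr := rat 1 2 * (var 1 * var 1) - rat 1 2 * var 1 + var 0 * var 2
def vv : IExpr := var 1 + var 0 * vv1
def hh : IExpr := vv * vv - rat 4 1 * vv + var 0 * (vv * vv)
def ff : IExpr := rat 3 1 * vv - var 0 * var 0 * (vv * vv * vv)
def kk : IExpr := rat 1 1 - rat 3 1 * vv + var 0 * hh
def resTwoAt (κ : IExpr) : IExpr :=
  resTwo vv vv1 (ff * kk) (hh - var 0 * (vv * vv * vv))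
    ((rat 2 1 + var 0 * ff) * (rat 2 1 + var 0 * kk)) κ

lemma eval_resTwoAt {L z v v1 v2 κ : ℝ} {k : IExpr} (hk : k.eval (values z [L, v2]) = κ)
    (hv : v = L + z * v1) (h1 : v1 = -(L - L ^ 2) / 2 + z * v2) :
    (resTwoAt k).eval (values z [L, v2]) = resTwoRest L z v v1 κ := by
  have x0 : (values z [L, v2]) 0 = z := rfl
  have x1 : (values z [L, v2]) 1 = L := rfl
  have x2 : (values z [L, v2]) 2 = v2 := rfl
  have e1 : vv1.eval (values z [L, v2]) = v1 := by
    simp only [vv1, eval_add, eval_sub, eval_mul, eval_rat, eval_var, x0, x1, x2]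
    rw [h1]; push_cast; ring
  have e2 : vv.eval (values z [L, v2]) = v := by
    simp only [vv, eval_add, eval_mul, eval_var, x0, x1, e1]
    rw [hv]
  simp only [resTwoAt, resTwo, ff, kk, hh, eval_add, eval_sub, eval_mul, eval_rat, eval_var, x0, x1,
    e1, e2, hk]
  rw [resTwoRest]; push_cast; ring

end IExpr

-- The extra margin `4 * z` pays for replacing true numerator and denominator by their main terms:
-- the errors `14 * z ^ 3` and `7 * z ^ 4` contribute `14 / 4 + 7 / 16 < 4`.
set_option maxRecDepth 100000 in
lemma resTwoAt_upper : (.rat 0 1 - IExpr.resTwoAt (.rat 77 100) - .rat 4 1 * .var 0).posCheck 101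
    625000000000000000000000000 [(693147180300000000000000000000, 500000000000000000000),
      (288000000000000000000000000000, 4000000000000000000000000000)] = true := by decide +kernel

set_option maxRecDepth 100000 in
lemma resTwoAt_lower : (IExpr.resTwoAt (.rat 0 1 - .rat 77 100) - .rat 4 1 * .var 0).posCheck 11
    6250000000000000000000000000 [(693147180300000000000000000000, 500000000000000000000),
      (288000000000000000000000000000, 4000000000000000000000000000)] = true := by decide +kernel

lemma abs_mul_le_mul {a b A B : ℝ} (ha : |a| ≤ A) (hb : |b| ≤ B) : |a * b| ≤ A * B := by
  rw [abs_mul]; exact mul_le_mul ha hb (abs_nonneg _) ((abs_nonneg _).trans ha)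

lemma second_factor_bounds {z u : ℝ} (hz : 0 < z) (hz' : z ≤ 1 / 16) (hu : 0 ≤ u)
    (hu' : u ≤ 0.0434) : 1.7 ≤ (1 + z) * (1 - u) * (2 - u) - z * (1 + u) ∧
      (1 + z) * (1 - u) * (2 - u) - z * (1 + u) ≤ 2.13 ∧ 1.9 ≤ (1 + u) ^ 2 * (2 - u) := by
  obtain ⟨p, hp⟩ : ∃ p, p = (1 - u) * (2 - u) := ⟨_, rfl⟩
  have p1 : 1.869 ≤ p := by rw [hp]; nlinarith
  have p2 : p ≤ 2 := by rw [hp]; nlinarith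
  have e : (1 + z) * (1 - u) * (2 - u) - z * (1 + u) = p + z * (p - 1 - u) := by rw [hp]; ring
  have k1 : 0 ≤ z * (p - 1 - u) := mul_nonneg hz.le (by linarith)
  have k2 : z * (p - 1 - u) ≤ 1 / 16 * 1 := mul_le_mul hz' (by linarith) (by linarith) (by norm_num)
  have e2 : (1 + u) ^ 2 * (2 - u) = 2 + u * (3 - u ^ 2) := by ring
  have k3 : 0 ≤ u * (3 - u ^ 2) := mul_nonneg hu (by nlinarith)
  rw [e, e2]
  refine ⟨?_, ?_, ?_⟩ <;> linarith

lemma resDen_two_approx {t : ℕ} {z u w w' : ℝ} (hz : 0 < z) (hz' : z ≤ 1 / 16) (hzt : t * z = 1)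
    (hu : 0 ≤ u) (hu' : u ≤ 0.0434) (hw : 0 ≤ w) (hw1 : w ≤ 0.71 * z ^ 4)
    (hw' : |w'| ≤ 6.6 * z ^ 2) :
    |z * resDen t (1 - u) w w' + (1 + u) ^ 2 * (2 - u) * ((1 + z) * (1 - u) * (2 - u)
      - z * (1 + u))| ≤ 14 * z ^ 3 := by
  have z40 : 0 < z ^ 4 := by positivity
  have z30 : 0 < z ^ 3 := by positivity
  have z43 : z ^ 4 ≤ 1 / 16 * z ^ 3 := by rw [pow_succ z 3]; nlinarith
  have z3 : z ^ 3 ≤ 1 / 4096 := by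
    have := pow_le_pow_left₀ hz.le hz' 3
    norm_num at this ⊢; exact this
  obtain ⟨H, hH⟩ : ∃ H, H = (1 + z) * (1 - u) * (2 - u) - z * (1 + u) := ⟨_, rfl⟩
  obtain ⟨J, hJ⟩ : ∃ J, J = 2 * z - (1 + 2 * z) * (1 - u) := ⟨_, rfl⟩
  have hHb : |H| ≤ 2.13 := by
    obtain ⟨h1, h2, -⟩ := second_factor_bounds hz hz' hu hu'
    rw [hH, abs_le]; constructor <;> linarith
  have hJb : |J| ≤ 1.13 := by rw [hJ, abs_le]; constructor <;> nlinarith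
  have hwb : |w| ≤ 0.71 * z ^ 4 := by rwa [abs_of_nonneg hw]
  have hE : |2 - u - w| ≤ 2 := by rw [abs_le]; constructor <;> linarith
  have e : z * resDen t (1 - u) w w' + (1 + u) ^ 2 * (2 - u) * H =
      (1 + u) ^ 2 * (w * H - (2 - u - w) * w * J) +
        (1 + u) * (1 - u) * ((2 - u - w) * (z * w')) := by
    rw [resDen, hH, hJ]
    linear_combination (-(1 + u) ^ 2 * (2 - u - w) * ((1 - u) ^ 2 + (1 - u) * (1 - w))) * hzt
  rw [← hH, e]
  have h1 : |(1 + u) ^ 2| ≤ 1.09 := by rw [abs_of_nonneg (by positivity)]; nlinarith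
  have h2 : |(1 + u) * (1 - u)| ≤ 1 := by rw [abs_le]; constructor <;> nlinarith
  have h3 : |z| ≤ z := (abs_of_pos hz).le
  have k1 := abs_mul_le_mul hwb hHb
  have k2 := abs_mul_le_mul (abs_mul_le_mul hE hwb) hJb
  have k3 := abs_mul_le_mul h2 (abs_mul_le_mul hE (abs_mul_le_mul h3 hw'))
  have k4 := abs_mul_le_mul h1 ((abs_sub _ _).trans (add_le_add k1 k2))
  refine (abs_add_le _ _).trans ((add_le_add k4 k3).trans ?_)
  nlinarith

lemma resNum_two_approx {z u w S : ℝ} (hz : 0 < z) (hz' : z ≤ 1 / 16)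
    (hu : 0 ≤ u) (hu' : u ≤ 0.0434) (hw : 0 ≤ w) (hw1 : w ≤ 0.71 * z ^ 4)
    (hS : |S| ≤ 2.13 * z ^ 4) : |resNum (1 - u) w S + (1 - 2 * u)| ≤ 7 * z ^ 4 := by
  have z40 : 0 < z ^ 4 := by positivity
  have z4 : z ^ 4 ≤ 1 / 65536 := by
    have := pow_le_pow_left₀ hz.le hz' 4
    norm_num at this ⊢; exact this
  have e : resNum (1 - u) w S + (1 - 2 * u) = (-w * (3 - u - w)) * (u ^ 2 + u - 1)
      - (1 + u) * (1 - u) * ((2 - u - w) * S) := by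
    rw [resNum]; ring
  rw [e]
  have h0 : |-w| ≤ 0.71 * z ^ 4 := by rw [abs_neg, abs_of_nonneg hw]; exact hw1
  have h1 : |3 - u - w| ≤ 3 := by rw [abs_le]; constructor <;> linarith
  have h2 : |u ^ 2 + u - 1| ≤ 1 := by rw [abs_le]; constructor <;> nlinarith
  have h3 : |(1 + u) * (1 - u)| ≤ 1 := by rw [abs_le]; constructor <;> nlinarith
  have h4 : |2 - u - w| ≤ 2 := by rw [abs_le]; constructor <;> linarith
  have k1 := abs_mul_le_mul (abs_mul_le_mul h0 h1) h2
  have k2 := abs_mul_le_mul h3 (abs_mul_le_mul h4 hS)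
  refine (abs_sub _ _).trans ((add_le_add k1 k2).trans ?_)
  linarith

lemma abs_div_sub_le_of_approx {z L N D FH V K1 K2 : ℝ} (hz : 0 < z) (hz' : z ≤ 1 / 16)
    (L1 : 0.69 ≤ L) (L2 : L ≤ 0.7) (ha : |z * D + FH| ≤ 14 * z ^ 3) (hF : 3 ≤ FH)
    (hb : |N + V| ≤ 7 * z ^ 4)
    (id1 : V - (1 / 4 - (4 * L + 1) / 8 * z + 0.77 * z ^ 2) * FH = z ^ 2 * K1)
    (id2 : V - (1 / 4 - (4 * L + 1) / 8 * z + -0.77 * z ^ 2) * FH = z ^ 2 * K2)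
    (c1 : K1 ≤ -4 * z) (c2 : 4 * z ≤ K2) :
    D < 0 ∧ |N / D - (z / 4 - (4 * L + 1) / 8 * z ^ 2)| ≤ 0.77 * z ^ 3 := by
  obtain ⟨a1, a2⟩ := abs_le.mp ha
  obtain ⟨b1, b2⟩ := abs_le.mp hb
  have z20 : 0 < z ^ 2 := by positivity
  have z30 : 0 < z ^ 3 := by positivity
  have z43 : z ^ 4 ≤ 1 / 16 * z ^ 3 := by
    rw [pow_succ z 3]; linarith [mul_le_mul_of_nonneg_left hz' z30.le]
  have z3 : z ^ 3 ≤ 1 / 4096 := by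
    have := pow_le_pow_left₀ hz.le hz' 3
    norm_num at this ⊢; exact this
  have z2 : z ^ 2 ≤ 1 / 16 * z := by nlinarith
  have hD : D < 0 := by
    have : z * D < 0 := by linarith
    exact neg_of_mul_neg_right this hz.le
  refine ⟨hD, ?_⟩
  obtain ⟨a, haa⟩ : ∃ a, a = z * D + FH := ⟨_, rfl⟩
  obtain ⟨g1, hg1⟩ : ∃ g, g = 1 / 4 - (4 * L + 1) / 8 * z + 0.77 * z ^ 2 := ⟨_, rfl⟩
  obtain ⟨g2, hg2⟩ : ∃ g, g = 1 / 4 - (4 * L + 1) / 8 * z + -0.77 * z ^ 2 := ⟨_, rfl⟩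
  rw [← hg1] at id1
  rw [← hg2] at id2
  have l1 := mul_le_mul_of_nonneg_right L1 hz.le
  have l2 := mul_le_mul_of_nonneg_right L2 hz.le
  have g1b : 0 ≤ g1 ∧ g1 ≤ 1 / 4 := by rw [hg1]; constructor <;> linarith
  have g2b : 0 ≤ g2 ∧ g2 ≤ 1 / 4 := by rw [hg2]; constructor <;> linarith
  have k1 : |g1 * a| ≤ 1 / 4 * (14 * z ^ 3) :=
    abs_mul_le_mul (by rw [abs_of_nonneg g1b.1]; exact g1b.2) (by rw [haa]; exact ha)
  have k2 : |g2 * a| ≤ 1 / 4 * (14 * z ^ 3) :=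
    abs_mul_le_mul (by rw [abs_of_nonneg g2b.1]; exact g2b.2) (by rw [haa]; exact ha)
  have q1 := mul_le_mul_of_nonneg_left c1 z20.le
  have q2 := mul_le_mul_of_nonneg_left c2 z20.le
  have u1 : N / D ≤ z * g1 := by
    rw [div_le_iff_of_neg hD]
    have : z * g1 * D = g1 * a - g1 * FH := by rw [haa]; ring
    rw [this]
    linarith [(abs_le.mp k1).2]
  have u2 : z * g2 ≤ N / D := by
    rw [le_div_iff_of_neg hD]
    have : z * g2 * D = g2 * a - g2 * FH := by rw [haa]; ring
    rw [this]
    linarith [(abs_le.mp k2).1]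
  rw [hg1] at u1
  rw [hg2] at u2
  rw [abs_le]
  constructor <;> linarith

lemma SecondData.resTwoRest_bounds {t : ℕ} {z v v1 v2 x : ℝ} (h : SecondData t z v v1 v2 x) :
    resTwoRest (Real.log 2) z v v1 0.77 ≤ -4 * z ∧
      4 * z ≤ resTwoRest (Real.log 2) z v v1 (-0.77) := by
  have hz := h.z_pos
  have hz' := h.z_le
  obtain ⟨b1, b2⟩ := h.v2_bd
  have hbox : List.Forall₂ IExpr.InBox [Real.log 2, v2]
      [(693147180300000000000000000000, 500000000000000000000),
      (288000000000000000000000000000, 4000000000000000000000000000)] := by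
    refine .cons inBox_log_two (.cons ?_ .nil)
    constructor <;> norm_num [Ball.scale] <;> linarith
  have c1 := IExpr.eval_pos_of_posCheck resTwoAt_upper hz.le
    (by norm_num [Ball.scale]; linarith) hbox
  have c2 := IExpr.eval_pos_of_posCheck resTwoAt_lower hz.le
    (by norm_num [Ball.scale]; linarith) hbox
  have x0 : (IExpr.values z [Real.log 2, v2]) 0 = z := rfl
  rw [IExpr.eval_sub, IExpr.eval_sub, IExpr.eval_resTwoAt (κ := 0.77) (by norm_num) h.v_eq h.v1_eq]
    at c1
  rw [IExpr.eval_sub, IExpr.eval_resTwoAt (κ := -0.77) (by norm_num) h.v_eq h.v1_eq]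
    at c2
  simp only [IExpr.eval_mul, IExpr.eval_rat, IExpr.eval_var, x0] at c1 c2
  generalize resTwoRest (Real.log 2) z v v1 0.77 = K1 at c1 ⊢
  generalize resTwoRest (Real.log 2) z v v1 (-0.77) = K2 at c2 ⊢
  norm_num at c1 c2
  constructor <;> linarith

lemma SecondData.u_bounds {t : ℕ} {z v v1 v2 x : ℝ} (h : SecondData t z v v1 v2 x) :
    0 < z * v ∧ z * v ≤ 0.0434 := by
  obtain ⟨hv1, hv2⟩ := h.v_bd
  refine ⟨mul_pos h.z_pos (by linarith), ?_⟩
  have : z * v ≤ 1 / 16 * 0.69315 := mul_le_mul h.z_le hv2 (by linarith) (by norm_num)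
  linarith

lemma SecondData.residue_bounds {t : ℕ} {z v v1 v2 x w w' S : ℝ} (h : SecondData t z v v1 v2 x)
    (hw : 0 ≤ w) (hw1 : w ≤ 0.71 * z ^ 4) (hw' : |w'| ≤ 6.6 * z ^ 2) (hS : |S| ≤ 2.13 * z ^ 4) :
    resDen t (1 - z * v) w w' < 0 ∧
    |resNum (1 - z * v) w S / resDen t (1 - z * v) w w' -
      (z / 4 - (4 * Real.log 2 + 1) / 8 * z ^ 2)| ≤ 0.77 * z ^ 3 := by
  obtain ⟨hu0, hu1⟩ := h.u_bounds
  obtain ⟨f2, -, f1⟩ := second_factor_bounds h.z_pos h.z_le hu0.le hu1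
  obtain ⟨c1, c2⟩ := h.resTwoRest_bounds
  obtain ⟨L1, L2⟩ := log_two_bounds
  have hF := mul_le_mul f1 f2 (by norm_num) (by linarith)
  exact abs_div_sub_le_of_approx h.z_pos h.z_le (by linarith) (by linarith)
    (resDen_two_approx h.z_pos h.z_le h.tz hu0.le hu1 hw hw1 hw') (by linarith)
    (resNum_two_approx h.z_pos h.z_le hu0.le hu1 hw hw1 hS)
    (resTwoRest_eq 0.77 h.v_eq) (resTwoRest_eq (-0.77) h.v_eq) c1 c2

/-- Target value for the residue at the dominant pole. -/
noncomputable def resOneTarget (z s : ℝ) : ℝ :=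
  1 / 8 + s * ((1 - 2 * z) / 16) + s ^ 2 * ((2 + 3 * z - 5 * z ^ 2) / 32)
    + s ^ 3 * ((9 + 45 * z + 20 * z ^ 2 - 68 * z ^ 3) / 128)

/-- Fourth order term in the comparison of the dominant residue with `resOneTarget`. -/
noncomputable def resOneRest (z s d d1 d2 d3 T1 T2 T3 C1 C2 F2 F3 : ℝ) : ℝ :=
  (1 - 2 * z) / 2 * d3 + (3 / 4 * z ^ 2 + (1 + z) * z / 2) * (d1 ^ 2 + 2 * d2)
    + 4 * T1 * (1 + 2 * z) * d2
    - (2 * z ^ 3 + 3 * z ^ 2 * (1 + 2 * z)) / 8 * (d1 * (d ^ 2 + d + 1))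
    + T1 * (6 * z ^ 2 + 4 * (1 + z) * z) * (d1 * (d + 1)) + 4 * T2 * (1 + 2 * z) * d1
    - ((F2 * C2 + F3 * C1) / 8 + T1 * (2 * F3 + F2 * C1) + T2 * (2 * F2 + 4 * C2) + 4 * T3 * C1
      + s * (F3 * C2 / 8 + T1 * (F2 * C2 + F3 * C1) + T2 * (2 * F3 + F2 * C1)
        + T3 * (2 * F2 + 4 * C2)
      + s * (T1 * (F3 * C2) + T2 * (F2 * C2 + F3 * C1) + T3 * (2 * F3 + F2 * C1)
      + s * (T2 * (F3 * C2) + T3 * (F2 * C2 + F3 * C1) + s * (T3 * (F3 * C2))))))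

/-- `T1`, `T2`, `T3` are the coefficients that cancel the orders `s`, `s ^ 2`, `s ^ 3`; `g1`, `g2`,
`g3` each pass what remains to the next order. -/
lemma resOneRest_eq {z s d d1 d2 d3 T1 T2 T3 C1 C2 F2 F3 : ℝ} (h : IsDominantShift z s d d1 d2 d3)
    (hT1 : T1 = (1 - 2 * z) / 16) (hT2 : T2 = (2 + 3 * z - 5 * z ^ 2) / 32)
    (hT3 : T3 = (9 + 45 * z + 20 * z ^ 2 - 68 * z ^ 3) / 128)
    (hC1 : C1 = -(1 + 2 * z) * d) (hC2 : C2 = -((1 + z) * z * d ^ 2))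
    (hF2 : F2 = -(3 * z ^ 2 * d ^ 2)) (hF3 : F3 = z ^ 3 * d ^ 3) :
    (1 - 2 * (s * z * d)) - resOneTarget z s * ((2 - s * z * d) ^ 2 * (1 + s * z * d)) *
      (2 - (1 + z) * s * d * (s * z * d) - (1 + 2 * z) * s * d) =
      s ^ 4 * resOneRest z s d d1 d2 d3 T1 T2 T3 C1 C2 F2 F3 := by
  have e1 : resOneTarget z s = 1 / 8 + s * T1 + s ^ 2 * T2 + s ^ 3 * T3 := by
    rw [resOneTarget, hT1, hT2, hT3]
  have e2 : (2 - s * z * d) ^ 2 * (1 + s * z * d) = 4 + s ^ 2 * F2 + s ^ 3 * F3 := by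
    rw [hF2, hF3]; ring
  have e3 : 2 - (1 + z) * s * d * (s * z * d) - (1 + 2 * z) * s * d = 2 + s * C1 + s ^ 2 * C2 := by
    rw [hC1, hC2]; ring
  have g1 : -2 * z * d - (8 * T1 + C1 / 2) = s * ((1 - 2 * z) / 2 * d1) := by
    rw [hT1, hC1]; linear_combination (1 - 2 * z) / 2 * h.d
  have g2 : (1 - 2 * z) / 2 * d1 - (F2 / 4 + C2 / 2 + 4 * T1 * C1 + 8 * T2) =
      s * ((1 - 2 * z) / 2 * d2 + (3 / 4 * z ^ 2 + (1 + z) * z / 2) * (d1 * (d + 1))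
        + 4 * T1 * (1 + 2 * z) * d1) := by
    rw [hT1, hT2, hC1, hC2, hF2]
    linear_combination (1 - 2 * z) / 2 * h.d1 + (3 / 4 * z ^ 2 + (1 + z) * z / 2) * (d + 1) * h.d
      + (1 - 2 * z) / 4 * (1 + 2 * z) * h.d
  have g3 : (1 - 2 * z) / 2 * d2 + (3 / 4 * z ^ 2 + (1 + z) * z / 2) * (d1 * (d + 1))
        + 4 * T1 * (1 + 2 * z) * d1
      - ((2 * F3 + F2 * C1) / 8 + T1 * (2 * F2 + 4 * C2) + 4 * T2 * C1 + 8 * T3) =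
      s * ((1 - 2 * z) / 2 * d3 + (3 / 4 * z ^ 2 + (1 + z) * z / 2) * (d1 ^ 2 + 2 * d2)
    + 4 * T1 * (1 + 2 * z) * d2
    - (2 * z ^ 3 + 3 * z ^ 2 * (1 + 2 * z)) / 8 * (d1 * (d ^ 2 + d + 1))
    + T1 * (6 * z ^ 2 + 4 * (1 + z) * z) * (d1 * (d + 1)) + 4 * T2 * (1 + 2 * z) * d1) := by
    rw [hT1, hT2, hT3, hC1, hC2, hF2, hF3]
    linear_combination (1 - 2 * z) / 2 * h.d2
      + (3 / 4 * z ^ 2 + (1 + z) * z / 2) * (d1 * h.d + 2 * h.d1)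
      + (1 - 2 * z) / 4 * (1 + 2 * z) * h.d1
      - (2 * z ^ 3 + 3 * z ^ 2 * (1 + 2 * z)) / 8 * (d ^ 2 + d + 1) * h.d
      + (1 - 2 * z) / 16 * (6 * z ^ 2 + 4 * (1 + z) * z) * (d + 1) * h.d
      + (2 + 3 * z - 5 * z ^ 2) / 8 * (1 + 2 * z) * h.d
  rw [e1, e2, e3, resOneRest]
  linear_combination s * g1 + s ^ 2 * g2 + s ^ 3 * g3

namespace IExpr

def oneRest (d d1 d2 T1 T2 T3 C1 C2 F2 F3 : IExpr) : IExpr :=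
  (rat 1 2 - var 0) * var 2
    + (rat 5 4 * (var 0 * var 0) + rat 1 2 * var 0) * (d1 * d1 + rat 2 1 * d2)
    + rat 4 1 * T1 * (rat 1 1 + rat 2 1 * var 0) * d2
    - (var 0 * var 0 * var 0 + rat 3 8 * (var 0 * var 0)) * (d1 * (d * d + d + rat 1 1))
    + T1 * (rat 10 1 * (var 0 * var 0) + rat 4 1 * var 0) * (d1 * (d + rat 1 1))
    + rat 4 1 * T2 * (rat 1 1 + rat 2 1 * var 0) * d1
    - (rat 1 8 * (F2 * C2 + F3 * C1) + T1 * (rat 2 1 * F3 + F2 * C1)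
      + T2 * (rat 2 1 * F2 + rat 4 1 * C2) + rat 4 1 * T3 * C1
      + var 1 * (rat 1 8 * (F3 * C2) + T1 * (F2 * C2 + F3 * C1) + T2 * (rat 2 1 * F3 + F2 * C1)
        + T3 * (rat 2 1 * F2 + rat 4 1 * C2)
      + var 1 * (T1 * (F3 * C2) + T2 * (F2 * C2 + F3 * C1) + T3 * (rat 2 1 * F3 + F2 * C1)
      + var 1 * (T2 * (F3 * C2) + T3 * (F2 * C2 + F3 * C1) + var 1 * (T3 * (F3 * C2))))))

def dd2 : IExpr :=
  rat 3 8 + rat 19 8 * var 0 + rat 3 1 * (var 0 * var 0) + var 1 * var 2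
def dd1 : IExpr := rat 1 2 + rat 3 2 * var 0 + var 1 * dd2
def dd : IExpr := rat 1 1 + var 1 * dd1
def oneRestAt : IExpr :=
  oneRest dd dd1 dd2 (rat 1 16 - rat 1 8 * var 0)
    (rat 1 16 + rat 3 32 * var 0 - rat 5 32 * (var 0 * var 0))
    (rat 9 128 + rat 45 128 * var 0 + rat 5 32 * (var 0 * var 0) - rat 17 32 * (var 0 * var 0 * var 0))
    (rat 0 1 - (rat 1 1 + rat 2 1 * var 0) * dd) (rat 0 1 - (rat 1 1 + var 0) * var 0 * (dd * dd))
    (rat 0 1 - rat 3 1 * (var 0 * var 0) * (dd * dd)) (var 0 * var 0 * var 0 * (dd * dd * dd))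

lemma eval_oneRestAt {z s d d1 d2 d3 T1 T2 T3 C1 C2 F2 F3 : ℝ} (h : IsDominantShift z s d d1 d2 d3)
    (hT1 : T1 = (1 - 2 * z) / 16) (hT2 : T2 = (2 + 3 * z - 5 * z ^ 2) / 32)
    (hT3 : T3 = (9 + 45 * z + 20 * z ^ 2 - 68 * z ^ 3) / 128)
    (hC1 : C1 = -(1 + 2 * z) * d) (hC2 : C2 = -((1 + z) * z * d ^ 2))
    (hF2 : F2 = -(3 * z ^ 2 * d ^ 2)) (hF3 : F3 = z ^ 3 * d ^ 3) :
    oneRestAt.eval (values z [s, d3]) = resOneRest z s d d1 d2 d3 T1 T2 T3 C1 C2 F2 F3 := by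
  have x0 : (values z [s, d3]) 0 = z := rfl
  have x1 : (values z [s, d3]) 1 = s := rfl
  have x2 : (values z [s, d3]) 2 = d3 := rfl
  have e2 : dd2.eval (values z [s, d3]) = d2 := by
    simp only [dd2, eval_add, eval_mul, eval_rat, eval_var, x0, x1, x2]
    rw [h.d2]; push_cast; ring
  have e1 : dd1.eval (values z [s, d3]) = d1 := by
    simp only [dd1, eval_add, eval_mul, eval_rat, eval_var, x0, x1, e2]
    rw [h.d1]; push_cast; ring
  have e0 : dd.eval (values z [s, d3]) = d := by
    simp only [dd, eval_add, eval_mul, eval_rat, eval_var, x1, e1]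
    rw [h.d]; push_cast; ring
  simp only [oneRestAt, oneRest, eval_add, eval_sub, eval_mul, eval_rat, eval_var, x0, x1, x2,
    e0, e1, e2]
  rw [resOneRest, hT1, hT2, hT3, hC1, hC2, hF2, hF3]; push_cast; ring

end IExpr

-- The second variable is `s`, and `0.000123 > 1 / 8192`; the third is `d3`, ranging over `[0, 1]`.
set_option maxRecDepth 100000 in
lemma oneRestAt_upper : (.rat 25 10 - IExpr.oneRestAt).posCheck 101
    625000000000000000000000000 [(0, 123000000000000000000000000),
      (0, 1000000000000000000000000000000)] = true := by decide +kernel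

set_option maxRecDepth 100000 in
lemma oneRestAt_lower : (.rat 25 10 + IExpr.oneRestAt).posCheck 101
    625000000000000000000000000 [(0, 123000000000000000000000000),
      (0, 1000000000000000000000000000000)] = true := by decide +kernel

namespace DominantData

variable {t : ℕ} {z s y d d1 d2 c x : ℝ}

lemma rest_bounds (h : DominantData t z s y d d1 d2 c x) (hc : 0 ≤ c) (hc' : c ≤ 1) :
    |(1 - 2 * (s * z * d)) - resOneTarget z s * ((2 - s * z * d) ^ 2 * (1 + s * z * d)) *
      (2 - (1 + z) * s * d * (s * z * d) - (1 + 2 * z) * s * d)| ≤ 2.5 * s ^ 4 := by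
  have hz := h.z_pos
  have hz' := h.z_le
  have hs := h.s_pos
  have hs' := h.s_le
  have hbox : List.Forall₂ IExpr.InBox [s, c] [(0, 123000000000000000000000000),
      (0, 1000000000000000000000000000000)] := by
    refine .cons ?_ (.cons ?_ .nil) <;> constructor <;> norm_num [Ball.scale] <;> linarith
  have c1 := IExpr.eval_pos_of_posCheck oneRestAt_upper hz.le
    (by norm_num [Ball.scale]; linarith) hbox
  have c2 := IExpr.eval_pos_of_posCheck oneRestAt_lower hz.le
    (by norm_num [Ball.scale]; linarith) hbox
  rw [IExpr.eval_sub, IExpr.eval_oneRestAt h.shift rfl rfl rfl rfl rfl rfl rfl] at c1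
  rw [IExpr.eval_add, IExpr.eval_oneRestAt h.shift rfl rfl rfl rfl rfl rfl rfl] at c2
  rw [resOneRest_eq h.shift rfl rfl rfl rfl rfl rfl rfl, abs_mul, abs_of_pos (pow_pos hs 4),
    mul_comm]
  refine mul_le_mul_of_nonneg_right ?_ (pow_pos hs 4).le
  rw [IExpr.eval_rat] at c1 c2
  rw [abs_le]
  norm_num at c1 c2 ⊢
  constructor <;> linarith

lemma abs_sum_le (h : DominantData t z s y d d1 d2 c x) (ht : 16 ≤ t) :
    |(altSum t 1 2 (x : ℂ)).re| ≤ s ^ 4 / 1000 := by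
  obtain ⟨x0, x1⟩ := h.x_bounds
  have hp := h.pow_brk_le' ht
  have s4 := pow_pos h.s_pos 4
  have s4' : s ^ 4 ≤ 1 := pow_le_one₀ h.s_pos.le (by linarith [h.s_le])
  have hys : y * s ^ 4 / 10 ^ 20 ≤ s ^ 4 / 4000 := by
    rw [div_le_div_iff₀ (by norm_num) (by norm_num)]
    have := mul_le_mul_of_nonneg_right h.y_le s4.le
    linarith
  have := norm_altSum_le (by omega : 1 ≤ t) (by linarith : x < 1) (q := (x : ℂ))
    (by rw [Complex.norm_real, Real.norm_of_nonneg (by linarith)]) 1 2 (by linarith)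
  exact (Complex.abs_re_le_norm _).trans (by linarith)

lemma abs_deriv_le (h : DominantData t z s y d d1 d2 c x) (ht : 16 ≤ t) :
    |(deriv (altSum t 0 2) (x : ℂ)).re| ≤ s ^ 4 / 1000 := by
  obtain ⟨x0, x1⟩ := h.x_bounds
  have hp := h.pow_brk_le' ht
  have hy0 := h.y_pos
  have s4 := pow_pos h.s_pos 4
  have s4' : s ^ 4 ≤ 1 := pow_le_one₀ h.s_pos.le (by linarith [h.s_le])
  have hys : y * s ^ 4 / 10 ^ 20 ≤ s ^ 4 / 4000 := by
    rw [div_le_div_iff₀ (by norm_num) (by norm_num)]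
    have := mul_le_mul_of_nonneg_right h.y_le s4.le
    linarith
  obtain ⟨e, he⟩ : ∃ e : ℝ, e = brk t 2 := ⟨_, rfl⟩
  have ht' : (16 : ℝ) ≤ t := by exact_mod_cast ht
  have he' : e = t * (t + 1) + 1 := by rw [he, brk_two]; push_cast; ring
  have e1 : 16 ≤ e := by rw [he']; nlinarith
  have hey : e * y ≤ 1 := by
    have h1 : ((t ^ 4 : ℕ) : ℝ) ≤ ((2 ^ t : ℕ) : ℝ) := by exact_mod_cast pow_four_le_two_pow ht
    push_cast at h1
    have h2 : e ≤ t ^ 4 := by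
      have h3 : (256 : ℝ) ≤ t ^ 2 := by nlinarith
      have : (256 : ℝ) * t ^ 2 ≤ t ^ 4 := by
        rw [show (t : ℝ) ^ 4 = t ^ 2 * t ^ 2 by ring]; gcongr
      rw [he']; nlinarith
    rw [h.y_eq, mul_one_div, div_le_one (by positivity), pow_succ]
    linarith
  have hx1e : x * (1 + 1 / e) < 1 := by
    have : 1 / e ≤ 1 / 16 := one_div_le_one_div_of_le (by norm_num) e1
    nlinarith
  have hd := norm_deriv_altSum_two_le (by omega : 1 ≤ t) 0 he (by linarith) hx1e (by linarith)
    (q := (x : ℂ)) (by rw [Complex.norm_real, Real.norm_of_nonneg (by linarith)])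
  refine (Complex.abs_re_le_norm _).trans (hd.trans ?_)
  rw [div_le_iff₀ (by linarith)]
  have h1 : e * x ^ brk t 2 ≤ e * (y * s ^ 4 / 10 ^ 20) := mul_le_mul_of_nonneg_left hp (by linarith)
  have h2 : e * (y * s ^ 4 / 10 ^ 20) = e * y * (s ^ 4 / 10 ^ 20) := by ring
  have h3 : e * y * (s ^ 4 / 10 ^ 20) ≤ 1 * (s ^ 4 / 10 ^ 20) :=
    mul_le_mul_of_nonneg_right hey (by positivity)
  have h4 := mul_le_mul_of_nonneg_left x0.le (by positivity : 0 ≤ s ^ 4 / 1000)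
  linarith

lemma resNum_approx {δ w S ε : ℝ} (h0 : 0 ≤ δ) (h1 : δ ≤ 0.0001) (hε : 0 ≤ ε) (hε' : ε ≤ 0.001)
    (hw : |w| ≤ ε) (hS : |S| ≤ ε) : |resNum δ w S - (1 - 2 * δ)| ≤ 3 * ε := by
  have e : resNum δ w S - (1 - 2 * δ) = (-(w * (2 + δ - w))) * (1 - 3 * δ + δ ^ 2)
      - (2 - δ) * δ * ((1 - w + δ) * S) := by
    rw [resNum]; ring
  obtain ⟨w1, w2⟩ := abs_le.mp hw
  rw [e]
  have k1 : |2 + δ - w| ≤ 2.01 := by rw [abs_le]; constructor <;> linarith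
  have k2 : |1 - 3 * δ + δ ^ 2| ≤ 1.01 := by rw [abs_le]; constructor <;> nlinarith
  have k3 : |(2 - δ) * δ| ≤ 0.01 := by rw [abs_le]; constructor <;> nlinarith
  have k4 : |1 - w + δ| ≤ 1.01 := by rw [abs_le]; constructor <;> linarith
  have l1 := abs_mul_le_mul hw k1
  rw [← abs_neg] at l1
  have l2 := abs_mul_le_mul l1 k2
  have l3 := abs_mul_le_mul k3 (abs_mul_le_mul k4 hS)
  exact (abs_sub _ _).trans ((add_le_add l2 l3).trans (by linarith))

lemma resDen_approx {δ w w' ε C P Q : ℝ} (h0 : 0 ≤ δ) (h1 : δ ≤ 0.0001) (hε : 0 ≤ ε)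
    (hε' : ε ≤ 0.001) (hw : |w| ≤ ε) (hw' : |w'| ≤ ε) (hP : P = (t + 1) * δ ^ 2)
    (hQ : Q = (t + 2) * δ) (hC : C = 2 - P - Q) (hP0 : 0 ≤ P) (hQ0 : 0 ≤ Q) (hP1 : P ≤ 0.001)
    (hQ1 : Q ≤ 0.001) :
    |resDen t δ w w' - (2 - δ) ^ 2 * (1 + δ) * C| ≤ 18 * ε := by
  have e : resDen t δ w w' - (2 - δ) ^ 2 * (1 + δ) * C =
      (2 - δ) ^ 2 * (-(w * C + (1 - w + δ) * w * (2 - Q))) + (2 - δ) * δ * ((1 - w + δ) * w') := by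
    rw [resDen, hC, hP, hQ]; ring
  obtain ⟨w1, w2⟩ := abs_le.mp hw
  rw [e]
  have k1 : |(2 - δ) ^ 2| ≤ 4 := by rw [abs_le]; constructor <;> nlinarith
  have k2 : |C| ≤ 2 := by rw [hC, abs_le]; constructor <;> linarith
  have k3 : |(2 - δ) * δ| ≤ 0.01 := by rw [abs_le]; constructor <;> nlinarith
  have k4 : |1 - w + δ| ≤ 1.01 := by rw [abs_le]; constructor <;> linarith
  have k5 : |2 - Q| ≤ 2 := by rw [abs_le]; constructor <;> linarith
  have l1 := (abs_add_le _ _).trans (add_le_add (abs_mul_le_mul hw k2)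
    (abs_mul_le_mul (abs_mul_le_mul k4 hw) k5))
  rw [← abs_neg] at l1
  have l2 := abs_mul_le_mul k1 l1
  have l3 := abs_mul_le_mul k3 (abs_mul_le_mul k4 hw')
  exact (abs_add_le _ _).trans ((add_le_add l2 l3).trans (by linarith))

lemma abs_resOneTarget_le {z s : ℝ} (hz : 0 ≤ z) (hz' : z ≤ 1 / 16) (hs : 0 ≤ s)
    (hs' : s ≤ 1 / 8192) : |resOneTarget z s| ≤ 0.14 := by
  have z2 : z ^ 2 ≤ 1 / 16 * z := by nlinarith
  have z3 : z ^ 3 ≤ z := by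
    calc z ^ 3 ≤ z ^ 1 := pow_le_pow_of_le_one hz (by linarith) (by norm_num)
      _ = z := pow_one z
  have z20 : 0 ≤ z ^ 2 := by positivity
  have z30 : 0 ≤ z ^ 3 := by positivity
  have t1 : |(1 - 2 * z) / 16| ≤ 1 := by rw [abs_le]; constructor <;> linarith
  have t2 : |(2 + 3 * z - 5 * z ^ 2) / 32| ≤ 1 := by rw [abs_le]; constructor <;> linarith
  have t3 : |(9 + 45 * z + 20 * z ^ 2 - 68 * z ^ 3) / 128| ≤ 1 := by
    rw [abs_le]; constructor <;> linarith
  have s1 : |s| ≤ 1 / 8192 := by rwa [abs_of_nonneg hs]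
  have s2 : |s ^ 2| ≤ 1 / 8192 := by
    rw [abs_of_nonneg (by positivity)]; nlinarith
  have s3 : |s ^ 3| ≤ 1 / 8192 := by
    rw [abs_of_nonneg (by positivity)]
    calc s ^ 3 ≤ s ^ 1 := pow_le_pow_of_le_one hs (by linarith) (by norm_num)
      _ ≤ _ := by linarith
  have k1 := abs_le.mp (abs_mul_le_mul s1 t1)
  have k2 := abs_le.mp (abs_mul_le_mul s2 t2)
  have k3 := abs_le.mp (abs_mul_le_mul s3 t3)
  rw [resOneTarget, abs_le]
  constructor <;> linarith [k1.1, k1.2, k2.1, k2.2, k3.1, k3.2]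

/-- In units of `s ^ 4` the error is `2.5 + 0.003 + 0.14 * 0.018`, divided by a denominator of at
least `7.87`. Since `s ^ 4 = t ^ 4 / (16 * 2 ^ (4 * t))`, the constant `0.32` gives `1 / 50`. -/
lemma residue_bounds {w w' S : ℝ} (h : DominantData t z s y d d1 d2 c x) (hc : 0 ≤ c) (hc' : c ≤ 1)
    (hw : |w| ≤ s ^ 4 / 1000) (hw' : |w'| ≤ s ^ 4 / 1000) (hS : |S| ≤ s ^ 4 / 1000) :
    0 < resDen t (y * d) w w' ∧
      |resNum (y * d) w S / resDen t (y * d) w w' - resOneTarget z s| ≤ 0.32 * s ^ 4 := by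
  have hz := h.z_pos
  have hz' := h.z_le
  have hs := h.s_pos
  have hs' := h.s_le
  obtain ⟨hd1, hd2⟩ := h.d_bd
  obtain ⟨hδ0, hδ1⟩ := h.yd
  have hδ2 : y * d ≤ 0.0001 := by linarith [h.y_le]
  have s4 := pow_pos hs 4
  have s4' : s ^ 4 ≤ 1 := pow_le_one₀ hs.le (by linarith)
  have hsd0 : 0 ≤ s * d := mul_nonneg hs.le (by linarith)
  have hsd : s * d ≤ 0.0002 := by
    have : s * d ≤ 1 / 8192 * 1.0001 := mul_le_mul hs' hd2 (by linarith) (by norm_num)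
    linarith
  obtain ⟨P, hP⟩ : ∃ P, P = (1 + z) * s * d * (s * z * d) := ⟨_, rfl⟩
  obtain ⟨Q, hQ⟩ : ∃ Q, Q = (1 + 2 * z) * s * d := ⟨_, rfl⟩
  have hQ0 : 0 ≤ Q := by rw [hQ, mul_assoc]; positivity
  have hQ1 : Q ≤ 0.001 := by rw [hQ, mul_assoc]; nlinarith
  have hP' : P = (z + z ^ 2) * (s * d) ^ 2 := by rw [hP]; ring
  have hP0 : 0 ≤ P := by rw [hP']; positivity
  have hP1 : P ≤ 0.001 := by
    rw [hP']
    have a1 : (s * d) ^ 2 ≤ 0.0002 ^ 2 := pow_le_pow_left₀ hsd0 hsd 2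
    have a2 : z + z ^ 2 ≤ 1 := by nlinarith
    have := mul_le_mul a2 a1 (by positivity) (by norm_num)
    norm_num at this ⊢; linarith
  have hPe : P = (t + 1) * (y * d) ^ 2 := by
    rw [hP, h.yz]; linear_combination -(s ^ 2 * d ^ 2 * z) * h.tz
  have hQe : Q = (t + 2) * (y * d) := by
    rw [hQ, h.yz]; linear_combination -(s * d) * h.tz
  have ha := resDen_approx hδ0.le hδ2 (by positivity) (by linarith) hw hw' hPe hQe rfl hP0 hQ0 hP1 hQ1
  have hb := resNum_approx hδ0.le hδ2 (by positivity) (by linarith) hw hS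
  have hr := h.rest_bounds hc hc'
  rw [← hP, ← hQ, ← h.yz] at hr
  have hT := abs_resOneTarget_le hz.le hz' hs.le hs'
  have hFC : 7.9 ≤ (2 - y * d) ^ 2 * (1 + y * d) * (2 - P - Q) := by
    have f1 : 3.99 ≤ (2 - y * d) ^ 2 * (1 + y * d) := by
      have : (2 - y * d) ^ 2 * (1 + y * d) = 4 - (y * d) ^ 2 * (3 - y * d) := by ring
      have a1 : (y * d) ^ 2 ≤ 0.0001 ^ 2 := pow_le_pow_left₀ hδ0.le hδ2 2
      have := mul_le_mul a1 (by linarith : 3 - y * d ≤ 3) (by linarith) (by norm_num)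
      norm_num at this ⊢
      linarith
    have := mul_le_mul f1 (by linarith : 1.99 ≤ 2 - P - Q) (by norm_num) (by linarith)
    norm_num at this ⊢
    linarith
  generalize resOneTarget z s = T at hr hT ⊢
  rw [mul_assoc T] at hr
  generalize (2 - y * d) ^ 2 * (1 + y * d) * (2 - P - Q) = FC at ha hr hFC
  generalize resNum (y * d) w S = N at hb ⊢
  generalize resDen t (y * d) w w' = D at ha ⊢
  have hD : 7.8 ≤ D := by linarith [(abs_le.mp ha).1]
  have hD' : 7.87 ≤ D := by
    have : s ^ 4 ≤ 0.001 := by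
      calc s ^ 4 ≤ s ^ 1 := pow_le_pow_of_le_one hs.le (by linarith) (by norm_num)
        _ ≤ 0.001 := by linarith
    linarith [(abs_le.mp ha).1]
  refine ⟨by linarith, ?_⟩
  have k1 := abs_mul_le_mul hT ha
  have e : N / D - T = (N - T * D) / D := by field_simp
  rw [e, abs_div, abs_of_pos (by linarith : 0 < D), div_le_iff₀ (by linarith)]
  have e2 : N - T * D = (N - (1 - 2 * (y * d))) + ((1 - 2 * (y * d)) - T * FC) - T * (D - FC) := by
    ring
  rw [e2]
  refine (abs_sub _ _).trans ((add_le_add ((abs_add_le _ _).trans (add_le_add hb hr)) k1).trans ?_)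
  linarith [mul_le_mul_of_nonneg_right hD' s4.le]

end DominantData

/-! ### Localisation of the zeros for `t ≥ 16` -/

lemma normSq_mul_sub_one (a m k : ℝ) {q : ℂ} (hm : ‖q‖ = m) (hk : q.re = m * (1 - k)) :
    ‖(a : ℂ) * q - 1‖ ^ 2 = (a * m - 1) ^ 2 + 2 * a * m * k := by
  have h1 : q.re ^ 2 + q.im ^ 2 = m ^ 2 := by
    rw [← hm, Complex.sq_norm, Complex.normSq_apply]; ring
  rw [Complex.sq_norm, Complex.normSq_apply]
  simp only [Complex.sub_re, Complex.sub_im, Complex.re_ofReal_mul, Complex.im_ofReal_mul,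
    Complex.one_re, Complex.one_im]
  linear_combination a ^ 2 * h1 - 2 * a * hk

/-- If `(1 - 2 q) + q ^ n (3 q - 1)` is small, so is the angle of `q`. -/
lemma angle_le_of_norm_le {m k M κ : ℝ} {q : ℂ} (hm : ‖q‖ = m) (hk : q.re = m * (1 - k))
    (hm1 : 1 / 3 ≤ m) (hm2 : m ≤ 1) (hM0 : 0 ≤ M) (hM : M ≤ 1 / 2) (hk0 : 0 ≤ k) (hκ : 0 ≤ κ) (hκ1 : κ ≤ 1)
    (h : ‖2 * q - 1‖ ≤ M * ‖3 * q - 1‖ + κ) :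
    (2 * m - 1 - M * (3 * m - 1)) * (2 * m - 1 + M * (3 * m - 1)) + 5 / 2 * (m * k) ≤ 5 * κ := by
  have e2 := normSq_mul_sub_one 2 m k hm hk
  have e3 := normSq_mul_sub_one 3 m k hm hk
  push_cast at e2 e3
  have h3 : ‖3 * q - 1‖ ≤ 4 := by
    calc ‖3 * q - 1‖ ≤ ‖3 * q‖ + ‖(1 : ℂ)‖ := norm_sub_le _ _
      _ ≤ 4 := by rw [norm_mul, hm]; norm_num; linarith
  have h4 : M * ‖3 * q - 1‖ ≤ 1 / 2 * 4 := mul_le_mul hM h3 (norm_nonneg _) (by norm_num)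
  have h5 := pow_le_pow_left₀ (norm_nonneg _) h 2
  have h6 : (M * ‖3 * q - 1‖ + κ) ^ 2 = M ^ 2 * ‖3 * q - 1‖ ^ 2 + κ * (2 * (M * ‖3 * q - 1‖) + κ) := by
    ring
  have h7 : κ * (2 * (M * ‖3 * q - 1‖) + κ) ≤ κ * 5 := mul_le_mul_of_nonneg_left (by linarith) hκ
  rw [h6, e2, e3] at h5
  -- The angular terms of the two squared norms are `4 m k` and `6 m k`; the factor `M ^ 2 ≤ 1 / 4`
  -- leaves `5 / 2 * (m k)`.
  have h8 : M ^ 2 ≤ 1 / 4 := by nlinarith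
  have h9 : 0 ≤ m * k := mul_nonneg (by linarith) hk0
  nlinarith [mul_le_mul_of_nonneg_right h8 h9]

/-- On the unit circle `‖w - 1‖ ^ 2 = 2 * (1 - w.re)`, and `‖ζ ^ j - 1‖ ≤ j * ‖ζ - 1‖` by
telescoping. -/
lemma one_sub_re_pow_le {ζ : ℂ} (hζ : ‖ζ‖ = 1) (j : ℕ) :
    1 - (ζ ^ j).re ≤ (j : ℝ) ^ 2 * (1 - ζ.re) := by
  have h1 : ∀ w : ℂ, ‖w‖ = 1 → ‖w - 1‖ ^ 2 = 2 * (1 - w.re) := by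
    intro w hw
    have := normSq_mul_sub_one 1 1 (1 - w.re) hw (by ring)
    push_cast at this
    rw [one_mul] at this
    rw [this]; ring
  have h2 : ‖ζ ^ j - 1‖ ≤ j * ‖ζ - 1‖ := by
    induction j with
    | zero => simp
    | succ j ih =>
      have e : ζ ^ (j + 1) - 1 = ζ ^ j * (ζ - 1) + (ζ ^ j - 1) := by ring
      rw [e]
      refine (norm_add_le _ _).trans ?_
      rw [norm_mul, norm_pow, hζ, one_pow, one_mul]
      push_cast
      linarith
  have h3 := pow_le_pow_left₀ (norm_nonneg _) h2 2
  rw [mul_pow, h1 _ (by rw [norm_pow, hζ, one_pow]), h1 _ hζ] at h3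
  linarith

lemma le_re_pow {q : ℂ} {m k : ℝ} (hm : ‖q‖ = m) (hm0 : 0 < m) (hk : q.re = m * (1 - k)) (j : ℕ) :
    m ^ j * (1 - j ^ 2 * k) ≤ (q ^ j).re := by
  obtain ⟨ζ, hζ⟩ : ∃ ζ : ℂ, ζ = q / m := ⟨_, rfl⟩
  have hm0' : (m : ℂ) ≠ 0 := by exact_mod_cast hm0.ne'
  have hq : q = m * ζ := by rw [hζ]; field_simp
  have h1 : ‖ζ‖ = 1 := by
    rw [hζ, norm_div, hm, Complex.norm_real, Real.norm_of_nonneg hm0.le, div_self hm0.ne']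
  have h2 : ζ.re = 1 - k := by
    have : m * ζ.re = m * (1 - k) := by rw [← hk, hq, Complex.re_ofReal_mul]
    exact mul_left_cancel₀ hm0.ne' this
  have h3 := one_sub_re_pow_le h1 j
  rw [h2] at h3
  rw [hq, mul_pow, ← Complex.ofReal_pow, Complex.re_ofReal_mul]
  refine mul_le_mul_of_nonneg_left ?_ (pow_nonneg hm0.le j)
  linarith

/-- Away from the origin the polynomial `1 - 2 q + q ^ n (3 q - 1)` expands distances from `β`. -/
lemma norm_sub_le_of_angle {t : ℕ} {z m k β : ℝ} {q : ℂ} (ht : 16 ≤ t) (hzt : t * z = 1)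
    (hm : ‖q‖ = m) (hm0 : 0 < m) (hk : q.re = m * (1 - k)) (hk1 : k ≤ z ^ 2 / 2)
    (hβ0 : 0.95 ≤ β) (hβ1 : β ≤ 1) (hmβ : β - m ≤ 0.04 * z) (hM : m ^ (t + 1) ≤ 1 / 2)
    (hβ : 0.9 ≤ β ^ (t + 1) * (3 * β - 1)) :
    3 / 2 * ‖q - β‖ ≤ ‖(1 - 2 * q + q ^ (t + 1) * (3 * q - 1)) -
      (1 - 2 * β + β ^ (t + 1) * (3 * β - 1))‖ := by
  have ht' : (16 : ℝ) ≤ t := by exact_mod_cast ht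
  have hz : 0 < z := by
    by_contra hn
    have := mul_nonpos_of_nonneg_of_nonpos (by linarith : (0 : ℝ) ≤ t) (not_lt.mp hn)
    linarith
  have hβp : 0 < β := by linarith
  -- These are the terms of the quotient `(q ^ (t + 1) - β ^ (t + 1)) / (q - β)`. For `i ≤ t` the
  -- small angle costs a factor `1 / 2`, and the modulus of `q` costs `0.95` by Bernoulli.
  have hterm : ∀ i ∈ Finset.range (t + 1),
      0.475 * β ^ t ≤ (q ^ i * (β : ℂ) ^ (t + 1 - 1 - i)).re := by
    intro i hi
    rw [Finset.mem_range] at hi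
    have hi' : (i : ℝ) ≤ t := by exact_mod_cast Nat.lt_succ_iff.mp hi
    have h1 := le_re_pow hm hm0 hk i
    have h2 : (i : ℝ) ^ 2 * k ≤ 1 / 2 := by
      calc (i : ℝ) ^ 2 * k ≤ i ^ 2 * (z ^ 2 / 2) := mul_le_mul_of_nonneg_left hk1 (by positivity)
        _ ≤ t ^ 2 * (z ^ 2 / 2) := by gcongr
        _ = (t * z) ^ 2 / 2 := by ring
        _ = 1 / 2 := by rw [hzt]; norm_num
    have h3 : 0.95 * β ^ i ≤ m ^ i := by
      rcases le_total β m with h | h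
      · have := pow_le_pow_left₀ hβp.le h i
        have := pow_pos hβp i
        linarith
      · have e : m / β = 1 + -((β - m) / β) := by field_simp; ring
        have hr : (β - m) / β ≤ 0.05 * z := by
          rw [div_le_iff₀ hβp]; nlinarith
        have hr0 : 0 ≤ (β - m) / β := div_nonneg (by linarith) hβp.le
        have hz1 : z ≤ 1 := by nlinarith
        have hb := one_add_mul_le_pow (a := -((β - m) / β)) (by linarith) i
        rw [← e, div_pow, le_div_iff₀ (pow_pos hβp i)] at hb
        refine le_trans (mul_le_mul_of_nonneg_right ?_ (pow_pos hβp i).le) hb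
        have : (i : ℝ) * ((β - m) / β) ≤ t * (0.05 * z) := mul_le_mul hi' hr hr0 (by linarith)
        nlinarith
    rw [← Complex.ofReal_pow, Complex.re_mul_ofReal]
    have h4 : 0.475 * β ^ i ≤ (q ^ i).re := by
      refine le_trans ?_ h1
      have : m ^ i * (1 / 2) ≤ m ^ i * (1 - i ^ 2 * k) :=
        mul_le_mul_of_nonneg_left (by linarith) (pow_nonneg hm0.le i)
      linarith
    have h5 := mul_le_mul_of_nonneg_right h4 (pow_nonneg hβp.le (t + 1 - 1 - i))
    refine le_trans (le_of_eq ?_) h5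
    rw [mul_assoc, ← pow_add]
    congr 2
    omega
  have hsum := Finset.sum_le_sum hterm
  rw [Finset.sum_const, Finset.card_range, nsmul_eq_mul, ← Complex.re_sum] at hsum
  obtain ⟨S, hS⟩ : ∃ S, S = ∑ i ∈ Finset.range (t + 1), q ^ i * (β : ℂ) ^ (t + 1 - 1 - i) := ⟨_, rfl⟩
  have hgeom : S * (q - β) = q ^ (t + 1) - (β : ℂ) ^ (t + 1) := by
    rw [hS]; exact (Commute.all _ _).geom_sum₂_mul _
  rw [← hS] at hsum
  have e : (1 - 2 * q + q ^ (t + 1) * (3 * q - 1)) - (1 - 2 * β + (β : ℂ) ^ (t + 1) * (3 * β - 1)) =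
      (((3 * β - 1 : ℝ) : ℂ) * S + (3 * q ^ (t + 1) - 2)) * (q - β) := by
    push_cast
    linear_combination -(3 * (β : ℂ) - 1) * hgeom
  rw [e, norm_mul]
  refine mul_le_mul_of_nonneg_right ?_ (norm_nonneg _)
  refine le_trans ?_ (Complex.re_le_norm _)
  rw [Complex.add_re, Complex.re_ofReal_mul]
  have h6 : -(3 * (1 / 2)) - 2 ≤ (3 * q ^ (t + 1) - 2).re := by
    have h7 := Complex.abs_re_le_norm (q ^ (t + 1))
    rw [norm_pow, hm] at h7
    have h8 : (3 * q ^ (t + 1) - 2).re = 3 * (q ^ (t + 1)).re - 2 := by simp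
    rw [h8]
    linarith [(abs_le.mp (h7.trans hM)).1]
  have h9 : β ^ (t + 1) ≤ β ^ t := pow_le_pow_of_le_one hβp.le hβ1 (Nat.le_succ t)
  have h10 := mul_le_mul_of_nonneg_left hsum (by linarith : 0 ≤ 3 * β - 1)
  have h11 := mul_le_mul_of_nonneg_right h9 (by linarith : 0 ≤ 3 * β - 1)
  have h12 : (17 : ℝ) ≤ ((t + 1 : ℕ) : ℝ) := by push_cast; linarith
  -- `17 * 0.475 * 0.9 > 7`, so subtracting the `7 / 2` from the remaining terms leaves more than `3
  -- / 2`.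
  have h13 : 17 * (0.475 * 0.9) ≤ ((t + 1 : ℕ) : ℝ) * (0.475 * (β ^ t * (3 * β - 1))) :=
    mul_le_mul h12 (by linarith) (by norm_num) (by linarith)
  norm_num at h13 h10 h6 ⊢
  linarith

lemma convexOn_pow_mul (n : ℕ) : ConvexOn ℝ (Set.Ici (1 / 3 : ℝ)) fun x => x ^ n * (3 * x - 1) := by
  have hsub : Set.Ici (1 / 3 : ℝ) ⊆ Set.Ici 0 := Set.Ici_subset_Ici.mpr (by norm_num)
  have h1 : ConvexOn ℝ (Set.Ici (1 / 3 : ℝ)) fun x : ℝ => x ^ n :=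
    (convexOn_pow n).subset hsub (convex_Ici _)
  have h2 : ConvexOn ℝ (Set.Ici (1 / 3 : ℝ)) fun x : ℝ => 3 * x - 1 :=
    ((convexOn_id (convex_Ici _)).smul (c := (3 : ℝ)) (by norm_num)).sub (concaveOn_const 1 (convex_Ici _))
  refine h1.mul h2 (fun x hx => pow_nonneg (hsub hx) n) (fun x hx => ?_) ?_
  · rw [Set.mem_Ici] at hx; linarith
  · refine MonotoneOn.monovaryOn ?_ ?_
    · exact fun x hx y _ hxy => pow_le_pow_left₀ (hsub hx) hxy n
    · exact fun x _ y _ hxy => by linarith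

/-- The function `2 x - 1 - x ^ n (3 x - 1)` is bounded below to the left of its zero `β`. -/
lemma gap_lower_left {n : ℕ} {m β ε : ℝ} (hm : 0.6 ≤ m) (hmβ : m ≤ β) (hβ : 0.9 ≤ β) (hβ1 : β ≤ 1)
    (hn : (0.6 : ℝ) ^ n ≤ 0.01) (hε : 0 ≤ ε) (hφ : -ε ≤ 2 * β - 1 - β ^ n * (3 * β - 1)) :
    0.47 * (β - m) - ε ≤ 2 * m - 1 - m ^ n * (3 * m - 1) := by
  have hd : 0 < β - 0.6 := by linarith
  obtain ⟨a, ha⟩ : ∃ a, a = (β - m) / (β - 0.6) := ⟨_, rfl⟩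
  have ha0 : 0 ≤ a := by rw [ha]; exact div_nonneg (by linarith) hd.le
  have ha1 : a ≤ 1 := by rw [ha, div_le_one hd]; linarith
  have ham : a * (β - 0.6) = β - m := by rw [ha, div_mul_cancel₀ _ hd.ne']
  -- The function is concave, hence above its chord from `0.6`, where its value is at least `0.2 -
  -- 0.008`, to `β`. As `β - 0.6 ≤ 0.4`, the slope exceeds `0.47`.
  have hc := (convexOn_pow_mul n).2 (x := 0.6) (y := β) (by norm_num [Set.mem_Ici])
    (by rw [Set.mem_Ici]; linarith) ha0 (by linarith : 0 ≤ 1 - a) (by ring)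
  have hmm : a • (0.6 : ℝ) + (1 - a) • β = m := by
    simp only [smul_eq_mul]; linarith
  rw [hmm] at hc
  simp only [smul_eq_mul] at hc
  have h1 : a * ((0.6 : ℝ) ^ n * (3 * 0.6 - 1)) ≤ a * 0.008 :=
    mul_le_mul_of_nonneg_left (by linarith) ha0
  have h2 := mul_le_mul_of_nonneg_left hφ (by linarith : 0 ≤ 1 - a)
  have h3 : a * ε ≥ 0 := mul_nonneg ha0 hε
  have h4 : β - m ≤ a * 0.4 := by rw [← ham]; exact mul_le_mul_of_nonneg_left (by linarith) ha0
  linarith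

/-- Beyond `β` the function can fall. By Bernoulli `x ^ n` gains at most `0.53 * n * (m - β)` from
`β` to `m`, and `3 * m - 1 ≤ 2`. -/
lemma gap_lower_right {n : ℕ} {m β : ℝ} (hβ : 0.95 ≤ β) (hβm : β ≤ m) (hm1 : m ≤ 1)
    (hM : m ^ n ≤ 1 / 2) : 2 * β - 1 - β ^ n * (3 * β - 1) - 1.06 * (n * (m - β)) ≤
      2 * m - 1 - m ^ n * (3 * m - 1) := by
  have hm0 : 0 < m := by linarith
  have h1 : m ^ n - β ^ n ≤ 0.53 * (n * (m - β)) := by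
    have e : β / m = 1 + -((m - β) / m) := by field_simp; ring
    have hr : (m - β) / m ≤ 1 := by rw [div_le_one hm0]; linarith
    have hb := one_add_mul_le_pow (a := -((m - β) / m)) (by linarith) n
    rw [← e, div_pow, le_div_iff₀ (pow_pos hm0 n)] at hb
    have h2 : (m - β) / m ≤ 1.06 * (m - β) := by
      rw [div_le_iff₀ hm0]; nlinarith
    have h3 := mul_le_mul_of_nonneg_left h2 (Nat.cast_nonneg (α := ℝ) n)
    have h4 : 0 ≤ (n : ℝ) * (1.06 * (m - β)) := by
      have : 0 ≤ m - β := by linarith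
      positivity
    have h5 := mul_le_mul_of_nonneg_left hM h4
    have h6 := mul_le_mul_of_nonneg_right h3 (pow_nonneg hm0.le n)
    linarith
  have h2 : β ^ n ≤ 1 / 2 := (pow_le_pow_left₀ (by linarith) hβm n).trans hM
  have h3 := mul_le_mul_of_nonneg_right h1 (by linarith : 0 ≤ 3 * m - 1)
  have h4 := mul_le_mul_of_nonneg_right h2 (by linarith : 0 ≤ m - β)
  have h5 : 0 ≤ (n : ℝ) * (m - β) := mul_nonneg (Nat.cast_nonneg n) (by linarith)
  have h6 := mul_le_mul_of_nonneg_left (by linarith : 3 * m - 1 ≤ 2) h5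
  linarith

/-- Properties of the radius `1 / rThree t` used in the localisation of the zeros. -/
structure RadiusData (t : ℕ) (z r : ℝ) : Prop where
  z_pos : 0 < z
  z_le : z ≤ 1 / 16
  tz : t * z = 1
  ge : 0.95 ≤ r
  lt : r < 1
  succ_le : r * (1 + 0.68 * z) ≤ 1
  pow_le : r ^ (t + 1) ≤ 1 / 2
  pow_brk_le : r ^ brk t 2 ≤ z ^ 4

namespace RadiusData

variable {t : ℕ} {z r : ℝ}

lemma four_le (h : RadiusData t z r) : z ^ 4 ≤ 1 / 65536 := by
  have := pow_le_pow_left₀ h.z_pos.le h.z_le 4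
  norm_num at this ⊢
  exact this

lemma norm_altSum_le (h : RadiusData t z r) (ht : 1 ≤ t) {q : ℂ} (hq : ‖q‖ ≤ r) (b : ℕ) :
    ‖altSum t b 2 q‖ ≤ 3 * z ^ 4 := by
  have := _root_.norm_altSum_le ht h.lt hq b 2 (by linarith [h.pow_brk_le, h.four_le])
  linarith [h.pow_brk_le]

lemma brk_mul_sq (h : RadiusData t z r) : (brk t 2 : ℝ) * z ^ 2 = 1 + z + z ^ 2 := by
  rw [brk_two]; push_cast; linear_combination (t * z + 1 + z) * h.tz

lemma norm_deriv_le (h : RadiusData t z r) (ht : 1 ≤ t) {q : ℂ} (hq : ‖q‖ ≤ r) :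
    ‖deriv (altSum t 0 2) q‖ ≤ 0.05 := by
  have hz := h.z_pos
  have hz' := h.z_le
  have z20 : 0 < z ^ 2 := by positivity
  have z2 : z ^ 2 ≤ 1 / 16 * z := by nlinarith
  have hb := h.brk_mul_sq
  have e0 : (0 : ℝ) < brk t 2 := by exact_mod_cast brk_pos ht 2
  have h1e : 1 / (brk t 2 : ℝ) ≤ z ^ 2 := by rw [div_le_iff₀ e0]; linarith
  have hr0 : 0 < r := by linarith [h.ge]
  have hx : r * (1 + 1 / (brk t 2 : ℝ)) < 1 := by
    refine lt_of_lt_of_le (mul_lt_mul_of_pos_left ?_ hr0) h.succ_le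
    linarith
  have hd := norm_deriv_altSum_two_le ht 0 rfl hr0 hx (by linarith [h.pow_brk_le, h.four_le]) hq
  refine hd.trans ?_
  rw [div_le_iff₀ hr0]
  have h1 : (brk t 2 : ℝ) * r ^ brk t 2 ≤ brk t 2 * z ^ 4 :=
    mul_le_mul_of_nonneg_left h.pow_brk_le e0.le
  have h2 : (brk t 2 : ℝ) * z ^ 4 = (1 + z + z ^ 2) * z ^ 2 := by rw [← hb]; ring
  have h3 : (1 + z + z ^ 2) * z ^ 2 ≤ 1.07 * (1 / 256) :=
    mul_le_mul (by linarith) (by linarith) z20.le (by norm_num)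
  linarith [h.ge]

lemma lipschitz (h : RadiusData t z r) (ht : 16 ≤ t) {p q : ℂ} (hp : ‖p‖ ≤ r) (hq : ‖q‖ ≤ r) :
    ‖q ^ (t + 2) * altSum t 0 2 q - p ^ (t + 2) * altSum t 0 2 p‖ ≤ 0.1 * ‖q - p‖ := by
  have hz := h.z_pos
  have hz' := h.z_le
  refine Convex.norm_image_sub_le_of_norm_hasDerivWithin_le
    (f := fun q => q ^ (t + 2) * altSum t 0 2 q)
    (f' := fun q => ((t + 2 : ℕ) : ℂ) * q ^ (t + 1) * altSum t 0 2 q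
      + q ^ (t + 2) * deriv (altSum t 0 2) q)
    (s := Metric.closedBall 0 r) (fun x hx => ?_) (fun x hx => ?_) (convex_closedBall 0 r)
    (mem_closedBall_zero_iff.mpr hp) (mem_closedBall_zero_iff.mpr hq)
  · rw [mem_closedBall_zero_iff] at hx
    have hw := (differentiableAt_altSum (by omega : 1 ≤ t) 0 2 (hx.trans_lt h.lt)).hasDerivAt
    exact ((hasDerivAt_pow (t + 2) x).mul hw).hasDerivWithinAt
  · rw [mem_closedBall_zero_iff] at hx
    have h1 : ‖x‖ ^ (t + 1) ≤ 1 / 2 := (pow_le_pow_left₀ (norm_nonneg _) hx _).trans h.pow_le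
    have h2 : ‖x‖ ^ (t + 2) ≤ 1 / 2 := by
      refine le_trans (pow_le_pow_of_le_one (norm_nonneg _) (hx.trans h.lt.le) ?_) h1
      omega
    have h3 := h.norm_altSum_le (by omega) hx 0
    have h4 := h.norm_deriv_le (by omega) hx
    refine (norm_add_le _ _).trans ?_
    rw [norm_mul, norm_mul, norm_mul, norm_pow, norm_pow, Complex.norm_natCast]
    have k1 : ((t + 2 : ℕ) : ℝ) * ‖x‖ ^ (t + 1) * ‖altSum t 0 2 x‖ ≤
        ((t + 2 : ℕ) : ℝ) * (1 / 2) * (3 * z ^ 4) := by gcongr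
    have k2 : ‖x‖ ^ (t + 2) * ‖deriv (altSum t 0 2) x‖ ≤ 1 / 2 * 0.05 := by gcongr
    have k3 : ((t + 2 : ℕ) : ℝ) * (1 / 2) * (3 * z ^ 4) = 1.5 * ((1 + 2 * z) * z ^ 3) := by
      push_cast; linear_combination 1.5 * z ^ 3 * h.tz
    have k4 : z ^ 3 ≤ (1 / 16) ^ 3 := pow_le_pow_left₀ hz.le hz' 3
    have k5 : (1 + 2 * z) * z ^ 3 ≤ 1.125 * (1 / 16) ^ 3 :=
      mul_le_mul (by linarith) k4 (by positivity) (by norm_num)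
    norm_num at k5 k2 k1 k3 ⊢
    linarith

lemma clearedDen_two_eq {t : ℕ} (ht : 1 ≤ t) {q : ℂ} (hq : ‖q‖ < 1) : clearedDen t 2 q =
    (1 - 2 * q + q ^ (t + 1) * (3 * q - 1)) - q ^ (t + 2) * altSum t 0 2 q := by
  rw [clearedDen_two ht hq]; ring

/-- A small value of the cleared denominator makes `‖2 q - 1‖` at most `‖q‖ ^ (t + 1) * ‖3 q - 1‖`
up to `2.5 * z ^ 4`, and `angle_le_of_norm_le` bounds the angle plus a multiple of the radial gap.
The gap is nearly nonnegative on both sides of `β`, which bounds the angle; far below `β` it is too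
large, which bounds `β - ‖q‖`. -/
lemma exists_angle {t : ℕ} {z r : ℝ} (h : RadiusData t z r) (ht : 16 ≤ t) {β : ℝ} (hβ : 0.95 ≤ β)
    (hφ0 : -(1.5 * z ^ 4) ≤ 2 * β - 1 - β ^ (t + 1) * (3 * β - 1)) (hβr1 : β ≤ r)
    (hβr2 : r - β ≤ 0.3 * z ^ 3) {q : ℂ} (hq : ‖q‖ ≤ r)
    (hq1 : 0.6 ≤ ‖q‖) (hP : ‖clearedDen t 2 q‖ ≤ z ^ 4) :
    ∃ k : ℝ, q.re = ‖q‖ * (1 - k) ∧ k ≤ z ^ 2 / 2 ∧ β - ‖q‖ ≤ 0.04 * z := by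
  obtain ⟨m, hm⟩ : ∃ m, m = ‖q‖ := ⟨_, rfl⟩
  rw [← hm] at hq hq1 ⊢
  have hz := h.z_pos
  have hz' := h.z_le
  have hr1 := h.lt
  have hm0 : 0 < m := by linarith
  obtain ⟨k, hk⟩ : ∃ k, k = 1 - q.re / m := ⟨_, rfl⟩
  have hkre : q.re = m * (1 - k) := by rw [hk]; field_simp; ring
  have hk0 : 0 ≤ k := by
    rw [hk, sub_nonneg, div_le_one hm0, hm]; exact Complex.re_le_norm q
  have z40 : 0 < z ^ 4 := pow_pos hz 4
  have z4 := h.four_le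
  have hM : m ^ (t + 1) ≤ 1 / 2 := (pow_le_pow_left₀ hm0.le hq _).trans h.pow_le
  have hM2 : m ^ (t + 2) ≤ 1 / 2 := by
    refine le_trans (pow_le_pow_of_le_one hm0.le (hq.trans hr1.le) ?_) hM
    omega
  have hkey : ‖2 * q - 1‖ ≤ m ^ (t + 1) * ‖3 * q - 1‖ + 2.5 * z ^ 4 := by
    have e : 2 * q - 1 = q ^ (t + 1) * (3 * q - 1) - q ^ (t + 2) * altSum t 0 2 q
        - clearedDen t 2 q := by
      rw [clearedDen_two_eq (by omega) (by rw [← hm]; linarith)]; ring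
    rw [e]
    refine (norm_sub_le _ _).trans ((add_le_add ((norm_sub_le _ _).trans le_rfl) hP).trans ?_)
    rw [norm_mul, norm_mul, norm_pow, norm_pow, ← hm]
    have := mul_le_mul hM2 (h.norm_altSum_le (by omega) (hm ▸ hq) 0) (norm_nonneg _) (by norm_num)
    linarith
  have hang := angle_le_of_norm_le hm.symm hkre (by linarith) (by linarith) (pow_nonneg hm0.le _)
    hM hk0 (by positivity) (by linarith) hkey
  have z3 : z ^ 4 ≤ 1 / 4096 * z := by
    have := pow_le_pow_left₀ hz.le hz' 3
    have e : z ^ 4 = z ^ 3 * z := by ring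
    rw [e]
    norm_num at this
    exact mul_le_mul_of_nonneg_right this hz.le
  have z20 : 0 < z ^ 2 := by positivity
  have z2 : z ^ 4 ≤ 1 / 256 * z ^ 2 := by
    have : z ^ 2 ≤ 1 / 256 := by nlinarith
    have e : z ^ 4 = z ^ 2 * z ^ 2 := by ring
    rw [e]
    exact mul_le_mul_of_nonneg_right this z20.le
  obtain ⟨G, hG⟩ : ∃ S, S = 2 * m - 1 + m ^ (t + 1) * (3 * m - 1) := ⟨_, rfl⟩
  have hMm : m ^ (t + 1) * (3 * m - 1) ≤ 1 / 2 * 2 :=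
    mul_le_mul hM (by linarith) (by linarith) (by norm_num)
  have hMm0 : 0 ≤ m ^ (t + 1) * (3 * m - 1) := mul_nonneg (pow_nonneg hm0.le _) (by linarith)
  have hG1 : 0.2 ≤ G := by rw [hG]; linarith
  have hG2 : G ≤ 2 := by rw [hG]; linarith
  have hleft : m ≤ β → 0.47 * (β - m) - 1.5 * z ^ 4 ≤ 2 * m - 1 - m ^ (t + 1) * (3 * m - 1) := by
    intro hmβ
    refine gap_lower_left hq1 hmβ (by linarith) (by linarith) ?_ (by positivity) hφ0
    refine (pow_le_pow_of_le_one (by norm_num) (by norm_num) (by omega : 17 ≤ t + 1)).trans ?_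
    norm_num
  have hφ : -(0.345 * z ^ 2) ≤ 2 * m - 1 - m ^ (t + 1) * (3 * m - 1) := by
    rcases le_total m β with hmβ | hmβ
    · have := hleft hmβ
      linarith
    · have h1 := gap_lower_right hβ hmβ (by linarith) hM
      have h2 : ((t + 1 : ℕ) : ℝ) * (m - β) ≤ ((t + 1 : ℕ) : ℝ) * (0.3 * z ^ 3) :=
        mul_le_mul_of_nonneg_left (by linarith) (Nat.cast_nonneg _)
      have h3 : ((t + 1 : ℕ) : ℝ) * (0.3 * z ^ 3) = 0.3 * ((1 + z) * z ^ 2) := by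
        push_cast; linear_combination 0.3 * z ^ 2 * h.tz
      have h4 : (1 + z) * z ^ 2 ≤ 1.0625 * z ^ 2 :=
        mul_le_mul_of_nonneg_right (by linarith) z20.le
      linarith
  rw [← hG] at hang
  generalize 2 * m - 1 - m ^ (t + 1) * (3 * m - 1) = φ at hang hleft hφ
  refine ⟨k, hkre, ?_, ?_⟩
  · have h1 := mul_le_mul_of_nonneg_right hφ (by linarith : 0 ≤ G)
    have h2 := mul_le_mul_of_nonneg_left hG2 (by positivity : 0 ≤ 0.345 * z ^ 2)
    have h3 := mul_le_mul_of_nonneg_right hq1 hk0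
    linarith
  · by_contra hcon
    rw [not_le] at hcon
    have h1 := hleft (by linarith)
    have h2 : 0 < φ := by linarith
    have h3 := mul_le_mul_of_nonneg_left hG1 h2.le
    have h4 : 0 ≤ m * k := mul_nonneg hm0.le hk0
    linarith

/-- The polynomial part expands distances from `β` by `3 / 2`, and the tail has Lipschitz constant
`0.1`. -/
lemma norm_sub_le (h : RadiusData t z r) (ht : 16 ≤ t) {β : ℝ} (hβ : 0.95 ≤ β)
    (hβ0 : redDen t β = 0) (hβr1 : β ≤ r) (hβr2 : r - β ≤ 0.3 * z ^ 3) {q : ℂ} (hq : ‖q‖ ≤ r)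
    (hq1 : 0.6 ≤ ‖q‖) (hP : ‖clearedDen t 2 q‖ ≤ z ^ 4) :
    1.4 * ‖q - β‖ ≤ ‖clearedDen t 2 q‖ := by
  have hr1 := h.lt
  have hβn : ‖(β : ℂ)‖ = β := by rw [Complex.norm_real, Real.norm_of_nonneg (by linarith)]
  have hβr : ‖(β : ℂ)‖ ≤ r := by rw [hβn]; exact hβr1
  have z4 := h.four_le
  have hβpow : β ^ (t + 2) ≤ 1 / 2 := by
    refine le_trans (pow_le_pow_of_le_one (by linarith) (by linarith) (?_ : t + 1 ≤ t + 2))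
      ((pow_le_pow_left₀ (by linarith) hβr1 _).trans h.pow_le)
    omega
  have hw0 := altSum_zero_re_nonneg (by omega : 1 ≤ t) (by linarith : 0 ≤ β) (by linarith) (i := 2)
    (((pow_le_pow_left₀ (by linarith) hβr1 _).trans h.pow_brk_le).trans (by linarith))
  have hw1 := (Complex.re_le_norm _).trans (h.norm_altSum_le (by omega) hβr 0)
  have hφ : 2 * β - 1 - β ^ (t + 1) * (3 * β - 1) =
      -(β ^ (t + 2) * (altSum t 0 2 (β : ℂ)).re) := by
    rw [redDen, pow_succ β (t + 1)] at hβ0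
    rw [pow_succ β (t + 1)]
    linear_combination -hβ0
  have hww := mul_le_mul hβpow hw1 hw0 (by norm_num)
  have hww0 : 0 ≤ β ^ (t + 2) * (altSum t 0 2 (β : ℂ)).re := mul_nonneg (by positivity) hw0
  obtain ⟨k, hk, hk1, hkβ⟩ := exists_angle h ht hβ (by rw [hφ]; linarith) hβr1 hβr2 hq hq1 hP
  have hM : ‖q‖ ^ (t + 1) ≤ 1 / 2 := (pow_le_pow_left₀ (norm_nonneg q) hq _).trans h.pow_le
  have h1 := norm_sub_le_of_angle ht h.tz rfl (by linarith) hk hk1 hβ (by linarith) hkβ hM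
    (by linarith)
  have h2 := h.lipschitz ht hβr hq
  have hβ0' : clearedDen t 2 (β : ℂ) = 0 := by
    rw [clearedDen, treeDen_eq_zero_of_redDen (by omega) (by linarith) (by linarith) hβ0, mul_zero]
  rw [clearedDen_two_eq (by omega) (hβr.trans_lt hr1)] at hβ0'
  have e : (1 - 2 * q + q ^ (t + 1) * (3 * q - 1)) - (1 - 2 * β + (β : ℂ) ^ (t + 1) * (3 * β - 1)) =
      clearedDen t 2 q + (q ^ (t + 2) * altSum t 0 2 q - (β : ℂ) ^ (t + 2) * altSum t 0 2 β) := by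
    rw [clearedDen_two_eq (by omega) (hq.trans_lt hr1)]
    linear_combination -hβ0'
  rw [e] at h1
  have h3 := h1.trans ((norm_add_le _ _).trans (add_le_add le_rfl h2))
  linarith

end RadiusData

namespace RadiusData

variable {t : ℕ} {z r : ℝ}

lemma pow_six_le (h : RadiusData t z r) (ht : 16 ≤ t) : (0.6 : ℝ) ^ t ≤ z ^ 2 := by
  have h1 : ((0.6 : ℝ) ^ t) ^ 2 ≤ (z ^ 2) ^ 2 := by
    calc ((0.6 : ℝ) ^ t) ^ 2 = (0.6 ^ 2) ^ t := by rw [← pow_mul, ← pow_mul, mul_comm]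
      _ ≤ (1 / 2) ^ t := pow_le_pow_left₀ (by norm_num) (by norm_num) t
      _ = 1 / 2 ^ t := by rw [div_pow, one_pow]
      _ ≤ z ^ 4 := inv_two_pow_le ht h.tz
      _ = (z ^ 2) ^ 2 := by ring
  have hz : 0 ≤ z ^ 2 := by positivity
  exact le_of_sq_le_sq h1 hz

/-- The cleared denominator is injective on the disc of radius `0.6`. -/
lemma eq_of_clearedDen_eq_zero (h : RadiusData t z r) (ht : 16 ≤ t) {p q : ℂ} (hp : ‖p‖ ≤ 0.6)
    (hq : ‖q‖ ≤ 0.6) (hp0 : clearedDen t 2 p = 0) (hq0 : clearedDen t 2 q = 0) : q = p := by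
  have hz := h.z_pos
  have hz' := h.z_le
  -- After the term `-2 q` is removed the Lipschitz constant is at most one, so two zeros would
  -- satisfy `2 * ‖q - p‖ ≤ ‖q - p‖`.
  have key : ‖(clearedDen t 2 q + 2 * q) - (clearedDen t 2 p + 2 * p)‖ ≤ 1 * ‖q - p‖ := by
    refine Convex.norm_image_sub_le_of_norm_hasDerivWithin_le
      (f := fun q => clearedDen t 2 q + 2 * q)
      (f' := fun q => (-2 * (1 - q ^ (t + 1)) + (1 - 2 * q) * -((t + 1) * q ^ t)
        + ((t + 2) * q ^ (t + 1) * (1 - altSum t 0 2 q)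
        + q ^ (t + 2) * -deriv (altSum t 0 2) q)) + 2 * 1)
      (s := Metric.closedBall 0 0.6) (fun x hx => ?_) (fun x hx => ?_) (convex_closedBall 0 0.6)
      (mem_closedBall_zero_iff.mpr hp) (mem_closedBall_zero_iff.mpr hq)
    · rw [mem_closedBall_zero_iff] at hx
      exact ((hasDerivAt_clearedDen_two (by omega) (by linarith)).add
        ((hasDerivAt_id x).const_mul 2)).hasDerivWithinAt
    · rw [mem_closedBall_zero_iff] at hx
      have hxr : ‖x‖ ≤ r := by linarith [h.ge]
      have h1 : ‖x‖ ^ t ≤ z ^ 2 := (pow_le_pow_left₀ (norm_nonneg _) hx _).trans (h.pow_six_le ht)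
      have hx1 : ‖x‖ ≤ 1 := by linarith
      have h2 : ‖x‖ ^ (t + 1) ≤ z ^ 2 :=
        (pow_le_pow_of_le_one (norm_nonneg _) hx1 (by omega : t ≤ t + 1)).trans h1
      have h3 := h.norm_altSum_le (by omega) hxr 0
      have h4 := h.norm_deriv_le (by omega) hxr
      have h5 : ‖x‖ ^ (t + 2) ≤ 1 := pow_le_one₀ (norm_nonneg _) hx1
      have e : (-2 * (1 - x ^ (t + 1)) + (1 - 2 * x) * -((t + 1) * x ^ t)
        + ((t + 2) * x ^ (t + 1) * (1 - altSum t 0 2 x)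
        + x ^ (t + 2) * -deriv (altSum t 0 2) x)) + 2 * 1 =
          2 * x ^ (t + 1) - (1 - 2 * x) * (((t + 1 : ℕ) : ℂ) * x ^ t)
        + (((t + 2 : ℕ) : ℂ) * (x ^ (t + 1) * (1 - altSum t 0 2 x))
        - x ^ (t + 2) * deriv (altSum t 0 2) x) := by push_cast; ring
      rw [e]
      have k1 : ‖2 * x ^ (t + 1)‖ ≤ 2 * z ^ 2 := by
        rw [norm_mul, norm_pow]; norm_num; linarith
      have k2 : ‖1 - 2 * x‖ ≤ 2.2 := by
        refine (_root_.norm_sub_le _ _).trans ?_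
        rw [norm_mul]; norm_num; norm_num at hx; linarith
      have k3 : ‖(1 - 2 * x) * (((t + 1 : ℕ) : ℂ) * x ^ t)‖ ≤ 2.2 * (((t + 1 : ℕ) : ℝ) * z ^ 2) := by
        rw [norm_mul, norm_mul, norm_pow, Complex.norm_natCast]; gcongr
      have k4 : ‖1 - altSum t 0 2 x‖ ≤ 1.1 := by
        refine (_root_.norm_sub_le _ _).trans ?_
        rw [norm_one]; linarith [h.four_le]
      have k5 : ‖((t + 2 : ℕ) : ℂ) * (x ^ (t + 1) * (1 - altSum t 0 2 x))‖ ≤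
          ((t + 2 : ℕ) : ℝ) * (z ^ 2 * 1.1) := by
        rw [norm_mul, norm_mul, norm_pow, Complex.norm_natCast]; gcongr
      have k6 : ‖x ^ (t + 2) * deriv (altSum t 0 2) x‖ ≤ 1 * 0.05 := by
        rw [norm_mul, norm_pow]; gcongr
      have l1 := (_root_.norm_sub_le _ _).trans (add_le_add k1 k3)
      have l2 := (_root_.norm_sub_le _ _).trans (add_le_add k5 k6)
      refine (norm_add_le _ _).trans ((add_le_add l1 l2).trans ?_)
      have m1 : ((t + 1 : ℕ) : ℝ) * z ^ 2 = (1 + z) * z := by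
        push_cast; linear_combination z * h.tz
      have m2 : ((t + 2 : ℕ) : ℝ) * (z ^ 2 * 1.1) = 1.1 * ((1 + 2 * z) * z) := by
        push_cast; linear_combination 1.1 * z * h.tz
      rw [m1, m2]
      nlinarith
  rw [hp0, hq0] at key
  have e : (0 + 2 * q) - (0 + 2 * p) = 2 * (q - p) := by ring
  rw [e, norm_mul] at key
  norm_num at key
  have : ‖q - p‖ = 0 := le_antisymm (by linarith) (norm_nonneg _)
  exact sub_eq_zero.mp (norm_eq_zero.mp this)

lemma norm_clearedNum_le (h : RadiusData t z r) (ht : 16 ≤ t) {q : ℂ} (hq : ‖q‖ ≤ r) :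
    ‖clearedNum t 2 q‖ ≤ 5 := by
  have hr := h.lt
  rw [clearedNum_two (by omega) (hq.trans_lt hr)]
  have h1 : ‖q ^ (t + 1)‖ ≤ 1 / 2 := by
    rw [norm_pow]; exact (pow_le_pow_left₀ (norm_nonneg _) hq _).trans h.pow_le
  have h2 : ‖q‖ ≤ 1 := by linarith
  have h3 := h.norm_altSum_le (by omega) hq 1
  have z4 := h.four_le
  have k1 : ‖1 - q ^ (t + 1)‖ ≤ 1 + 1 / 2 := by
    refine (_root_.norm_sub_le _ _).trans ?_
    rw [norm_one]; linarith
  have k2 : ‖1 - q - q ^ 2‖ ≤ 1 + 1 + 1 := by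
    refine (_root_.norm_sub_le _ _).trans (add_le_add ((_root_.norm_sub_le _ _).trans ?_) ?_)
    · rw [norm_one]; linarith
    · rw [norm_pow]; exact pow_le_one₀ (norm_nonneg _) h2
  have k3 : ‖(1 - q ^ (t + 1)) * (1 - q - q ^ 2)‖ ≤ (1 + 1 / 2) * (1 + 1 + 1) := by
    rw [norm_mul]; gcongr
  have k4 : ‖q * (q ^ (t + 1)) ^ 2‖ ≤ 1 * (1 / 2) ^ 2 := by
    rw [norm_mul, norm_pow (q ^ (t + 1))]; gcongr
  have k5 : ‖q * q ^ (t + 1) * altSum t 1 2 q‖ ≤ 1 * (1 / 2) * (3 * z ^ 4) := by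
    rw [norm_mul, norm_mul]; gcongr
  refine (_root_.norm_sub_le _ _).trans ((add_le_add ((norm_add_le _ _).trans (add_le_add k3 k4)) k5).trans ?_)
  linarith

end RadiusData

/-! ### The circle of radius `1 / rThree t`, and conclusion -/

lemma radiusData_of_rThree {t : ℕ} (ht : 16 ≤ t) {z : ℝ} (hz : z = 1 / t) :
    RadiusData t z (1 / rThree t) ∧
      rThree t = 1 + z * (Real.log 2 + z * (-(Real.log 2 - Real.log 2 ^ 2) / 2)) := by
  have ht' : (16 : ℝ) ≤ t := by exact_mod_cast ht
  have t0 : (t : ℝ) ≠ 0 := by positivity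
  have z0 : 0 < z := by rw [hz]; positivity
  have z1 : z ≤ 1 / 16 := by rw [hz]; exact one_div_le_one_div_of_le (by norm_num) ht'
  have hzt : t * z = 1 := by rw [hz]; field_simp
  have he : rThree t = 1 + z * (Real.log 2 + z * (-(Real.log 2 - Real.log 2 ^ 2) / 2)) := by
    rw [rThree_eq (by omega), hz]; field_simp; ring
  refine ⟨?_, he⟩
  obtain ⟨L1, L2⟩ := log_two_bounds
  obtain ⟨L3, L4, -⟩ := log_two_pow_bounds
  obtain ⟨v, hv⟩ : ∃ v, v = Real.log 2 + z * (-(Real.log 2 - Real.log 2 ^ 2) / 2) := ⟨_, rfl⟩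
  rw [← hv] at he
  obtain ⟨b, hb⟩ : ∃ b, b = (Real.log 2 - Real.log 2 ^ 2) / 2 := ⟨_, rfl⟩
  have hb1 : 0.1063 ≤ b ∧ b ≤ 0.1064 := by rw [hb]; constructor <;> linarith
  have hvb : v = Real.log 2 - z * b := by rw [hv, hb]; ring
  have zb : z * b ≤ 1 / 16 * 0.1064 := mul_le_mul z1 hb1.2 (by linarith) (by norm_num)
  have zb0 : 0 ≤ z * b := mul_nonneg z0.le (by linarith)
  have v1 : 0.686 ≤ v := by rw [hvb]; linarith
  have v2 : v ≤ 0.6932 := by rw [hvb]; linarith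
  have zv : z * v ≤ 1 / 16 * 0.6932 := mul_le_mul z1 v2 (by linarith) (by norm_num)
  have zv0 : 0 < z * v := mul_pos z0 (by linarith)
  have hr0 : 0 < rThree t := by rw [he]; linarith
  have hr1 : 1 / rThree t < 1 := by rw [div_lt_one hr0, he]; linarith
  have hrv : 1 / rThree t * (1 + z * v) ≤ 1 := by rw [← he, one_div_mul_cancel hr0.ne']
  have hlog : Real.log 2 + 0 * z ≤ (1 + z) * (v - z * v ^ 2 / 2) := by
    have : v ^ 2 ≤ 0.6932 ^ 2 := pow_le_pow_left₀ (by linarith) v2 2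
    have k1 : z * (0.2 : ℝ) ≤ z * (v - b - (1 + z) * v ^ 2 / 2) := by
      refine mul_le_mul_of_nonneg_left ?_ z0.le
      norm_num at this
      nlinarith
    have : (1 + z) * (v - z * v ^ 2 / 2) = Real.log 2 + z * (v - b - (1 + z) * v ^ 2 / 2) := by
      linear_combination hvb
    rw [this]; linarith
  refine ⟨z0, z1, hzt, ?_, hr1, ?_, ?_, ?_⟩
  · rw [le_div_iff₀ hr0, he]; linarith
  · refine le_trans (mul_le_mul_of_nonneg_left ?_ (by positivity)) hrv
    nlinarith
  · exact pow_succ_le_half z0 hzt (by positivity) (by linarith) hrv (by linarith)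
  · have := pow_brk_two_le z0 hzt (by positivity) hr1.le (by linarith) hrv hlog
    rw [neg_zero, Real.exp_zero] at this
    exact this.trans (inv_two_pow_le ht hzt)

/-- `rThree` is the expansion of the inverse of the second zero cut after order `z ^ 2`, so the two
radii differ by `r * x * z ^ 3 * v2` with `v2` near `0.29`. -/
lemma SecondData.radius_sub {t : ℕ} {z v v1 v2 x : ℝ} (h : SecondData t z v v1 v2 x) {r : ℝ}
    (hr : RadiusData t z r)
    (he : 1 / r = 1 + z * (Real.log 2 + z * (-(Real.log 2 - Real.log 2 ^ 2) / 2))) :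
    0.2 * z ^ 3 ≤ r - x ∧ r - x ≤ 0.3 * z ^ 3 := by
  obtain ⟨x0, x1, hx⟩ := h.x_bounds
  have hr0 : 0.95 ≤ r := hr.ge
  have hr1 := hr.lt
  have hre : r * (1 + z * (Real.log 2 + z * (-(Real.log 2 - Real.log 2 ^ 2) / 2))) = 1 := by
    rw [← he, mul_one_div_cancel (by linarith)]
  have e : r - x = r * x * (z ^ 3 * v2) := by
    have h1 := h.v_eq
    have h2 := h.v1_eq
    rw [h1, h2] at hx
    linear_combination -r * hx + x * hre
  have z3 : 0 < z ^ 3 := pow_pos h.z_pos 3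
  have hv := h.v2_bd
  have k0 : r * x ≤ 1 * 1 := mul_le_mul hr1.le x1.le (by linarith) (by norm_num)
  have k1 : 0.95 * 0.95 ≤ r * x := mul_le_mul hr0 (by linarith) (by norm_num) (by linarith)
  have k2 : z ^ 3 * 0.288 ≤ z ^ 3 * v2 := mul_le_mul_of_nonneg_left hv.1 z3.le
  have k3 : z ^ 3 * v2 ≤ z ^ 3 * 0.292 := mul_le_mul_of_nonneg_left hv.2 z3.le
  have k4 := mul_le_mul k1 k2 (by positivity) (by linarith)
  have k5 := mul_le_mul k0 k3 (by linarith) (by norm_num)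
  rw [e]
  constructor <;> linarith

lemma resOneTarget_eq {t : ℕ} (ht : t ≠ 0) {z s : ℝ} (hz : z = 1 / t) (hs : s = t / 2 ^ (t + 1)) :
    resOneTarget z s = 1 / 8 + ((t : ℝ) - 2) / 2 ^ (t + 5)
    + (2 * (t : ℝ) ^ 2 + 3 * t - 5) / 2 ^ (2 * t + 7)
    + (9 * (t : ℝ) ^ 3 + 45 * (t : ℝ) ^ 2 + 20 * t - 68) / 2 ^ (3 * t + 10) := by
  have t0 : (t : ℝ) ≠ 0 := by exact_mod_cast ht
  have p1 : (2 : ℝ) ^ (t + 5) = 2 ^ t * 32 := by rw [pow_add]; norm_num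
  have p2 : (2 : ℝ) ^ (2 * t + 7) = (2 ^ t) ^ 2 * 128 := by rw [pow_add, mul_comm 2 t, pow_mul]; norm_num
  have p3 : (2 : ℝ) ^ (3 * t + 10) = (2 ^ t) ^ 3 * 1024 := by
    rw [pow_add, mul_comm 3 t, pow_mul]; norm_num
  rw [resOneTarget, hz, hs, p1, p2, p3, pow_succ]
  field_simp
  ring

lemma one_eighth_le_resOneTarget {z s : ℝ} (hz : 0 ≤ z) (hz' : z ≤ 1 / 16) (hs : 0 ≤ s) :
    1 / 8 ≤ resOneTarget z s := by
  have z2 : z ^ 2 ≤ 1 := pow_le_one₀ hz (by linarith)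
  have z3 : z ^ 3 ≤ z := by
    calc z ^ 3 ≤ z ^ 1 := pow_le_pow_of_le_one hz (by linarith) (by norm_num)
      _ = z := pow_one z
  have z22 : z ^ 2 ≤ 1 / 16 * z := by nlinarith
  have t1 := mul_nonneg hs (by linarith : 0 ≤ (1 - 2 * z) / 16)
  have t2 := mul_nonneg (pow_nonneg hs 2) (by linarith : 0 ≤ (2 + 3 * z - 5 * z ^ 2) / 32)
  have t3 := mul_nonneg (pow_nonneg hs 3)
    (by linarith [sq_nonneg z] : 0 ≤ (9 + 45 * z + 20 * z ^ 2 - 68 * z ^ 3) / 128)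
  rw [resOneTarget]
  linarith

/-- On the circle `‖q - β‖ ≥ 0.2 * z ^ 3`. A cleared denominator below `z ^ 4` would give `1.4 * 0.2
* z ^ 3 ≤ z ^ 4`, impossible for `z ≤ 1 / 16`. The cleared numerator is at most `5`, and `z ^ (-4) =
t ^ 4`. -/
lemma RadiusData.norm_treeNum_le {t : ℕ} {z r β : ℝ} (h : RadiusData t z r) (ht : 16 ≤ t)
    (hβ : 0.95 ≤ β) (hβ0 : redDen t β = 0) (h1 : 0.2 * z ^ 3 ≤ r - β) (h2 : r - β ≤ 0.3 * z ^ 3)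
    {q : ℂ} (hq : ‖q‖ = r) : ‖treeNum t q‖ ≤ 5 * (t : ℝ) ^ 4 * ‖treeDen t q‖ := by
  have z3 := pow_pos h.z_pos 3
  have hN := h.norm_clearedNum_le ht hq.le
  have hP : z ^ 4 ≤ ‖clearedDen t 2 q‖ := by
    by_contra hcon
    rw [not_le] at hcon
    have k1 := h.norm_sub_le ht hβ hβ0 (by linarith) h2 hq.le (by linarith [h.ge]) hcon.le
    have k2 : r - β ≤ ‖q - β‖ := by
      have := norm_sub_norm_le q (β : ℂ)
      rw [hq, Complex.norm_real, Real.norm_of_nonneg (by linarith)] at this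
      exact this
    have k3 : z ^ 4 ≤ 1 / 16 * z ^ 3 := by
      rw [pow_succ z 3]; linarith [mul_le_mul_of_nonneg_left h.z_le z3.le]
    linarith
  have hb := norm_pos_iff.mpr (brkProd_ne_zero (by omega : 1 ≤ t) 2 (hq.trans_lt h.lt))
  rw [clearedNum, norm_mul] at hN
  rw [clearedDen, norm_mul] at hP
  have k4 : (t : ℝ) ^ 4 * z ^ 4 = 1 := by rw [← mul_pow, h.tz, one_pow]
  have k5 := mul_le_mul_of_nonneg_left hP (by positivity : 0 ≤ 5 * (t : ℝ) ^ 4)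
  refine le_of_mul_le_mul_left ?_ hb
  linarith

theorem exists_denZeros_of_ge {t : ℕ} (ht : 16 ≤ t) :
    ∃ α β R R₂ : ℝ, DenZeros t (1 / rThree t) α β R R₂ ∧ TreeNumerics t (1 / α) (1 / β) R R₂ := by
  have ht1 : 1 ≤ t := by omega
  obtain ⟨α, c, hc, hc', hα, hα0⟩ := exists_first_zero ht
  obtain ⟨β, σ, hσ, hβ, hβ0⟩ := exists_second_zero ht
  obtain ⟨z, s, y, d, d1, d2, hA⟩ := hα.exists_data ht hc hc'
  obtain ⟨z', v, v1, v2, hB⟩ := hβ.exists_data ht hσ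
  have hz : z = 1 / t := by rw [eq_div_iff (by positivity), mul_comm]; exact hA.tz
  have hzz : z' = z := by rw [hz, eq_div_iff (by positivity), mul_comm]; exact hB.tz
  subst hzz
  obtain ⟨hR, hRe⟩ := radiusData_of_rThree ht hz
  obtain ⟨r1, r2⟩ := hB.radius_sub hR (by rw [one_div_one_div, hRe])
  obtain ⟨α0, α1⟩ := hA.x_bounds
  obtain ⟨β0, β1, -⟩ := hB.x_bounds
  obtain ⟨wA0, wA1⟩ := hA.omega_bounds ht
  obtain ⟨wB0, wB1⟩ := hB.omega_bounds ht
  obtain ⟨DA, RA⟩ := hA.residue_bounds hc hc' (by rw [abs_of_nonneg wA0]; exact wA1)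
    (hA.abs_deriv_le ht) (hA.abs_sum_le ht)
  obtain ⟨DB, RB⟩ := hB.residue_bounds wB0 wB1 (hB.abs_deriv_le ht) (hB.abs_sum_le ht)
  have hzA := isDenZero_of_redDen ht1 (by linarith) (by linarith) hα0 hA.x_eq rfl rfl rfl DA.ne'
  have hzB := isDenZero_of_redDen ht1 (by linarith) (by linarith) hβ0
    (by rw [hB.x_eq]; congr 1; ring : β = 1 / (2 - (1 - z' * v))) rfl rfl rfl DB.ne
  generalize resNum (y * d) (altSum t 0 2 (α : ℂ)).re (altSum t 1 2 (α : ℂ)).re /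
    resDen t (y * d) (altSum t 0 2 (α : ℂ)).re (deriv (altSum t 0 2) (α : ℂ)).re = R at hzA RA
  generalize resNum (1 - z' * v) (altSum t 0 2 (β : ℂ)).re (altSum t 1 2 (β : ℂ)).re /
    resDen t (1 - z' * v) (altSum t 0 2 (β : ℂ)).re (deriv (altSum t 0 2) (β : ℂ)).re = R₂ at hzB RB
  obtain ⟨L1, L2⟩ := log_two_bounds
  have hz0 := hA.z_pos
  have hz1 := hA.z_le
  have hs4 : s ^ 4 ≤ 1 / 8192 := by
    calc s ^ 4 ≤ s ^ 1 := pow_le_pow_of_le_one hA.s_pos.le (by linarith [hA.s_le]) (by norm_num)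
      _ ≤ _ := by linarith [hA.s_le]
  have hcl : ∀ x : ℝ, 0 ≤ x → x < 1 → redDen t x = 0 → clearedDen t 2 (x : ℂ) = 0 := by
    intro x h0 h1 h
    rw [clearedDen, treeDen_eq_zero_of_redDen ht1 h0 h1 h, mul_zero]
  refine ⟨α, β, R, R₂, ⟨α0, by linarith, ?_, hR.lt, ?_, ?_, hzA, hzB, fun q hq hq0 => ?_,
    fun q hq => hR.norm_treeNum_le ht (by linarith) hβ0 r1 r2 hq⟩, ⟨fun _ => hα.abs_sub_le ht hc hc',
    fun h => absurd h (by omega), fun _ => ?_, fun h => absurd h (by omega), fun _ => ?_,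
    fun h => absurd h (by omega), ?_⟩⟩
  · have := pow_pos hz0 3
    linarith
  · have := one_eighth_le_resOneTarget hz0.le hz1 hA.s_pos.le
    linarith [(abs_le.mp RA).1]
  · have k1 : z' ^ 2 ≤ 1 / 16 * z' := by nlinarith
    have k2 : z' ^ 3 ≤ 1 / 16 * z' := by
      have : z' ^ 3 = z' * z' ^ 2 := by ring
      rw [this]; nlinarith
    have k3 := mul_le_mul_of_nonneg_left k1 (by linarith : 0 ≤ (4 * Real.log 2 + 1) / 8)
    have k4 := mul_lt_mul_of_pos_right L2 hz0
    linarith [(abs_le.mp RB).1]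
  · have hP : clearedDen t 2 q = 0 := by rw [clearedDen, hq0, mul_zero]
    rcases le_total ‖q‖ 0.6 with h | h
    · left
      refine hR.eq_of_clearedDen_eq_zero ht ?_ h (hcl α (by linarith) (by linarith) hα0) hP
      rw [Complex.norm_real, Real.norm_of_nonneg (by linarith)]
      linarith
    · right
      have hz3 := pow_pos hz0 3
      have := hR.norm_sub_le ht (by linarith) hβ0 (by linarith) r2 hq h
        (by rw [hP, norm_zero]; positivity)
      rw [hP, norm_zero] at this
      exact sub_eq_zero.mp (norm_eq_zero.mp (le_antisymm (by linarith) (norm_nonneg _)))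
  · have hs : s = t / 2 ^ (t + 1) := by rw [hA.s_eq, hA.y_eq, mul_one_div]
    rw [← resOneTarget_eq (by omega) hz hs]
    refine RA.trans (le_of_eq ?_)
    rw [hs, mul_comm 4 t, pow_mul, pow_succ (2 : ℝ) t]
    field_simp
    norm_num
  · rw [hβ.inv_eq, add_sub_cancel_left, abs_div, abs_of_nonneg (by positivity : (0 : ℝ) ≤ t ^ 5)]
    gcongr
  · refine le_trans (le_of_eq ?_) (RB.trans (le_of_eq ?_))
    · congr 1; rw [hz]; field_simp
    · rw [hz]; ring

theorem exists_denZeros {t : ℕ} (ht : 2 ≤ t) :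
    ∃ α β R R₂ : ℝ, DenZeros t (1 / rThree t) α β R R₂ ∧ TreeNumerics t (1 / α) (1 / β) R R₂ := by
  rcases le_total t 15 with h | h
  · exact exists_denZeros_of_le ht h
  · rcases h.eq_or_lt with rfl | h
    · exact exists_denZeros_of_le ht le_rfl
    · exact exists_denZeros_of_ge h

theorem mainTheorem2 (t : ℕ) (ht : 2 ≤ t) :
    ∃ F : ℂ → ℂ, IsTreeGeneratingFunction t F ∧
    ∃ ρ ρ₂ R R₂ : ℝ,
      1 < rThree t ∧ rThree t < ρ₂ ∧ ρ₂ < ρ ∧ 0 < R ∧ 0 < R₂ ∧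
      -- exactly two poles in the closed disc, both simple, with their residues
      (∀ q : ℂ, ‖q‖ ≤ 1 / rThree t →
        (IsPole F q ↔ q = ((1 / ρ : ℝ) : ℂ) ∨ q = ((1 / ρ₂ : ℝ) : ℂ))) ∧
      IsSimplePoleWithResidue F ((1 / ρ : ℝ) : ℂ) (-(R : ℂ)) ∧
      IsSimplePoleWithResidue F ((1 / ρ₂ : ℝ) : ℂ) (-(R₂ : ℂ)) ∧
      -- the dominant pole
      (3 ≤ t →
        |ρ - (2 - 1 / 2 ^ (t + 1) - ((t : ℝ) + 3) / 2 ^ (2 * t + 3)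
            - (3 * (t : ℝ) ^ 2 + 19 * t + 24) / 2 ^ (3 * t + 6))|
          ≤ 0.28 * (t : ℝ) ^ 3 / 2 ^ (4 * t)) ∧
      (t = 2 → |ρ - 1.794147187541686| ≤ 1 / 10 ^ 15) ∧
      -- the residue at the dominant pole
      (6 ≤ t →
        |R - (1 / 8 + ((t : ℝ) - 2) / 2 ^ (t + 5)
            + (2 * (t : ℝ) ^ 2 + 3 * t - 5) / 2 ^ (2 * t + 7)
            + (9 * (t : ℝ) ^ 3 + 45 * (t : ℝ) ^ 2 + 20 * t - 68) / 2 ^ (3 * t + 10))|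
          ≤ (t : ℝ) ^ 4 / (50 * 2 ^ (4 * t))) ∧
      (t ≤ 5 → |R - resTable t| ≤ 1 / 10 ^ 16) ∧
      -- the second pole
      (16 ≤ t →
        |ρ₂ - (1 + Real.log 2 / t - (Real.log 2 - Real.log 2 ^ 2) / (2 * (t : ℝ) ^ 2)
            + (4 * Real.log 2 ^ 3 + 3 * Real.log 2 ^ 2 + 6 * Real.log 2) / (24 * (t : ℝ) ^ 3)
            + (2 * Real.log 2 ^ 4 + 54 * Real.log 2 ^ 3 - 27 * Real.log 2 ^ 2 - 6 * Real.log 2)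
                / (48 * (t : ℝ) ^ 4))|
          ≤ 0.26 / (t : ℝ) ^ 5) ∧
      (t ≤ 15 → |ρ₂ - rhoTwoTable t| ≤ 1 / 10 ^ 15) ∧
      -- the residue at the second pole
      |R₂ - (1 / (4 * (t : ℝ)) - (4 * Real.log 2 + 1) / (8 * (t : ℝ) ^ 2))|
        ≤ 0.77 / (t : ℝ) ^ 3 ∧
      -- the bound on the circle
      (∀ q : ℂ, ‖q‖ = 1 / rThree t → ‖F q‖ ≤ 5 * (t : ℝ) ^ 4) := by
  have ht1 : 1 ≤ t := by omega
  obtain ⟨α, β, R, R₂, hz, hn⟩ := exists_denZeros ht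
  have hα := hz.half_lt
  have hαβ := hz.lt
  have hβr := hz.lt_r
  have hr0 : 0 < rThree t := one_div_pos.mp (by linarith)
  refine ⟨treeGF t, hz.isTreeGeneratingFunction ht1, 1 / α, 1 / β, R, R₂, ?_, ?_, ?_, hz.pos,
    hz.pos₂, fun q hq => ?_, ?_, ?_, hn.rho, hn.rho_two, hn.res, hn.res_small, hn.rho₂,
    hn.rho₂_small, hn.res₂, fun q hq => hz.norm_treeGF_le ht1 hq⟩
  · exact (div_lt_one hr0).mp hz.r_lt
  · rw [lt_div_iff₀ (by linarith)]
    rw [lt_div_iff₀ hr0] at hβr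
    linarith
  · exact one_div_lt_one_div_of_lt (by linarith) hαβ
  · rw [one_div_one_div, one_div_one_div]; exact hz.isPole_iff ht1 hq
  · rw [one_div_one_div]
    exact hz.zero.isSimplePole ht1 (by rw [abs_lt]; constructor <;> linarith [hz.r_lt]) hz.pos.ne'
  · rw [one_div_one_div]
    exact hz.zero₂.isSimplePole ht1 (by rw [abs_lt]; constructor <;> linarith [hz.r_lt]) hz.pos₂.ne'
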